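/- Work in univalent type theory: intensional Martin-Löf type theory with a cumulative hierarchy of universes $\mathcal U_0,\mathcal U_1,\dots$, dependent products (with $\eta$), dependent sums, identity types, the natural numbers, the integers $\mathbb Z$ (the inductive type with constructors $\mathrm{zero}:\mathbb Z$ and $\mathrm{pos},\mathrm{neg}:\mathbb N\to\mathbb Z$, where $\mathrm{pos}(n)$ and $\mathrm{neg}(n)$ stand for $n+1$ and $-(n+1)$; $s:\mathbb Z\to\mathbb Z$ is the successor function, $0:=\mathrm{zero}$, $1:=s(0)$), the univalence axiom for every universe, and a propositional truncation $\|X\|$ with $|\cdot|:X\to\|X\|$ which maps each universe to itself, is a proposition, and through which every map from $X$ to a proposition (in any universe) factors; no computation rule for the truncation is assumed, and neither function extensionality nor higher inductive types are assumed. To say that an element of a closed type can be constructed means that there is a closed term for which the judgment that it has this type is derivable. Write $\mathrm{refl}$ for reflexivity. For $B:A\to\mathcal U$, a path $p:x=_A y$, $b:B(x)$ and $b':B(y)$, let $\mathrm{trp}_{B,p}:B(x)\to B(y)$ be transport along $p$ and let $(b=^B_p b')$ be the type $\mathrm{trp}_{B,p}(b)=_{B(y)}b'$ of paths from $b$ to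 $b'$ over $p$; for $f:\prod_{x:A}B(x)$ let $\mathrm{apd}_f(p):f(x)=^B_p f(y)$ be the dependent action of $f$ on $p$. For each universe $\mathcal U=\mathcal U_i$ put $$\mathrm{Tor}_{\mathbb Z}:=\sum_{(X,f):\sum_{X:\mathcal U}(X\to X)}\bigl\|(\mathbb Z,s)=(X,f)\bigr\|,\qquad \mathrm{pt}:=\bigl((\mathbb Z,s),|\mathrm{refl}_{(\mathbb Z,s)}|\bigr):\mathrm{Tor}_{\mathbb Z},$$ and let $\mathrm{ev}_0:(\mathrm{pt}=_{\mathrm{Tor}_{\mathbb Z}}\mathrm{pt})\to\mathbb Z$ send $p$ to the transport of $0$ along the path $\mathbb Z=\mathbb Z$ that $p$ induces on underlying types. **Theorem.** For every universe $\mathcal U_i$ used to form $\mathrm{Tor}_{\mathbb Z}$ and every universe $\mathcal U_j$: 1. One can construct a proof that $\mathrm{ev}_0$ is an equivalence. Given any such proof, let $\circlearrowleft\;:=\mathrm{ev}_0^{-1}(1):\mathrm{pt}=\mathrm{pt}$. 2. (Induction principle of the circle) One can construct an element of $$\prod_{A:\mathrm{Tor}_{\mathbb Z}\to\mathcal U_j}\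 \prod_{a:A(\mathrm{pt})}\ \prod_{p:\,a=^A_{\circlearrowleft}a}\ \sum_{f:\prod_{z:\mathrm{Tor}_{\mathbb Z}}A(z)}\ \sum_{r:\,f(\mathrm{pt})=a}\ \mathrm{apd}_f(\circlearrowleft)=^{\tilde A}_r p,\qquad\text{where }\tilde A(y):=(y=^A_{\circlearrowleft}y)\text{ for }y:A(\mathrm{pt}).$$ 3. (Dependent universal property of the circle) One can construct, for every family $A:\mathrm{Tor}_{\mathbb Z}\to\mathcal U_j$, a section of the evaluation map $$\Bigl(\prod_{z:\mathrm{Tor}_{\mathbb Z}}A(z)\Bigr)\to\sum_{a:A(\mathrm{pt})}(a=^A_{\circlearrowleft}a),\qquad f\mapsto\bigl(f(\mathrm{pt}),\mathrm{apd}_f(\circlearrowleft)\bigr),$$ that is, a map $g$ in the other direction together with an identification of $y$ with the evaluation of $g(y)$, for every $y$. -/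

import Mathlib

/-!
Univalent type theory as a formal system, and the type of `ℤ`-torsors inside it.

The ambient logic of Lean is not univalent, so the type theory is represented by its raw terms and
its judgments.  The system is intensional Martin-Löf type theory with a cumulative hierarchy of
universes `U₀, U₁, …` (à la Russell), dependent products with the `η`-rule, dependent sums, identity
types, the natural numbers, the integers (the inductive type with constructors `zero`, `pos`,
`neg`), the univalence axiom for every universe, and a propositional truncation that has its
universal property but no computation rule.  Function extensionality, propositional resizing,
uniqueness for dependent sums and higher inductive types are not part of the system.
Adding further type formers to it only makes more types inhabited.
-/

namespace HoTT

/-- Raw terms (and types), with de Bruijn indices.  The second argument of `pi`, `lam`, `sigma` is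
under one binder; no other argument is under a binder. -/
inductive Tm : Type
  /-- a variable -/
  | var (n : ℕ)
  /-- the universe `U i` -/
  | univ (i : ℕ)
  /-- `∏ (x : A), B` -/
  | pi (A B : Tm)
  /-- `λ (x : A), b` -/
  | lam (A b : Tm)
  | app (f a : Tm)
  /-- `∑ (x : A), B` -/
  | sigma (A B : Tm)
  | pair (a b : Tm)
  /-- induction for `∑`: motive `C`, branch `g`, at `p` -/
  | sigmaElim (C g p : Tm)
  /-- the identity type `a =_A b` -/
  | idt (A a b : Tm)
  /-- the reflexivity path `refl a : a =_A a` -/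
  | idp (a : Tm)
  /-- (based) path induction: motive `C`, value `c` at reflexivity, at the path `p` -/
  | pathElim (C c p : Tm)
  | nat
  | zero
  | succ (n : Tm)
  | natElim (C z s n : Tm)
  /-- the type of integers -/
  | int
  | izero
  /-- `pos n` stands for `n + 1` -/
  | ipos (n : Tm)
  /-- `neg n` stands for `- (n + 1)` -/
  | ineg (n : Tm)
  | intElim (C z p m k : Tm)
  /-- the propositional truncation `‖A‖` -/
  | trunc (A : Tm)
  /-- `|a| : ‖A‖` -/
  | tr (a : Tm)
  /-- the identification of two elements of `‖A‖` -/
  | squash (x y : Tm)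
  /-- recursion for `‖A‖` into `P`, with `h` witnessing that `P` is a proposition, `g : A → P` -/
  | truncRec (P h g t : Tm)
  /-- the univalence axiom for the universe `U i` -/
  | ua (i : ℕ)

namespace Tm

/-- Extension of a renaming under a binder. -/
def liftRen (ρ : ℕ → ℕ) : ℕ → ℕ
  | 0 => 0
  | n + 1 => ρ n + 1

/-- Renaming of variables. -/
def ren : (ℕ → ℕ) → Tm → Tm
  | ρ, var n => var (ρ n)
  | _, univ i => univ i
  | ρ, pi A B => pi (A.ren ρ) (B.ren (liftRen ρ))
  | ρ, lam A b => lam (A.ren ρ) (b.ren (liftRen ρ))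
  | ρ, app f a => app (f.ren ρ) (a.ren ρ)
  | ρ, sigma A B => sigma (A.ren ρ) (B.ren (liftRen ρ))
  | ρ, pair a b => pair (a.ren ρ) (b.ren ρ)
  | ρ, sigmaElim C g p => sigmaElim (C.ren ρ) (g.ren ρ) (p.ren ρ)
  | ρ, idt A a b => idt (A.ren ρ) (a.ren ρ) (b.ren ρ)
  | ρ, idp a => idp (a.ren ρ)
  | ρ, pathElim C c p => pathElim (C.ren ρ) (c.ren ρ) (p.ren ρ)
  | _, nat => nat
  | _, zero => zero
  | ρ, succ n => succ (n.ren ρ)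
  | ρ, natElim C z s n => natElim (C.ren ρ) (z.ren ρ) (s.ren ρ) (n.ren ρ)
  | _, int => int
  | _, izero => izero
  | ρ, ipos n => ipos (n.ren ρ)
  | ρ, ineg n => ineg (n.ren ρ)
  | ρ, intElim C z p m k => intElim (C.ren ρ) (z.ren ρ) (p.ren ρ) (m.ren ρ) (k.ren ρ)
  | ρ, trunc A => trunc (A.ren ρ)
  | ρ, tr a => tr (a.ren ρ)
  | ρ, squash x y => squash (x.ren ρ) (y.ren ρ)
  | ρ, truncRec P h g t => truncRec (P.ren ρ) (h.ren ρ) (g.ren ρ) (t.ren ρ)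
  | _, ua i => ua i

/-- Weakening by one variable. -/
def wk (t : Tm) : Tm := t.ren (fun n => n + 1)

/-- Extension of a substitution under a binder. -/
def liftSub (σ : ℕ → Tm) : ℕ → Tm
  | 0 => var 0
  | n + 1 => (σ n).wk

/-- Simultaneous (capture avoiding) substitution. -/
def sub : (ℕ → Tm) → Tm → Tm
  | σ, var n => σ n
  | _, univ i => univ i
  | σ, pi A B => pi (A.sub σ) (B.sub (liftSub σ))
  | σ, lam A b => lam (A.sub σ) (b.sub (liftSub σ))
  | σ, app f a => app (f.sub σ) (a.sub σ)
  | σ, sigma A B => sigma (A.sub σ) (B.sub (liftSub σ))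
  | σ, pair a b => pair (a.sub σ) (b.sub σ)
  | σ, sigmaElim C g p => sigmaElim (C.sub σ) (g.sub σ) (p.sub σ)
  | σ, idt A a b => idt (A.sub σ) (a.sub σ) (b.sub σ)
  | σ, idp a => idp (a.sub σ)
  | σ, pathElim C c p => pathElim (C.sub σ) (c.sub σ) (p.sub σ)
  | _, nat => nat
  | _, zero => zero
  | σ, succ n => succ (n.sub σ)
  | σ, natElim C z s n => natElim (C.sub σ) (z.sub σ) (s.sub σ) (n.sub σ)
  | _, int => int
  | _, izero => izero
  | σ, ipos n => ipos (n.sub σ)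
  | σ, ineg n => ineg (n.sub σ)
  | σ, intElim C z p m k => intElim (C.sub σ) (z.sub σ) (p.sub σ) (m.sub σ) (k.sub σ)
  | σ, trunc A => trunc (A.sub σ)
  | σ, tr a => tr (a.sub σ)
  | σ, squash x y => squash (x.sub σ) (y.sub σ)
  | σ, truncRec P h g t => truncRec (P.sub σ) (h.sub σ) (g.sub σ) (t.sub σ)
  | _, ua i => ua i

/-- `B[a]`: the term `a` replaces the variable `0` of `B`. -/
def inst (B a : Tm) : Tm :=
  B.sub (fun n => match n with
    | 0 => a
    | k + 1 => var k)

/-! ### Basic constructions in type theory -/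

/-- `A → B` -/
def arrow (A B : Tm) : Tm := pi A B.wk

/-- `isContr A := ∑ (x : A), ∏ (y : A), x = y` -/
def isContr (A : Tm) : Tm := sigma A (pi A.wk (idt A.wk.wk (var 1) (var 0)))

/-- `isProp A := ∏ (x y : A), x = y` -/
def isProp (A : Tm) : Tm := pi A (pi A.wk (idt A.wk.wk (var 1) (var 0)))

/-- The fiber of `f : A → B` over `b : B`, that is `∑ (x : A), f x = b`. -/
def fiber (A B f b : Tm) : Tm := sigma A (idt B.wk (app f.wk (var 0)) b.wk)

/-- `f : A → B` is an equivalence: all its fibers are contractible. -/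
def isEquiv (A B f : Tm) : Tm := pi B (isContr (fiber A.wk B.wk f.wk (var 0)))

/-- The type `A ≃ B` of equivalences from `A` to `B`. -/
def equiv (A B : Tm) : Tm := sigma (arrow A B) (isEquiv A.wk B.wk (var 0))

/-- The identity equivalence `A ≃ A`.  Its first component is `λ x, x`; the fiber over `y` has the
center `(y, refl)`, and the contraction at `(x, p)` is obtained by induction on `p : x = y`. -/
def idEquiv (A : Tm) : Tm :=
  let idf : Tm := lam A (var 0)
  let A1 : Tm := A.wk
  let A2 : Tm := A1.wk
  let A3 : Tm := A2.wk
  let A4 : Tm := A3.wk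
  let A5 : Tm := A4.wk
  let F1 : Tm := fiber A1 A1 idf.wk (var 0)
  pair idf
    (lam A
      (pair (pair (var 0) (idp (var 0)))
        (lam F1
          (sigmaElim
            (lam F1.wk (idt F1.wk.wk (pair (var 2) (idp (var 2))) (var 0)))
            (lam A2
              (lam (idt A3 (app idf.wk.wk.wk (var 0)) (var 2))
                (pathElim
                  (lam A4
                    (lam (idt A5 (var 2) (var 0))
                      (idt (fiber A5.wk A5.wk idf.wk.wk.wk.wk.wk.wk (var 1))
                        (pair (var 1) (idp (var 1))) (pair (var 3) (var 0)))))
                  (idp (pair (var 1) (idp (var 1))))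
                  (var 0))))
            (var 0)))))

/-- The canonical map `(X = Y) → (X ≃ Y)` for types `X`, `Y` in `U i`, defined by path induction
from the identity equivalence, applied to `p`. -/
def idToEquiv (i : ℕ) (X p : Tm) : Tm :=
  pathElim (lam (univ i) (lam (idt (univ i) X.wk (var 0)) (equiv X.wk.wk (var 1)))) (idEquiv X) p

/-- The univalence axiom for `U i`: for all `X Y : U i`, the canonical map
`(X = Y) → (X ≃ Y)` is an equivalence. -/
def univalence (i : ℕ) : Tm :=
  pi (univ i) (pi (univ i)
    (isEquiv (idt (univ i) (var 1) (var 0)) (equiv (var 1) (var 0))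
      (lam (idt (univ i) (var 1) (var 0)) (idToEquiv i (var 2) (var 0)))))

end Tm

open Tm

/-- Contexts: lists of types, the most recent variable first; each type may use the variables
that come after it in the list. -/
abbrev Ctx : Type := List Tm

/-- The judgments that can be made in a context. -/
inductive Judgment : Type
  /-- the context is well formed -/
  | ctx
  /-- `a : A` -/
  | mem (a A : Tm)
  /-- `a ≡ b : A` -/
  | eq (a b A : Tm)

/-- Derivability of judgments.  A type is an element of some universe. -/
inductive Derivable : Ctx → Judgment → Prop
  -- contexts and variables
  | ctx_nil : Derivable [] .ctx
  | ctx_cons {Γ A i} : Derivable Γ (.mem A (univ i)) → Derivable (A :: Γ) .ctx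
  | var {Γ : Ctx} {n : ℕ} {A} : Derivable Γ .ctx → Γ[n]? = some A →
      Derivable Γ (.mem (var n) (A.ren (fun k => k + (n + 1))))
  -- judgmental equality is a congruence, and is respected by typing
  | eq_refl {Γ a A} : Derivable Γ (.mem a A) → Derivable Γ (.eq a a A)
  | eq_symm {Γ a b A} : Derivable Γ (.eq a b A) → Derivable Γ (.eq b a A)
  | eq_trans {Γ a b c A} : Derivable Γ (.eq a b A) → Derivable Γ (.eq b c A) →
      Derivable Γ (.eq a c A)
  | conv {Γ a A B i} : Derivable Γ (.mem a A) → Derivable Γ (.eq A B (univ i)) →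
      Derivable Γ (.mem a B)
  | eq_conv {Γ a b A B i} : Derivable Γ (.eq a b A) → Derivable Γ (.eq A B (univ i)) →
      Derivable Γ (.eq a b B)
  -- universes
  | univ {Γ i} : Derivable Γ .ctx → Derivable Γ (.mem (univ i) (univ (i + 1)))
  | cumul {Γ A i} : Derivable Γ (.mem A (univ i)) → Derivable Γ (.mem A (univ (i + 1)))
  | eq_cumul {Γ A B i} : Derivable Γ (.eq A B (univ i)) → Derivable Γ (.eq A B (univ (i + 1)))
  -- dependent products
  | pi {Γ A B i} : Derivable Γ (.mem A (univ i)) → Derivable (A :: Γ) (.mem B (univ i)) →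
      Derivable Γ (.mem (pi A B) (univ i))
  | lam {Γ A b B i} : Derivable Γ (.mem A (univ i)) → Derivable (A :: Γ) (.mem b B) →
      Derivable Γ (.mem (lam A b) (pi A B))
  | app {Γ f a A B} : Derivable Γ (.mem f (pi A B)) → Derivable Γ (.mem a A) →
      Derivable Γ (.mem (app f a) (B.inst a))
  | pi_beta {Γ a A b B i} : Derivable Γ (.mem A (univ i)) → Derivable (A :: Γ) (.mem b B) →
      Derivable Γ (.mem a A) → Derivable Γ (.eq (app (lam A b) a) (b.inst a) (B.inst a))
  | pi_eta {Γ f A B} : Derivable Γ (.mem f (pi A B)) →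
      Derivable Γ (.eq f (lam A (app f.wk (var 0))) (pi A B))
  | pi_congr {Γ A A' B B' i} : Derivable Γ (.mem A (univ i)) → Derivable Γ (.eq A A' (univ i)) →
      Derivable (A :: Γ) (.eq B B' (univ i)) → Derivable Γ (.eq (pi A B) (pi A' B') (univ i))
  | lam_congr {Γ A A' b b' B i} : Derivable Γ (.mem A (univ i)) →
      Derivable Γ (.eq A A' (univ i)) → Derivable (A :: Γ) (.eq b b' B) →
      Derivable Γ (.eq (lam A b) (lam A' b') (pi A B))
  | app_congr {Γ f f' a a' A B} : Derivable Γ (.eq f f' (pi A B)) → Derivable Γ (.eq a a' A) →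
      Derivable Γ (.eq (app f a) (app f' a') (B.inst a))
  -- dependent sums
  | sigma {Γ A B i} : Derivable Γ (.mem A (univ i)) → Derivable (A :: Γ) (.mem B (univ i)) →
      Derivable Γ (.mem (sigma A B) (univ i))
  | pair {Γ a b A B i} : Derivable Γ (.mem A (univ i)) → Derivable (A :: Γ) (.mem B (univ i)) →
      Derivable Γ (.mem a A) → Derivable Γ (.mem b (B.inst a)) →
      Derivable Γ (.mem (pair a b) (sigma A B))
  | sigmaElim {Γ C g p A B j} : Derivable Γ (.mem C (arrow (sigma A B) (univ j))) →
      Derivable Γ (.mem g (pi A (pi B (app C.wk.wk (pair (var 1) (var 0)))))) →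
      Derivable Γ (.mem p (sigma A B)) → Derivable Γ (.mem (sigmaElim C g p) (app C p))
  | sigma_beta {Γ C g a b A B j} : Derivable Γ (.mem C (arrow (sigma A B) (univ j))) →
      Derivable Γ (.mem g (pi A (pi B (app C.wk.wk (pair (var 1) (var 0)))))) →
      Derivable Γ (.mem a A) → Derivable Γ (.mem b (B.inst a)) →
      Derivable Γ (.eq (sigmaElim C g (pair a b)) (app (app g a) b) (app C (pair a b)))
  | sigma_congr {Γ A A' B B' i} : Derivable Γ (.mem A (univ i)) →
      Derivable Γ (.eq A A' (univ i)) → Derivable (A :: Γ) (.eq B B' (univ i)) →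
      Derivable Γ (.eq (sigma A B) (sigma A' B') (univ i))
  | pair_congr {Γ a a' b b' A B i} : Derivable Γ (.mem A (univ i)) →
      Derivable (A :: Γ) (.mem B (univ i)) →
      Derivable Γ (.eq a a' A) → Derivable Γ (.eq b b' (B.inst a)) →
      Derivable Γ (.eq (pair a b) (pair a' b') (sigma A B))
  | sigmaElim_congr {Γ C C' g g' p p' A B j} :
      Derivable Γ (.eq C C' (arrow (sigma A B) (univ j))) →
      Derivable Γ (.eq g g' (pi A (pi B (app C.wk.wk (pair (var 1) (var 0)))))) →
      Derivable Γ (.eq p p' (sigma A B)) →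
      Derivable Γ (.eq (sigmaElim C g p) (sigmaElim C' g' p') (app C p))
  -- identity types
  | idt {Γ A a b i} : Derivable Γ (.mem A (univ i)) → Derivable Γ (.mem a A) →
      Derivable Γ (.mem b A) → Derivable Γ (.mem (idt A a b) (univ i))
  | idp {Γ A a} : Derivable Γ (.mem a A) → Derivable Γ (.mem (idp a) (idt A a a))
  | pathElim {Γ C c p A a b j} :
      Derivable Γ (.mem C (pi A (arrow (idt A.wk a.wk (var 0)) (univ j)))) →
      Derivable Γ (.mem c (app (app C a) (idp a))) → Derivable Γ (.mem p (idt A a b)) →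
      Derivable Γ (.mem (pathElim C c p) (app (app C b) p))
  | path_beta {Γ C c A a j} :
      Derivable Γ (.mem C (pi A (arrow (idt A.wk a.wk (var 0)) (univ j)))) →
      Derivable Γ (.mem a A) → Derivable Γ (.mem c (app (app C a) (idp a))) →
      Derivable Γ (.eq (pathElim C c (idp a)) c (app (app C a) (idp a)))
  | idt_congr {Γ A A' a a' b b' i} : Derivable Γ (.eq A A' (univ i)) →
      Derivable Γ (.eq a a' A) → Derivable Γ (.eq b b' A) →
      Derivable Γ (.eq (idt A a b) (idt A' a' b') (univ i))
  | idp_congr {Γ A a a'} : Derivable Γ (.eq a a' A) →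
      Derivable Γ (.eq (idp a) (idp a') (idt A a a))
  | pathElim_congr {Γ C C' c c' p p' A a b j} :
      Derivable Γ (.eq C C' (pi A (arrow (idt A.wk a.wk (var 0)) (univ j)))) →
      Derivable Γ (.eq c c' (app (app C a) (idp a))) → Derivable Γ (.eq p p' (idt A a b)) →
      Derivable Γ (.eq (pathElim C c p) (pathElim C' c' p') (app (app C b) p))
  -- natural numbers
  | nat {Γ} : Derivable Γ .ctx → Derivable Γ (.mem nat (univ 0))
  | zero {Γ} : Derivable Γ .ctx → Derivable Γ (.mem zero nat)
  | succ {Γ n} : Derivable Γ (.mem n nat) → Derivable Γ (.mem (succ n) nat)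
  | natElim {Γ C z s n j} : Derivable Γ (.mem C (arrow nat (univ j))) →
      Derivable Γ (.mem z (app C zero)) →
      Derivable Γ (.mem s (pi nat (arrow (app C.wk (var 0)) (app C.wk (succ (var 0)))))) →
      Derivable Γ (.mem n nat) → Derivable Γ (.mem (natElim C z s n) (app C n))
  | nat_beta_zero {Γ C z s j} : Derivable Γ (.mem C (arrow nat (univ j))) →
      Derivable Γ (.mem z (app C zero)) →
      Derivable Γ (.mem s (pi nat (arrow (app C.wk (var 0)) (app C.wk (succ (var 0)))))) →
      Derivable Γ (.eq (natElim C z s zero) z (app C zero))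
  | nat_beta_succ {Γ C z s n j} : Derivable Γ (.mem C (arrow nat (univ j))) →
      Derivable Γ (.mem z (app C zero)) →
      Derivable Γ (.mem s (pi nat (arrow (app C.wk (var 0)) (app C.wk (succ (var 0)))))) →
      Derivable Γ (.mem n nat) →
      Derivable Γ (.eq (natElim C z s (succ n)) (app (app s n) (natElim C z s n))
        (app C (succ n)))
  | succ_congr {Γ n n'} : Derivable Γ (.eq n n' nat) → Derivable Γ (.eq (succ n) (succ n') nat)
  | natElim_congr {Γ C C' z z' s s' n n' j} : Derivable Γ (.eq C C' (arrow nat (univ j))) →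
      Derivable Γ (.eq z z' (app C zero)) →
      Derivable Γ (.eq s s' (pi nat (arrow (app C.wk (var 0)) (app C.wk (succ (var 0)))))) →
      Derivable Γ (.eq n n' nat) →
      Derivable Γ (.eq (natElim C z s n) (natElim C' z' s' n') (app C n))
  -- integers
  | int {Γ} : Derivable Γ .ctx → Derivable Γ (.mem int (univ 0))
  | izero {Γ} : Derivable Γ .ctx → Derivable Γ (.mem izero int)
  | ipos {Γ n} : Derivable Γ (.mem n nat) → Derivable Γ (.mem (ipos n) int)
  | ineg {Γ n} : Derivable Γ (.mem n nat) → Derivable Γ (.mem (ineg n) int)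
  | intElim {Γ C z p m k j} : Derivable Γ (.mem C (arrow int (univ j))) →
      Derivable Γ (.mem z (app C izero)) →
      Derivable Γ (.mem p (pi nat (app C.wk (ipos (var 0))))) →
      Derivable Γ (.mem m (pi nat (app C.wk (ineg (var 0))))) →
      Derivable Γ (.mem k int) → Derivable Γ (.mem (intElim C z p m k) (app C k))
  | int_beta_zero {Γ C z p m j} : Derivable Γ (.mem C (arrow int (univ j))) →
      Derivable Γ (.mem z (app C izero)) →
      Derivable Γ (.mem p (pi nat (app C.wk (ipos (var 0))))) →
      Derivable Γ (.mem m (pi nat (app C.wk (ineg (var 0))))) →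
      Derivable Γ (.eq (intElim C z p m izero) z (app C izero))
  | int_beta_pos {Γ C z p m n j} : Derivable Γ (.mem C (arrow int (univ j))) →
      Derivable Γ (.mem z (app C izero)) →
      Derivable Γ (.mem p (pi nat (app C.wk (ipos (var 0))))) →
      Derivable Γ (.mem m (pi nat (app C.wk (ineg (var 0))))) →
      Derivable Γ (.mem n nat) →
      Derivable Γ (.eq (intElim C z p m (ipos n)) (app p n) (app C (ipos n)))
  | int_beta_neg {Γ C z p m n j} : Derivable Γ (.mem C (arrow int (univ j))) →
      Derivable Γ (.mem z (app C izero)) →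
      Derivable Γ (.mem p (pi nat (app C.wk (ipos (var 0))))) →
      Derivable Γ (.mem m (pi nat (app C.wk (ineg (var 0))))) →
      Derivable Γ (.mem n nat) →
      Derivable Γ (.eq (intElim C z p m (ineg n)) (app m n) (app C (ineg n)))
  | ipos_congr {Γ n n'} : Derivable Γ (.eq n n' nat) → Derivable Γ (.eq (ipos n) (ipos n') int)
  | ineg_congr {Γ n n'} : Derivable Γ (.eq n n' nat) → Derivable Γ (.eq (ineg n) (ineg n') int)
  | intElim_congr {Γ C C' z z' p p' m m' k k' j} :
      Derivable Γ (.eq C C' (arrow int (univ j))) →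
      Derivable Γ (.eq z z' (app C izero)) →
      Derivable Γ (.eq p p' (pi nat (app C.wk (ipos (var 0))))) →
      Derivable Γ (.eq m m' (pi nat (app C.wk (ineg (var 0))))) →
      Derivable Γ (.eq k k' int) →
      Derivable Γ (.eq (intElim C z p m k) (intElim C' z' p' m' k') (app C k))
  -- propositional truncation: a reflection into propositions, with no computation rule
  | trunc {Γ A i} : Derivable Γ (.mem A (univ i)) → Derivable Γ (.mem (trunc A) (univ i))
  | tr {Γ A a} : Derivable Γ (.mem a A) → Derivable Γ (.mem (tr a) (trunc A))
  | squash {Γ A x y} : Derivable Γ (.mem x (trunc A)) → Derivable Γ (.mem y (trunc A)) →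
      Derivable Γ (.mem (squash x y) (idt (trunc A) x y))
  | truncRec {Γ A P h g t j} : Derivable Γ (.mem P (univ j)) → Derivable Γ (.mem h (isProp P)) →
      Derivable Γ (.mem g (arrow A P)) → Derivable Γ (.mem t (trunc A)) →
      Derivable Γ (.mem (truncRec P h g t) P)
  | trunc_congr {Γ A A' i} : Derivable Γ (.eq A A' (univ i)) →
      Derivable Γ (.eq (trunc A) (trunc A') (univ i))
  | tr_congr {Γ A a a'} : Derivable Γ (.eq a a' A) → Derivable Γ (.eq (tr a) (tr a') (trunc A))
  | squash_congr {Γ A x x' y y'} : Derivable Γ (.eq x x' (trunc A)) →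
      Derivable Γ (.eq y y' (trunc A)) →
      Derivable Γ (.eq (squash x y) (squash x' y') (idt (trunc A) x y))
  | truncRec_congr {Γ A P P' h h' g g' t t' j} : Derivable Γ (.eq P P' (univ j)) →
      Derivable Γ (.eq h h' (isProp P)) → Derivable Γ (.eq g g' (arrow A P)) →
      Derivable Γ (.eq t t' (trunc A)) →
      Derivable Γ (.eq (truncRec P h g t) (truncRec P' h' g' t') P)
  -- univalence
  | ua {Γ i} : Derivable Γ .ctx → Derivable Γ (.mem (ua i) (univalence i))

/-- `⊢ a : A`, in the empty context. -/
def HasType (a A : Tm) : Prop := Derivable [] (.mem a A)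

/-- The closed type `A` has an element: one can construct a closed term of type `A`. -/
def IsInhabited (A : Tm) : Prop := ∃ a : Tm, HasType a A

/-! ### Paths, and paths over paths -/

/-- The first projection `∑ (x : A), B → A`, applied to `p`. -/
def pr1 (A B p : Tm) : Tm := sigmaElim (lam (sigma A B) A.wk) (lam A (lam B (var 1))) p

/-- The inverse of `f : A → B` at `b : B`, for `e : isEquiv A B f`: the first component of the
center of the fiber of `f` over `b`. -/
def invOf (A B f e b : Tm) : Tm :=
  let F : Tm := fiber A B f b
  pr1 A (idt B.wk (app f.wk (var 0)) b.wk)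
    (pr1 F (pi F.wk (idt F.wk.wk (var 1) (var 0))) (app e b))

/-- Transport of `b : B a` along `p : a =_A a'` in the family `B : A → U`, by induction on `p`. -/
def transport (A a B p b : Tm) : Tm :=
  pathElim (lam A (lam (idt A.wk a.wk (var 0)) (app B.wk.wk (var 1)))) b p

/-- The type of paths from `b : B a` to `b' : B a'` over `p : a =_A a'`, for `B : A → U`. -/
def pathOver (A a a' B p b b' : Tm) : Tm := idt (app B a') (transport A a B p b) b'

/-- The action `f a =_B f a'` of `f : A → B` on a path `p : a =_A a'`. -/
def ap (A a B f p : Tm) : Tm :=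
  pathElim
    (lam A (lam (idt A.wk a.wk (var 0))
      (idt B.wk.wk (app f.wk.wk a.wk.wk) (app f.wk.wk (var 1)))))
    (idp (app f a)) p

/-- The dependent action of `f : ∏ (x : A), B x` on a path `p : a =_A a'`: a path from `f a` to
`f a'` over `p`. -/
def apd (A a B f p : Tm) : Tm :=
  pathElim
    (lam A (lam (idt A.wk a.wk (var 0))
      (pathOver A.wk.wk a.wk.wk (var 1) B.wk.wk (var 0)
        (app f.wk.wk a.wk.wk) (app f.wk.wk (var 1)))))
    (idp (app f a)) p

/-! ### The integers and the type of `ℤ`-torsors -/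

/-- The embedding `ℕ → ℤ`, applied to `n`. -/
def embed (n : Tm) : Tm := natElim (lam nat int) izero (lam nat (lam int (ipos (var 1)))) n

/-- Negation of integers, applied to `k`. -/
def negate (k : Tm) : Tm :=
  intElim (lam int int) izero (lam nat (ineg (var 0))) (lam nat (ipos (var 0))) k

/-- The successor function `s : ℤ → ℤ`: `0 ↦ pos 0`, `pos n ↦ pos (n + 1)`, `neg n ↦ - n`. -/
def succZ : Tm :=
  lam int (intElim (lam int int) (ipos zero) (lam nat (ipos (succ (var 0))))
    (lam nat (negate (embed (var 0)))) (var 0))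

/-- `1 := s 0` -/
def oneZ : Tm := app succZ izero

/-- `∑ (X : U i), (X → X)` -/
def Endo (i : ℕ) : Tm := sigma (univ i) (arrow (var 0) (var 0))

/-- `(ℤ, s)` -/
def intEndo : Tm := pair int succZ

/-- `‖(ℤ, s) = (X, f)‖`, where the variable `0` stands for `(X, f) : Endo i`. -/
def mereId (i : ℕ) : Tm := trunc (idt (Endo i) intEndo (var 0))

/-- The type of `ℤ`-torsors, `∑ ((X, f) : ∑ (X : U i), (X → X)), ‖(ℤ, s) = (X, f)‖`. -/
def TorZ (i : ℕ) : Tm := sigma (Endo i) (mereId i)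

/-- The base point `((ℤ, s), |refl|)` of `TorZ i`. -/
def pt : Tm := pair intEndo (tr (idp intEndo))

/-- The underlying type map `TorZ i → U i`, `((X, f), t) ↦ X`. -/
def carrier (i : ℕ) : Tm :=
  lam (TorZ i) (pr1 (univ i) (arrow (var 0) (var 0)) (pr1 (Endo i) (mereId i) (var 0)))

/-- The type `pt = pt` of loops of `TorZ i` at the base point. -/
def loops (i : ℕ) : Tm := idt (TorZ i) pt pt

/-- The map `ev₀ : (pt = pt) → ℤ` that sends `p` to the transport of `0` along the path in `U i`
induced by `p` on the underlying types. -/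
def evZero (i : ℕ) : Tm :=
  lam (loops i)
    (transport (univ i) (app (carrier i) pt) (lam (univ i) (var 0))
      (ap (TorZ i) pt (univ i) (carrier i) (var 0)) izero)

/-- The type expressing that `ev₀` is an equivalence. -/
def evZeroIsEquiv (i : ℕ) : Tm := isEquiv (loops i) int (evZero i)

/-- The loop `ev₀⁻¹ 1 : pt = pt`, where `e` is an element of `evZeroIsEquiv i`. -/
def loop (i : ℕ) (e : Tm) : Tm := invOf (loops i) int (evZero i) e oneZ

/-! ### Universal properties of the circle -/

/-- For `A : C → U`, `c : C` and `s : c = c`, the family `y ↦ (y =^A_s y)` over `A c`. -/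
def loopsOver (C c s A : Tm) : Tm :=
  lam (app A c) (pathOver C.wk c.wk c.wk A.wk s.wk (var 0) (var 0))

/-- The type of algebra sections
`∑ (f : ∏ (z : C), A z) (r : f c = a), apd f s =_r p` (a path over `r` in the family
`y ↦ (y =^A_s y)`), for `A : C → U`, `a : A c` and a path `p` from `a` to `a` over `s`. -/
def algSect (C c s A a p : Tm) : Tm :=
  sigma (pi C (app A.wk (var 0)))
    (sigma (idt (app A.wk c.wk) (app (var 0) c.wk) a.wk)
      (pathOver (app A.wk.wk c.wk.wk) (app (var 1) c.wk.wk) a.wk.wk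
        (loopsOver C.wk.wk c.wk.wk s.wk.wk A.wk.wk) (var 0)
        (apd C.wk.wk c.wk.wk A.wk.wk (var 1) s.wk.wk) p.wk.wk))

/-- The induction principle of the circle for `(C, c, s)` and families of types in `U j`:
`∏ (A : C → U j) (a : A c) (p : a =^A_s a), algSect A a p`. -/
def circleInduction (j : ℕ) (C c s : Tm) : Tm :=
  pi (arrow C (univ j))
    (pi (app (var 0) c.wk)
      (pi (pathOver C.wk.wk c.wk.wk c.wk.wk (var 1) s.wk.wk (var 0) (var 0))
        (algSect C.wk.wk.wk c.wk.wk.wk s.wk.wk.wk (var 2) (var 1) (var 0))))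

/-- `f : X → Y` has a section: `∑ (g : Y → X), ∏ (y : Y), f (g y) = y`. -/
def hasSection (X Y f : Tm) : Tm :=
  sigma (arrow Y X)
    (pi Y.wk (idt Y.wk.wk (app f.wk.wk (app (var 1) (var 0))) (var 0)))

/-- The dependent universal property of the circle for `(C, c, s)` and families of types in `U j`:
for every `A : C → U j`, the map `(∏ (z : C), A z) → ∑ (a : A c), (a =^A_s a)`,
`f ↦ (f c, apd f s)`, has a section. -/
def dependentUniversalProperty (j : ℕ) (C c s : Tm) : Tm :=
  let sections : Tm := pi C.wk (app (var 1) (var 0))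
  let target : Tm := sigma (app (var 0) c.wk)
    (pathOver C.wk.wk c.wk.wk c.wk.wk (var 1) s.wk.wk (var 0) (var 0))
  pi (arrow C (univ j))
    (hasSection sections target
      (lam sections
        (pair (app (var 0) c.wk.wk) (apd C.wk.wk c.wk.wk (var 1) (var 0) s.wk.wk))))

end HoTT

/-!
The closed terms asked for are too long to be derived rule by rule, so most of the proof is by
reflection. Constructions are written as surface terms (`Tr`) with most types left out, an
elaborator (`typeFrom`, `termFrom`) fills them in, and a type checker, run by the kernel, accepts
the results. Nothing is proved about the elaborator; the checker is proved sound for `Derivable`.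

Soundness has to do without the metatheory of type theory: neither subject reduction nor the
injectivity of `∏` is available for `Derivable`. The checked terms (`ATm`) therefore carry the types
that raw terms omit, and the relation `W`, which follows the annotations and gives every subterm its
type, replaces inversion of typing: evaluation of the annotated term preserves it
(`whnfStep_sound`), conversion of terms that satisfy it gives judgmental equality of their erasures,
and inference establishes it. Universe levels are symbolic in the levels `i` and `j` of the theorem,
so that one run of the checker serves for all of them. To compare an annotated term with a raw type
of the theorem, both are evaluated at the levels `testLevels`, from which the symbolic levels can be
recovered (`erase_of_matchesRaw`).

Lemmas are variables: the context starts with the truncation and univalence and is extended by the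
type of each lemma, whose proof is checked in the context of the preceding ones. It is `Realized`
as long as closed terms can be substituted for its variables, and this is preserved by every
checked proof (`Realized.cons_of_check`). A term that has the type of the theorem in such a context
then yields a closed one (`Realized.isInhabited`). In the second part of the theorem a variable
stands for the given proof that `ev₀` is an equivalence (`Realized.isInhabited_of_infersRaw`).

The mathematics that is checked in this way is the following. Univalence gives induction on
equivalences, and hence function extensionality. Homotopy induction then turns the recursion
principle of `(ℤ, s, 0)`, for families over `ℤ` on which the operation over `s` consists of
equivalences, into a universal property: compatible sections of such a family correspond to their
values at `0`. So a point `x` of a torsor `(X, f)` is the value at `0` of a unique map `ℤ → X`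
compatible with `s` and `f`, its orbit. This map is an equivalence, as it is enough to check for
`(X, f) = (ℤ, s)`. By univalence, torsors with a point form a contractible type (`torContrT`), and
the fundamental theorem of identity types (`fibIdT`) makes `ev₀` an equivalence. It carries
composition with the loop to `s`, so the loops inherit the universal property of `ℤ`
(`upLoopsT`).

For the induction principle, given `A`, `a` and `p`, consider over each `z` the type of elements `y`
of `A z` with paths to `y` from the transports of `a` along all paths to `z`, compatible with `p`
(`cone`). Over the base point, the universal property of the loops leaves an element `y` with one
path `a = y`, so this type is contractible; being contractible is a proposition and the type of
torsors is connected, so all these types are contractible (`coneContrT`). Their centers are the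
section of `A` that is required, and the compatibility of the paths is its value on the loop
(`circleIndT`). The section of the evaluation map is obtained from this by repackaging paths in
`∑`-types (`depUnivT`).
-/

/-! ### The substitution calculus of raw terms -/

namespace HoTT

namespace Tm

theorem liftRen_liftRen (ρ ρ' : ℕ → ℕ) :
    (fun n => liftRen ρ' (liftRen ρ n)) = liftRen (fun n => ρ' (ρ n)) := by
  funext n; cases n <;> rfl

theorem ren_ren (t : Tm) (ρ ρ' : ℕ → ℕ) :
    (t.ren ρ).ren ρ' = t.ren (fun n => ρ' (ρ n)) := by
  induction t generalizing ρ ρ' <;> simp_all [ren, liftRen_liftRen]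

theorem liftSub_liftRen (ρ : ℕ → ℕ) (σ : ℕ → Tm) :
    (fun n => liftSub σ (liftRen ρ n)) = liftSub (fun n => σ (ρ n)) := by
  funext n; cases n <;> rfl

theorem sub_ren (t : Tm) (ρ : ℕ → ℕ) (σ : ℕ → Tm) :
    (t.ren ρ).sub σ = t.sub (fun n => σ (ρ n)) := by
  induction t generalizing ρ σ <;> simp_all [ren, sub, liftSub_liftRen]

theorem wk_ren (t : Tm) (ρ : ℕ → ℕ) : t.wk.ren (liftRen ρ) = (t.ren ρ).wk := by
  simp [wk, ren_ren, liftRen]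

theorem ren_liftSub (σ : ℕ → Tm) (ρ : ℕ → ℕ) :
    (fun n => (liftSub σ n).ren (liftRen ρ)) = liftSub (fun n => (σ n).ren ρ) := by
  funext n; cases n
  · rfl
  · exact wk_ren _ _

theorem ren_sub (t : Tm) (σ : ℕ → Tm) (ρ : ℕ → ℕ) :
    (t.sub σ).ren ρ = t.sub (fun n => (σ n).ren ρ) := by
  induction t generalizing ρ σ <;> simp_all [ren, sub, ren_liftSub]

theorem wk_sub (t : Tm) (σ : ℕ → Tm) : t.wk.sub (liftSub σ) = (t.sub σ).wk := by
  simp [wk, sub_ren, ren_sub, liftSub]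

theorem sub_liftSub (σ τ : ℕ → Tm) :
    (fun n => (liftSub σ n).sub (liftSub τ)) = liftSub (fun n => (σ n).sub τ) := by
  funext n; cases n
  · rfl
  · exact wk_sub _ _

theorem sub_sub (t : Tm) (σ τ : ℕ → Tm) :
    (t.sub σ).sub τ = t.sub (fun n => (σ n).sub τ) := by
  induction t generalizing σ τ <;> simp_all [sub, sub_liftSub]

theorem liftSub_var : liftSub var = var := by
  funext n; cases n <;> rfl

theorem sub_var (t : Tm) : t.sub var = t := by
  induction t <;> simp_all [sub, liftSub_var]

theorem liftSub_comp_ren (ρ : ℕ → ℕ) :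
    liftSub (fun n => Tm.var (ρ n)) = fun n => var (liftRen ρ n) := by
  funext n; cases n <;> rfl

theorem ren_eq_sub (t : Tm) (ρ : ℕ → ℕ) : t.ren ρ = t.sub (fun n => Tm.var (ρ n)) := by
  induction t generalizing ρ <;> simp_all [ren, sub, liftSub_comp_ren]

/-- The substitution of `a` for the variable `0`, which lowers the other variables. -/
def single (a : Tm) : ℕ → Tm
  | 0 => a
  | k + 1 => var k

theorem inst_eq (B a : Tm) : B.inst a = B.sub (single a) := by
  unfold inst; congr 1

theorem wk_inst (t a : Tm) : t.wk.inst a = t := by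
  simp only [inst_eq, wk, sub_ren]; exact sub_var t

theorem inst_sub (B a : Tm) (σ : ℕ → Tm) :
    (B.inst a).sub σ = (B.sub (liftSub σ)).inst (a.sub σ) := by
  simp only [inst_eq, sub_sub]
  congr 1; funext n; cases n
  · rfl
  · simp only [liftSub, ← inst_eq, wk_inst]; rfl

theorem isContr_sub (A : Tm) (σ : ℕ → Tm) : (isContr A).sub σ = isContr (A.sub σ) := by
  simp [isContr, sub, wk_sub, liftSub]
  simp [wk, ren]

theorem isProp_sub (A : Tm) (σ : ℕ → Tm) : (isProp A).sub σ = isProp (A.sub σ) := by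
  simp [isProp, sub, wk_sub, liftSub]
  simp [wk, ren]

theorem arrow_sub (A B : Tm) (σ : ℕ → Tm) :
    (arrow A B).sub σ = arrow (A.sub σ) (B.sub σ) := by
  simp [arrow, sub, wk_sub]

theorem fiber_sub (A B f b : Tm) (σ : ℕ → Tm) :
    (fiber A B f b).sub σ = fiber (A.sub σ) (B.sub σ) (f.sub σ) (b.sub σ) := by
  simp [fiber, sub, wk_sub, liftSub]

theorem isEquiv_sub (A B f : Tm) (σ : ℕ → Tm) :
    (isEquiv A B f).sub σ = isEquiv (A.sub σ) (B.sub σ) (f.sub σ) := by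
  simp [isEquiv, sub, isContr_sub, fiber_sub, wk_sub, liftSub]

theorem equiv_sub (A B : Tm) (σ : ℕ → Tm) :
    (equiv A B).sub σ = equiv (A.sub σ) (B.sub σ) := by
  simp [equiv, sub, isEquiv_sub, arrow_sub, wk_sub, liftSub]

theorem idEquiv_sub (A : Tm) (σ : ℕ → Tm) : (idEquiv A).sub σ = idEquiv (A.sub σ) := by
  simp [idEquiv, sub, fiber_sub, wk_sub, liftSub]
  simp [wk, ren]

theorem idToEquiv_sub (i : ℕ) (X p : Tm) (σ : ℕ → Tm) :
    (idToEquiv i X p).sub σ = idToEquiv i (X.sub σ) (p.sub σ) := by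
  simp [idToEquiv, sub, idEquiv_sub, equiv_sub, wk_sub, liftSub]
  simp [wk, ren]

theorem univalence_sub (i : ℕ) (σ : ℕ → Tm) : (univalence i).sub σ = univalence i := by
  simp [univalence, sub, isEquiv_sub, equiv_sub, idToEquiv_sub, liftSub]
  simp [wk, ren]

end Tm

open Tm

namespace Judgment

/-- Renaming of variables in a judgment. -/
def ren (ρ : ℕ → ℕ) : Judgment → Judgment
  | ctx => ctx
  | mem a A => mem (a.ren ρ) (A.ren ρ)
  | eq a b A => eq (a.ren ρ) (b.ren ρ) (A.ren ρ)

/-- Substitution in a judgment. -/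
def sub (σ : ℕ → Tm) : Judgment → Judgment
  | ctx => ctx
  | mem a A => mem (a.sub σ) (A.sub σ)
  | eq a b A => eq (a.sub σ) (b.sub σ) (A.sub σ)

end Judgment

/-- The type of the variable `n` in the context `Γ`, weakened to all of `Γ`, is `A`. -/
def VarTy (Γ : Ctx) (n : ℕ) (A : Tm) : Prop :=
  ∃ B, Γ[n]? = some B ∧ A = B.ren (fun k => k + (n + 1))

theorem VarTy.zero {Γ : Ctx} {A : Tm} : VarTy (A :: Γ) 0 A.wk := ⟨A, rfl, rfl⟩

theorem VarTy.succ {Γ : Ctx} {n : ℕ} {A B : Tm} (h : VarTy Γ n A) :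
    VarTy (B :: Γ) (n + 1) A.wk := by
  obtain ⟨C, hC, rfl⟩ := h
  exact ⟨C, by simpa using hC, by simp [wk, ren_ren]; rfl⟩

theorem VarTy.cons_cases {Γ : Ctx} {n : ℕ} {A B : Tm} (h : VarTy (B :: Γ) n A) :
    (n = 0 ∧ A = B.wk) ∨ ∃ m A', n = m + 1 ∧ VarTy Γ m A' ∧ A = A'.wk := by
  obtain ⟨C, hC, rfl⟩ := h
  cases n with
  | zero => left; simp at hC; subst hC; exact ⟨rfl, rfl⟩
  | succ m =>
    right
    exact ⟨m, _, rfl, ⟨C, by simpa using hC, rfl⟩, by simp [wk, ren_ren]; rfl⟩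

/-- `ρ` is a renaming of the variables of `Γ` by variables of `Δ` with the same types. -/
def RenOK (ρ : ℕ → ℕ) (Γ Δ : Ctx) : Prop := ∀ n A, VarTy Γ n A → VarTy Δ (ρ n) (A.ren ρ)

theorem RenOK.lift {ρ : ℕ → ℕ} {Γ Δ : Ctx} (h : RenOK ρ Γ Δ) (A : Tm) :
    RenOK (liftRen ρ) (A :: Γ) (A.ren ρ :: Δ) := by
  intro n B hB
  rcases hB.cons_cases with ⟨rfl, rfl⟩ | ⟨m, A', rfl, h', rfl⟩
  · rw [wk_ren]; exact .zero
  · rw [wk_ren]; exact (h _ _ h').succ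

theorem RenOK.wk (Γ : Ctx) (A : Tm) : RenOK (fun n => n + 1) Γ (A :: Γ) :=
  fun _ _ h => h.succ

theorem Derivable.varTy {Γ : Ctx} {n : ℕ} {A : Tm} (hΓ : Derivable Γ .ctx) (h : VarTy Γ n A) :
    Derivable Γ (.mem (.var n) A) := by
  obtain ⟨B, hB, rfl⟩ := h
  exact .var hΓ hB

set_option linter.unusedSimpArgs false in
/-- Derivable judgments are stable under every class of substitutions that is closed under
extension by a variable.  Renamings and then arbitrary substitutions are instances. -/
theorem Derivable.sub_of {P : (ℕ → Tm) → Ctx → Ctx → Prop}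
    (hvar : ∀ {σ Γ Δ n A}, P σ Γ Δ → Derivable Δ .ctx → VarTy Γ n A →
      Derivable Δ (.mem (σ n) (A.sub σ)))
    (hlift : ∀ {σ Γ Δ A}, P σ Γ Δ → Derivable (A.sub σ :: Δ) .ctx →
      P (liftSub σ) (A :: Γ) (A.sub σ :: Δ))
    {Γ : Ctx} {J : Judgment} (h : Derivable Γ J) :
    ∀ {Δ : Ctx} {σ : ℕ → Tm}, P σ Γ Δ → Derivable Δ .ctx → Derivable Δ (J.sub σ) := by
  induction h with
  | ctx_nil => intro Δ σ _ h; exact h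
  | ctx_cons => intro Δ σ _ h; exact h
  | var _ h _ => intro Δ σ hσ hΔ; exact hvar hσ hΔ ⟨_, h, rfl⟩
  | ua => intro Δ σ _ h; simp only [Judgment.sub, univalence_sub]; exact .ua h
  | univ => intro Δ σ _ h; exact .univ h
  | nat => intro Δ σ _ h; exact .nat h
  | zero => intro Δ σ _ h; exact .zero h
  | int => intro Δ σ _ h; exact .int h
  | izero => intro Δ σ _ h; exact .izero h
  | eq_refl _ h₀ | eq_symm _ h₀ | cumul _ h₀ | eq_cumul _ h₀ | pi_eta _ h₀ | idp _ h₀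
  | idp_congr _ h₀ | succ _ h₀ | succ_congr _ h₀ | ipos _ h₀ | ineg _ h₀ | ipos_congr _ h₀
  | ineg_congr _ h₀ | trunc _ h₀ | tr _ h₀ | trunc_congr _ h₀ | tr_congr _ h₀ =>
    intro Δ σ hσ hΔ
    replace h₀ := h₀ hσ hΔ
    simp only [Judgment.sub, Tm.sub, inst_sub, arrow_sub, isProp_sub, wk_sub, liftSub]
      at h₀ ⊢
    first
      | exact .eq_refl h₀ | exact .eq_symm h₀ | exact .cumul h₀ | exact .eq_cumul h₀
      | exact .pi_eta h₀ | exact .idp h₀ | exact .idp_congr h₀ | exact .succ h₀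
      | exact .succ_congr h₀ | exact .ipos h₀ | exact .ineg h₀ | exact .ipos_congr h₀
      | exact .ineg_congr h₀ | exact .trunc h₀ | exact .tr h₀ | exact .trunc_congr h₀
      | exact .tr_congr h₀
  | eq_trans _ _ h₀ h₁ | conv _ _ h₀ h₁ | eq_conv _ _ h₀ h₁ | app _ _ h₀ h₁ | app_congr _ _ h₀ h₁
  | squash _ _ h₀ h₁ | squash_congr _ _ h₀ h₁ =>
    intro Δ σ hσ hΔ
    replace h₀ := h₀ hσ hΔ
    replace h₁ := h₁ hσ hΔ
    simp only [Judgment.sub, Tm.sub, inst_sub, arrow_sub, isProp_sub, wk_sub, liftSub]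
      at h₀ h₁ ⊢
    first
      | exact .eq_trans h₀ h₁ | exact .conv h₀ h₁ | exact .eq_conv h₀ h₁ | exact .app h₀ h₁
      | exact .app_congr h₀ h₁ | exact .squash h₀ h₁ | exact .squash_congr h₀ h₁
  | pi _ _ h₀ h₁ | lam _ _ h₀ h₁ | sigma _ _ h₀ h₁ =>
    intro Δ σ hσ hΔ
    replace h₀ := h₀ hσ hΔ
    replace h₁ := h₁ (hlift hσ (.ctx_cons h₀)) (.ctx_cons h₀)
    simp only [Judgment.sub, Tm.sub, inst_sub, arrow_sub, isProp_sub, wk_sub, liftSub]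
      at h₀ h₁ ⊢
    first
      | exact .pi h₀ h₁ | exact .lam h₀ h₁ | exact .sigma h₀ h₁
  | pi_beta _ _ _ h₀ h₁ h₂ =>
    intro Δ σ hσ hΔ
    replace h₀ := h₀ hσ hΔ
    replace h₁ := h₁ (hlift hσ (.ctx_cons h₀)) (.ctx_cons h₀)
    replace h₂ := h₂ hσ hΔ
    simp only [Judgment.sub, Tm.sub, inst_sub, arrow_sub, isProp_sub, wk_sub, liftSub]
      at h₀ h₁ h₂ ⊢
    exact .pi_beta h₀ h₁ h₂
  | pi_congr _ _ _ h₀ h₁ h₂ | lam_congr _ _ _ h₀ h₁ h₂ | sigma_congr _ _ _ h₀ h₁ h₂ =>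
    intro Δ σ hσ hΔ
    replace h₀ := h₀ hσ hΔ
    replace h₁ := h₁ hσ hΔ
    replace h₂ := h₂ (hlift hσ (.ctx_cons h₀)) (.ctx_cons h₀)
    simp only [Judgment.sub, Tm.sub, inst_sub, arrow_sub, isProp_sub, wk_sub, liftSub]
      at h₀ h₁ h₂ ⊢
    first
      | exact .pi_congr h₀ h₁ h₂ | exact .lam_congr h₀ h₁ h₂ | exact .sigma_congr h₀ h₁ h₂
  | pair _ _ _ _ h₀ h₁ h₂ h₃ | pair_congr _ _ _ _ h₀ h₁ h₂ h₃ =>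
    intro Δ σ hσ hΔ
    replace h₀ := h₀ hσ hΔ
    replace h₁ := h₁ (hlift hσ (.ctx_cons h₀)) (.ctx_cons h₀)
    replace h₂ := h₂ hσ hΔ
    replace h₃ := h₃ hσ hΔ
    simp only [Judgment.sub, Tm.sub, inst_sub, arrow_sub, isProp_sub, wk_sub, liftSub]
      at h₀ h₁ h₂ h₃ ⊢
    first
      | exact .pair h₀ h₁ h₂ h₃ | exact .pair_congr h₀ h₁ h₂ h₃
  | sigmaElim _ _ _ h₀ h₁ h₂ | sigmaElim_congr _ _ _ h₀ h₁ h₂ | idt _ _ _ h₀ h₁ h₂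
  | pathElim _ _ _ h₀ h₁ h₂ | path_beta _ _ _ h₀ h₁ h₂ | idt_congr _ _ _ h₀ h₁ h₂
  | pathElim_congr _ _ _ h₀ h₁ h₂ | nat_beta_zero _ _ _ h₀ h₁ h₂ =>
    intro Δ σ hσ hΔ
    replace h₀ := h₀ hσ hΔ
    replace h₁ := h₁ hσ hΔ
    replace h₂ := h₂ hσ hΔ
    simp only [Judgment.sub, Tm.sub, inst_sub, arrow_sub, isProp_sub, wk_sub, liftSub]
      at h₀ h₁ h₂ ⊢
    first
      | exact .sigmaElim h₀ h₁ h₂ | exact .sigmaElim_congr h₀ h₁ h₂ | exact .idt h₀ h₁ h₂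
      | exact .pathElim h₀ h₁ h₂ | exact .path_beta h₀ h₁ h₂ | exact .idt_congr h₀ h₁ h₂
      | exact .pathElim_congr h₀ h₁ h₂ | exact .nat_beta_zero h₀ h₁ h₂
  | sigma_beta _ _ _ _ h₀ h₁ h₂ h₃ | natElim _ _ _ _ h₀ h₁ h₂ h₃
  | nat_beta_succ _ _ _ _ h₀ h₁ h₂ h₃ | natElim_congr _ _ _ _ h₀ h₁ h₂ h₃
  | int_beta_zero _ _ _ _ h₀ h₁ h₂ h₃ | truncRec _ _ _ _ h₀ h₁ h₂ h₃
  | truncRec_congr _ _ _ _ h₀ h₁ h₂ h₃ =>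
    intro Δ σ hσ hΔ
    replace h₀ := h₀ hσ hΔ
    replace h₁ := h₁ hσ hΔ
    replace h₂ := h₂ hσ hΔ
    replace h₃ := h₃ hσ hΔ
    simp only [Judgment.sub, Tm.sub, inst_sub, arrow_sub, isProp_sub, wk_sub, liftSub]
      at h₀ h₁ h₂ h₃ ⊢
    first
      | exact .sigma_beta h₀ h₁ h₂ h₃ | exact .natElim h₀ h₁ h₂ h₃
      | exact .nat_beta_succ h₀ h₁ h₂ h₃ | exact .natElim_congr h₀ h₁ h₂ h₃
      | exact .int_beta_zero h₀ h₁ h₂ h₃ | exact .truncRec h₀ h₁ h₂ h₃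
      | exact .truncRec_congr h₀ h₁ h₂ h₃
  | intElim _ _ _ _ _ h₀ h₁ h₂ h₃ h₄ | int_beta_pos _ _ _ _ _ h₀ h₁ h₂ h₃ h₄
  | int_beta_neg _ _ _ _ _ h₀ h₁ h₂ h₃ h₄ | intElim_congr _ _ _ _ _ h₀ h₁ h₂ h₃ h₄ =>
    intro Δ σ hσ hΔ
    replace h₀ := h₀ hσ hΔ
    replace h₁ := h₁ hσ hΔ
    replace h₂ := h₂ hσ hΔ
    replace h₃ := h₃ hσ hΔ
    replace h₄ := h₄ hσ hΔ
    simp only [Judgment.sub, Tm.sub, inst_sub, arrow_sub, isProp_sub, wk_sub, liftSub]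
      at h₀ h₁ h₂ h₃ h₄ ⊢
    first
      | exact .intElim h₀ h₁ h₂ h₃ h₄ | exact .int_beta_pos h₀ h₁ h₂ h₃ h₄
      | exact .int_beta_neg h₀ h₁ h₂ h₃ h₄ | exact .intElim_congr h₀ h₁ h₂ h₃ h₄

theorem Derivable.ren {Γ Δ : Ctx} {J : Judgment} {ρ : ℕ → ℕ} (h : Derivable Γ J)
    (hρ : RenOK ρ Γ Δ) (hΔ : Derivable Δ .ctx) : Derivable Δ (J.ren ρ) := by
  have key : Derivable Δ (J.sub (fun n => Tm.var (ρ n))) := by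
    refine h.sub_of (P := fun σ Γ Δ => ∃ ρ, σ = (fun n => Tm.var (ρ n)) ∧ RenOK ρ Γ Δ)
      ?_ ?_ ⟨ρ, rfl, hρ⟩ hΔ
    · rintro _ Γ Δ n A ⟨ρ, rfl, hρ⟩ hΔ hA
      rw [← ren_eq_sub]
      exact .varTy hΔ (hρ _ _ hA)
    · rintro _ Γ Δ A ⟨ρ, rfl, hρ⟩ -
      refine ⟨liftRen ρ, liftSub_comp_ren ρ, ?_⟩
      rw [← ren_eq_sub]
      exact hρ.lift A
  cases J <;> simpa only [Judgment.ren, Judgment.sub, ren_eq_sub] using key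

theorem Derivable.weaken {Γ : Ctx} {A a B : Tm} (h : Derivable Γ (.mem a B))
    (hA : Derivable (A :: Γ) .ctx) : Derivable (A :: Γ) (.mem a.wk B.wk) :=
  h.ren (RenOK.wk Γ A) hA

/-- `σ` is a substitution of terms in the context `Δ` for the variables of `Γ`. -/
def SubOK (σ : ℕ → Tm) (Γ Δ : Ctx) : Prop :=
  ∀ n A, VarTy Γ n A → Derivable Δ (.mem (σ n) (A.sub σ))

theorem SubOK.lift {σ : ℕ → Tm} {Γ Δ : Ctx} {A : Tm} (h : SubOK σ Γ Δ)
    (hA : Derivable (A.sub σ :: Δ) .ctx) : SubOK (liftSub σ) (A :: Γ) (A.sub σ :: Δ) := by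
  intro n B hB
  rcases hB.cons_cases with ⟨rfl, rfl⟩ | ⟨m, A', rfl, h', rfl⟩
  · rw [wk_sub]; exact .varTy hA .zero
  · rw [wk_sub]; exact (h _ _ h').weaken hA

theorem Derivable.sub {Γ Δ : Ctx} {J : Judgment} {σ : ℕ → Tm} (h : Derivable Γ J)
    (hσ : SubOK σ Γ Δ) (hΔ : Derivable Δ .ctx) : Derivable Δ (J.sub σ) :=
  h.sub_of (P := SubOK) (fun h _ hA => h _ _ hA) (fun h hA => h.lift hA) hσ hΔ

theorem SubOK.single {Γ : Ctx} {A a : Tm} (hΓ : Derivable Γ .ctx) (ha : Derivable Γ (.mem a A)) :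
    SubOK (single a) (A :: Γ) Γ := by
  intro n B hB
  rcases hB.cons_cases with ⟨rfl, rfl⟩ | ⟨m, A', rfl, h', rfl⟩
  · rw [← inst_eq, wk_inst]; exact ha
  · rw [← inst_eq, wk_inst]; exact .varTy hΓ h'

end HoTT

namespace HoTT

/-! ### Annotated terms -/

/-- Universe levels of annotated terms, as functions of the two levels `(i, j)` of the theorem:
`n k` is the constant `k`, and `i k`, `j k`, `m k` are `i + k`, `j + k`, `i + j + 1 + k`. -/
inductive Lv : Type
  | n (k : ℕ)
  | i (k : ℕ)
  | j (k : ℕ)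
  | m (k : ℕ)
  | max (a b : Lv)

namespace Lv

/-- The value of a level. -/
def eval (v : ℕ × ℕ) : Lv → ℕ
  | n k => k
  | i k => v.1 + k
  | j k => v.2 + k
  | m k => v.1 + v.2 + 1 + k
  | max a b => Nat.max (a.eval v) (b.eval v)

/-- The next level. -/
def succ : Lv → Lv
  | n k => n (k + 1)
  | i k => i (k + 1)
  | j k => j (k + 1)
  | m k => m (k + 1)
  | max a b => max a.succ b.succ

/-- A sufficient test for `a ≤ b` whatever the values of `i` and `j`, where `a` is not a maximum. -/
def leAtom (a : Lv) : Lv → Bool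
  | max b c => leAtom a b || leAtom a c
  | n l => match a with
    | n k => Nat.ble k l
    | _ => false
  | i l => match a with
    | n k => Nat.ble k l
    | i k => Nat.ble k l
    | _ => false
  | j l => match a with
    | n k => Nat.ble k l
    | j k => Nat.ble k l
    | _ => false
  | m l => match a with
    | n k => Nat.ble k (l + 1)
    | i k => Nat.ble k (l + 1)
    | j k => Nat.ble k (l + 1)
    | m k => Nat.ble k l
    | _ => false

/-- A sufficient test for `a ≤ b` whatever the values of `i` and `j`. -/
def le : Lv → Lv → Bool
  | max a b, c => le a c && le b c
  | a, c => leAtom a c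

/-- The maximum of two levels, which is one of the two if they are comparable. -/
def sup (a b : Lv) : Lv := bif le a b then b else bif le b a then a else max a b

end Lv

/-- Annotated terms.  They differ from raw terms in three ways: universe levels are symbolic; the
eliminators have motives and branches that are terms under binders, and together with pairs they
carry the types of their arguments; and a change of type along a judgmental equality or an
inclusion of universes is marked by `ann`.  Hence an annotated term has at most one type, up to
syntactic equality of raw terms. -/
inductive ATm : Type
  | var (n : ℕ)
  | univ (l : Lv)
  | pi (A B : ATm)
  | lam (A b : ATm)
  | app (f a : ATm)
  | sigma (A B : ATm)
  | pair (A B a b : ATm)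
  /-- the first projection of `p : sigma A B` -/
  | fst (A B p : ATm)
  /-- the second projection of `p : sigma A B` -/
  | snd (A B p : ATm)
  /-- induction for `p : sigma A B`: the motive `M` is under one binder, the branch `c` is under
  two -/
  | split (A B M c p : ATm)
  | idt (A a b : ATm)
  | idp (a : ATm)
  /-- path induction for `p : a =_A b`: the motive `M` is under two binders -/
  | pathInd (A a b M c p : ATm)
  | nat
  | zero
  | succ (n : ATm)
  /-- the motive `M` is under one binder, the branch `s` is under two -/
  | natInd (M z s n : ATm)
  | int
  | izero
  | ipos (n : ATm)
  | ineg (n : ATm)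
  /-- the motive `M` and the branches `p` and `m` are under one binder -/
  | intInd (M z p m k : ATm)
  | trunc (A : ATm)
  | tr (a : ATm)
  /-- the term `t`, considered as a term of type `T` -/
  | ann (t T : ATm)

/-- Contexts of annotated types, the most recent variable first. -/
abbrev ACtx : Type := List ATm

/-- The first projection as a raw term, for `p : sigma A B`. -/
def Tm.fst (A B p : Tm) : Tm :=
  .sigmaElim (.lam (.sigma A B) A.wk) (.lam A (.lam B (.var 1))) p

/-- The second projection as a raw term, for `p : sigma A B`. -/
def Tm.snd (A B p : Tm) : Tm :=
  .sigmaElim (.lam (.sigma A B) ((B.ren (liftRen Nat.succ)).inst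
    (Tm.fst A.wk (B.ren (liftRen Nat.succ)) (.var 0)))) (.lam A (.lam B (.var 0))) p

namespace ATm

/-- The raw term underlying an annotated term, for the values `v` of `i` and `j`. -/
def erase (v : ℕ × ℕ) : ATm → Tm
  | var n => .var n
  | univ l => .univ (l.eval v)
  | pi A B => .pi (A.erase v) (B.erase v)
  | lam A b => .lam (A.erase v) (b.erase v)
  | app f a => .app (f.erase v) (a.erase v)
  | sigma A B => .sigma (A.erase v) (B.erase v)
  | pair _ _ a b => .pair (a.erase v) (b.erase v)
  | fst A B p => .fst (A.erase v) (B.erase v) (p.erase v)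
  | snd A B p => .snd (A.erase v) (B.erase v) (p.erase v)
  | split A B M c p => .sigmaElim (.lam (.sigma (A.erase v) (B.erase v)) (M.erase v))
      (.lam (A.erase v) (.lam (B.erase v) (c.erase v))) (p.erase v)
  | idt A a b => .idt (A.erase v) (a.erase v) (b.erase v)
  | idp a => .idp (a.erase v)
  | pathInd A a _ M c p => .pathElim
      (.lam (A.erase v) (.lam (.idt (A.erase v).wk (a.erase v).wk (.var 0)) (M.erase v)))
      (c.erase v) (p.erase v)
  | nat => .nat
  | zero => .zero
  | succ n => .succ (n.erase v)
  | natInd M z s n => .natElim (.lam .nat (M.erase v)) (z.erase v)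
      (.lam .nat (.lam (M.erase v) (s.erase v))) (n.erase v)
  | int => .int
  | izero => .izero
  | ipos n => .ipos (n.erase v)
  | ineg n => .ineg (n.erase v)
  | intInd M z p m k => .intElim (.lam .int (M.erase v)) (z.erase v)
      (.lam .nat (p.erase v)) (.lam .nat (m.erase v)) (k.erase v)
  | trunc A => .trunc (A.erase v)
  | tr a => .tr (a.erase v)
  | ann t _ => t.erase v

/-- Replacement of the variables and universes of a term, by functions of the number of binders
above them. -/
def trav (f : ℕ → ℕ → ATm) (g : ℕ → Lv → ATm) : ATm → ℕ → ATm
  | var n, k => f k n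
  | univ l, k => g k l
  | pi A B, k => pi (A.trav f g k) (B.trav f g (k + 1))
  | lam A b, k => lam (A.trav f g k) (b.trav f g (k + 1))
  | app t a, k => app (t.trav f g k) (a.trav f g k)
  | sigma A B, k => sigma (A.trav f g k) (B.trav f g (k + 1))
  | pair A B a b, k =>
    pair (A.trav f g k) (B.trav f g (k + 1)) (a.trav f g k) (b.trav f g k)
  | fst A B p, k => fst (A.trav f g k) (B.trav f g (k + 1)) (p.trav f g k)
  | snd A B p, k => snd (A.trav f g k) (B.trav f g (k + 1)) (p.trav f g k)
  | split A B M c p, k => split (A.trav f g k) (B.trav f g (k + 1)) (M.trav f g (k + 1))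
      (c.trav f g (k + 2)) (p.trav f g k)
  | idt A a b, k => idt (A.trav f g k) (a.trav f g k) (b.trav f g k)
  | idp a, k => idp (a.trav f g k)
  | pathInd A a b M c p, k => pathInd (A.trav f g k) (a.trav f g k) (b.trav f g k)
      (M.trav f g (k + 2)) (c.trav f g k) (p.trav f g k)
  | nat, _ => nat
  | zero, _ => zero
  | succ n, k => succ (n.trav f g k)
  | natInd M z s n, k =>
    natInd (M.trav f g (k + 1)) (z.trav f g k) (s.trav f g (k + 2)) (n.trav f g k)
  | int, _ => int
  | izero, _ => izero
  | ipos n, k => ipos (n.trav f g k)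
  | ineg n, k => ineg (n.trav f g k)
  | intInd M z p m x, k => intInd (M.trav f g (k + 1)) (z.trav f g k) (p.trav f g (k + 1))
      (m.trav f g (k + 1)) (x.trav f g k)
  | trunc A, k => trunc (A.trav f g k)
  | tr a, k => tr (a.trav f g k)
  | ann t T, k => ann (t.trav f g k) (T.trav f g k)

/-- Raising by `d` the variables that are at least `c`. -/
def shift (d c : ℕ) (t : ATm) : ATm :=
  t.trav (fun k n => var (bif Nat.ble k n then n + d else n)) (fun _ l => univ l) c

/-- Weakening by one variable. -/
def wk (t : ATm) : ATm := t.shift 1 0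

/-- The value of the variable `n` under the substitution of `a` for the variable `c`. -/
def instVar (a : ATm) (c n : ℕ) : ATm :=
  bif Nat.ble c n then (bif Nat.beq c n then a.shift c 0 else var (n - 1)) else var n

/-- The substitution of `s` for the variable `c` of `t`; the term `t` is under `c` binders more
than `s`. -/
def instAt (s : ATm) (c : ℕ) (t : ATm) : ATm := t.trav (instVar s) (fun _ l => univ l) c

/-- `B[a]`: the term `a` replaces the variable `0` of `B`. -/
def inst (B a : ATm) : ATm := instAt a 0 B

/-- `C[a, b]`: the terms `a` and `b` replace the variables `1` and `0` of `C`. -/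
def inst₂ (C a b : ATm) : ATm := (instAt a 1 C).inst b

/-- Removal of the outermost annotations. -/
def strip : ATm → ATm
  | ann t _ => t.strip
  | t => t

/-- A test for equality of the underlying raw terms. -/
def eqv : ATm → ATm → Bool
  | ann t _, u => eqv t u
  | var n, u => match u.strip with
    | var n' => Nat.beq n n'
    | _ => false
  | univ l, u => match u.strip with
    | univ l' => l.le l' && l'.le l
    | _ => false
  | pi A B, u => match u.strip with
    | pi A' B' => eqv A A' && eqv B B'
    | _ => false
  | lam A b, u => match u.strip with
    | lam A' b' => eqv A A' && eqv b b'
    | _ => false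
  | app f a, u => match u.strip with
    | app f' a' => eqv f f' && eqv a a'
    | _ => false
  | sigma A B, u => match u.strip with
    | sigma A' B' => eqv A A' && eqv B B'
    | _ => false
  | pair _ _ a b, u => match u.strip with
    | pair _ _ a' b' => eqv a a' && eqv b b'
    | _ => false
  | fst A B p, u => match u.strip with
    | fst A' B' p' => eqv p p' && (eqv A A' && eqv B B')
    | _ => false
  | snd A B p, u => match u.strip with
    | snd A' B' p' => eqv p p' && (eqv A A' && eqv B B')
    | _ => false
  | split A B M c p, u => match u.strip with
    | split A' B' M' c' p' =>
      eqv p p' && (eqv c c' && (eqv A A' && (eqv B B' && eqv M M')))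
    | _ => false
  | idt A a b, u => match u.strip with
    | idt A' a' b' => eqv A A' && (eqv a a' && eqv b b')
    | _ => false
  | idp a, u => match u.strip with
    | idp a' => eqv a a'
    | _ => false
  | pathInd A a _ M c p, u => match u.strip with
    | pathInd A' a' _ M' c' p' =>
      eqv p p' && (eqv c c' && (eqv a a' && (eqv A A' && eqv M M')))
    | _ => false
  | nat, u => match u.strip with
    | nat => true
    | _ => false
  | zero, u => match u.strip with
    | zero => true
    | _ => false
  | succ n, u => match u.strip with
    | succ n' => eqv n n'
    | _ => false
  | natInd M z s n, u => match u.strip with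
    | natInd M' z' s' n' => eqv n n' && (eqv M M' && (eqv z z' && eqv s s'))
    | _ => false
  | int, u => match u.strip with
    | int => true
    | _ => false
  | izero, u => match u.strip with
    | izero => true
    | _ => false
  | ipos n, u => match u.strip with
    | ipos n' => eqv n n'
    | _ => false
  | ineg n, u => match u.strip with
    | ineg n' => eqv n n'
    | _ => false
  | intInd M z p m k, u => match u.strip with
    | intInd M' z' p' m' k' =>
      eqv k k' && (eqv M M' && (eqv z z' && (eqv p p' && eqv m m')))
    | _ => false
  | trunc A, u => match u.strip with
    | trunc A' => eqv A A'
    | _ => false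
  | tr a, u => match u.strip with
    | tr a' => eqv a a'
    | _ => false

/-- The level of a universe. -/
def asUniv (t : ATm) : Option Lv := match t.strip with
  | univ l => some l
  | _ => none

/-- The components of a product type. -/
def asPi (t : ATm) : Option (ATm × ATm) := match t.strip with
  | pi A B => some (A, B)
  | _ => none

/-- The components of an identity type. -/
def asIdt (t : ATm) : Option (ATm × ATm × ATm) := match t.strip with
  | idt A a b => some (A, a, b)
  | _ => none

/-- The value `x` if the test `b` succeeds. -/
def guardB {α : Type} (b : Bool) (x : α) : Option α := bif b then some x else none

/-- The type of an annotated term that is known to be well typed. -/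
def typeOf : ACtx → ATm → Option ATm
  | Γ, var n => (Γ[n]?).map fun A => A.shift (n + 1) 0
  | _, univ l => some (univ l.succ)
  | Γ, pi A B => (typeOf Γ A).bind fun S => S.asUniv.bind fun k =>
      (typeOf (A :: Γ) B).bind fun T => T.asUniv.bind fun l => some (univ (k.sup l))
  | Γ, lam A b => (typeOf (A :: Γ) b).bind fun B => some (pi A B)
  | Γ, app f a => (typeOf Γ f).bind fun F => F.asPi.bind fun AB => some (AB.2.inst a)
  | Γ, sigma A B => (typeOf Γ A).bind fun S => S.asUniv.bind fun k =>
      (typeOf (A :: Γ) B).bind fun T => T.asUniv.bind fun l => some (univ (k.sup l))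
  | _, pair A B _ _ => some (sigma A B)
  | _, fst A _ _ => some A
  | _, snd A B p => some (B.inst (fst A B p))
  | _, split _ _ M _ p => some (M.inst p)
  | Γ, idt A _ _ => typeOf Γ A
  | Γ, idp a => (typeOf Γ a).bind fun A => some (idt A a a)
  | _, pathInd _ _ b M _ p => some (M.inst₂ b p)
  | _, nat => some (univ (.n 0))
  | _, zero => some nat
  | _, succ _ => some nat
  | _, natInd M _ _ n => some (M.inst n)
  | _, int => some (univ (.n 0))
  | _, izero => some int
  | _, ipos _ => some int
  | _, ineg _ => some int
  | _, intInd M _ _ _ k => some (M.inst k)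
  | Γ, trunc A => typeOf Γ A
  | Γ, tr a => (typeOf Γ a).bind fun A => some (trunc A)
  | _, ann _ T => some T

/-! ### Weak head reduction and conversion -/

/-- The term `u`, whose variable `0` has type `A'`, as a term whose variable `0` has the equal
type `A`. -/
def retype (A A' u : ATm) : ATm :=
  bif eqv A A' then u else instAt (ann (var 0) A'.wk) 0 (u.shift 1 1)

/-- The term `u`, whose variable `1` has type `A'`, as a term whose variable `1` has the equal
type `A`. -/
def retype₁ (A A' u : ATm) : ATm :=
  bif eqv A A' then u else instAt (ann (var 0) A'.wk) 1 (u.shift 1 2)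

/-- Whether the outermost form of a term is an introduction that occurs in a computation rule. -/
def isIntro : ATm → Bool
  | lam _ _ => true
  | pair _ _ _ _ => true
  | idp _ => true
  | zero => true
  | succ _ => true
  | izero => true
  | ipos _ => true
  | ineg _ => true
  | _ => false

section step

variable (w : ACtx → ATm → ATm) (cv : ACtx → ATm → ATm → Bool)

/-- The components of `p : sigma A B`, as terms of types `A` and `B[·]`, if `p` reduces to a pair.
If the pair is under an annotation, this requires a check that the components of the two types are
convertible: injectivity of type formers is not available. -/
def asPair (Γ : ACtx) (A B p : ATm) : Option (ATm × ATm) := match w Γ p with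
  | pair _ _ a b => some (a, b)
  | ann p' _ => match p' with
    | pair A' B' a b =>
      let a' := ann a A
      let C := B.inst a'
      guardB (cv Γ A' A && cv Γ (B'.inst a) C) (a', ann b C)
    | _ => none
  | _ => none

/-- Whether `p : a =_A b` reduces to a reflexivity path, which is then one at `a` and at `b`. -/
def isRefl (Γ : ACtx) (A a b p : ATm) : Bool := match w Γ p with
  | idp _ => true
  | ann p' _ => match p' with
    | idp x => match typeOf Γ x with
      | some X => cv Γ A X && cv Γ a x && cv Γ b x
      | none => false
    | _ => false
  | _ => false

/-- The term `t`, considered as a term of type `T`. -/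
def cast (Γ : ACtx) (t T : ATm) : ATm := match typeOf Γ t with
  | some S => bif eqv S T then t else ann t T
  | none => ann t T

/-- One level of weak head reduction, for given reduction and conversion procedures. -/
def whnfStep (Γ : ACtx) (t : ATm) : ATm := match t with
  | app f a => match w Γ f with
    | lam _ b => w Γ (b.inst a)
    | ann f' T => match f', T.strip with
      | lam A b, pi A' B' =>
        let b' := b.inst (ann a A)
        match typeOf Γ b' with
        | some B => bif cv Γ A' A && cv Γ B (B'.inst a) then w Γ (ann b' (B'.inst a))
          else app (ann f' T) a
        | none => app (ann f' T) a
      | _, _ => app (ann f' T) a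
    | f' => app f' a
  | fst A B p => match asPair w cv Γ A B p with
    | some (a, _) => w Γ a
    | none => t
  | snd A B p => match asPair w cv Γ A B p with
    | some (_, b) => w Γ (ann b (B.inst (fst A B p)))
    | none => t
  | split A B M c p => match asPair w cv Γ A B p with
    | some (a, b) => w Γ (ann (c.inst₂ a b) (M.inst p))
    | none => t
  | pathInd A a b M c p => bif isRefl w cv Γ A a b p then w Γ (ann c (M.inst₂ b p)) else t
  | natInd M z s n => match w Γ n with
    | zero => w Γ (ann z (M.inst n))
    | succ m => w Γ (ann (s.inst₂ m (natInd M z s m)) (M.inst n))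
    | _ => t
  | intInd M z p m k => match w Γ k with
    | izero => w Γ (ann z (M.inst k))
    | ipos n => w Γ (ann (p.inst n) (M.inst k))
    | ineg n => w Γ (ann (m.inst n) (M.inst k))
    | _ => t
  | ann t T => match w Γ t with
    | ann v _ => bif isIntro v then cast Γ v T else ann v T
    | v => bif isIntro v then cast Γ v T else ann v T
  | t => t

/-- Conversion of the types of two terms and then of the terms. -/
def convTerm (Γ : ACtx) (t u : ATm) : Bool :=
  eqv t u || match typeOf Γ t, typeOf Γ u with
    | some T, some U => cv Γ T U && cv Γ t u
    | _, _ => false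

/-- Conversion of `f` with `lam A b` by the `η`-rule. -/
def convEta (Γ : ACtx) (f A b : ATm) : Bool :=
  match typeOf Γ f with
  | some F => match F.strip with
    | pi A' B' =>
      cv Γ A' A && match typeOf (A' :: Γ) (retype A' A b) with
        | some B => cv (A' :: Γ) B' B && cv (A' :: Γ) (app f.wk (var 0)) (retype A' A b)
        | none => false
    | _ => false
  | none => false

/-- Conversion of terms with equal heads, by congruence. -/
def convHead (Γ : ACtx) (t u : ATm) : Bool := match t with
  | pi A B => match u with
    | pi A' B' => cv Γ A A' && cv (A :: Γ) B (retype A A' B')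
    | _ => false
  | sigma A B => match u with
    | sigma A' B' => cv Γ A A' && cv (A :: Γ) B (retype A A' B')
    | _ => false
  | lam A b => match u with
    | lam A' b' => cv Γ A A' && convTerm cv (A :: Γ) b (retype A A' b')
    | _ => false
  | app f a => match u with
    | app f' a' => convTerm cv Γ f f' && convTerm cv Γ a a'
    | _ => false
  | pair _ _ a b => match u with
    | pair _ _ a' b' => convTerm cv Γ a a' && convTerm cv Γ b b'
    | _ => false
  | fst A B p => match u with
    | fst A' B' p' => cv Γ A A' && cv (A :: Γ) B (retype A A' B') && cv Γ p p'
    | _ => false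
  | snd A B p => match u with
    | snd A' B' p' => cv Γ A A' && cv (A :: Γ) B (retype A A' B') && cv Γ p p'
    | _ => false
  | split A B M c p => match u with
    | split A' B' M' c' p' =>
      let B₁ := retype A A' B'
      cv Γ A A' && cv (A :: Γ) B B₁ && cv Γ p p' &&
        cv (sigma A B :: Γ) M (retype (sigma A B) (sigma A' B') M') &&
        cv (B :: A :: Γ) c (retype B B₁ (retype₁ A A' c'))
    | _ => false
  | idt A a b => match u with
    | idt A' a' b' => cv Γ A A' && cv Γ a a' && cv Γ b b'
    | _ => false
  | idp a => match u with
    | idp a' => convTerm cv Γ a a'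
    | _ => false
  | pathInd A a b M c p => match u with
    | pathInd A' a' b' M' c' p' =>
      let P := idt A.wk a.wk (var 0)
      let P' := retype A A' (idt A'.wk a'.wk (var 0))
      cv Γ A A' && cv Γ a a' && cv Γ b b' && cv Γ p p' &&
        cv (P :: A :: Γ) M (retype P P' (retype₁ A A' M')) && cv Γ c c'
    | _ => false
  | succ n => match u with
    | succ n' => cv Γ n n'
    | _ => false
  | natInd M z s n => match u with
    | natInd M' z' s' n' => cv Γ n n' && cv (nat :: Γ) M M' && cv Γ z z' &&
        cv (M :: nat :: Γ) s (retype M M' s')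
    | _ => false
  | ipos n => match u with
    | ipos n' => cv Γ n n'
    | _ => false
  | ineg n => match u with
    | ineg n' => cv Γ n n'
    | _ => false
  | intInd M z p m k => match u with
    | intInd M' z' p' m' k' => cv Γ k k' && cv (int :: Γ) M M' && cv Γ z z' &&
        cv (nat :: Γ) p p' && cv (nat :: Γ) m m'
    | _ => false
  | trunc A => match u with
    | trunc A' => cv Γ A A'
    | _ => false
  | tr a => match u with
    | tr a' => convTerm cv Γ a a'
    | _ => false
  | _ => false

/-- Whether a term is an abstraction. -/
def isLam : ATm → Bool
  | lam _ _ => true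
  | _ => false

/-- One level of conversion, for given reduction and conversion procedures. -/
def convStep (Γ : ACtx) (t u : ATm) : Bool :=
  eqv t u ||
    let t' := (w Γ t).strip
    let u' := (w Γ u).strip
    eqv t' u' || match t', u' with
      | lam A b, u' => bif isLam u' then convHead cv Γ (lam A b) u' else convEta cv Γ u' A b
      | t', lam A b => convEta cv Γ t' A b
      | t', u' => convHead cv Γ t' u'

end step

/-- Weak head reduction and conversion with recursion depth at most `n`. -/
def reduceConv : ℕ → (ACtx → ATm → ATm) × (ACtx → ATm → ATm → Bool)
  | 0 => (fun _ t => t, fun _ => eqv)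
  | n + 1 => (whnfStep (reduceConv n).1 (reduceConv n).2,
      convStep (reduceConv n).1 (reduceConv n).2)

/-- The bound on the recursion depth of reduction and conversion. -/
def depth : ℕ := 1000

/-- The weak head normal form of a term. -/
def whnf : ACtx → ATm → ATm := (reduceConv depth).1

/-- The test for judgmental equality of two terms of the same type. -/
def conv : ACtx → ATm → ATm → Bool := (reduceConv depth).2

/-- The inclusion of types: convertibility, or inclusion of universes. -/
def tyLe (Γ : ACtx) (S T : ATm) : Bool :=
  conv Γ S T || match S.strip, T.strip with
    | univ k, univ l => k.le l
    | _, _ => false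

/-- The type of an annotated term, if it is well typed. -/
def infer : ACtx → ATm → Option ATm
  | Γ, var n => (Γ[n]?).map fun A => A.shift (n + 1) 0
  | _, univ l => some (univ l.succ)
  | Γ, pi A B => (infer Γ A).bind fun S => S.asUniv.bind fun k =>
      (infer (A :: Γ) B).bind fun T => T.asUniv.bind fun l => some (univ (k.sup l))
  | Γ, lam A b => (infer Γ A).bind fun S => S.asUniv.bind fun _ =>
      (infer (A :: Γ) b).bind fun B => some (pi A B)
  | Γ, app f a => (infer Γ f).bind fun F => F.asPi.bind fun AB =>
      (infer Γ a).bind fun A => guardB (eqv A AB.1) (AB.2.inst a)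
  | Γ, sigma A B => (infer Γ A).bind fun S => S.asUniv.bind fun k =>
      (infer (A :: Γ) B).bind fun T => T.asUniv.bind fun l => some (univ (k.sup l))
  | Γ, pair A B a b => (infer Γ A).bind fun S => S.asUniv.bind fun _ =>
      (infer (A :: Γ) B).bind fun T => T.asUniv.bind fun _ =>
      (infer Γ a).bind fun A' => (infer Γ b).bind fun B' =>
      guardB (eqv A' A && eqv B' (B.inst a)) (sigma A B)
  | Γ, fst A B p => (infer Γ A).bind fun S => S.asUniv.bind fun _ =>
      (infer (A :: Γ) B).bind fun T => T.asUniv.bind fun _ =>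
      (infer Γ p).bind fun P => guardB (eqv P (sigma A B)) A
  | Γ, snd A B p => (infer Γ A).bind fun S => S.asUniv.bind fun _ =>
      (infer (A :: Γ) B).bind fun T => T.asUniv.bind fun _ =>
      (infer Γ p).bind fun P => guardB (eqv P (sigma A B)) (B.inst (fst A B p))
  | Γ, split A B M c p => (infer Γ A).bind fun S => S.asUniv.bind fun _ =>
      (infer (A :: Γ) B).bind fun T => T.asUniv.bind fun _ =>
      (infer (sigma A B :: Γ) M).bind fun U => U.asUniv.bind fun _ =>
      (infer (B :: A :: Γ) c).bind fun C => (infer Γ p).bind fun P =>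
      guardB (eqv P (sigma A B) && eqv C (inst (M.shift 2 1)
        (pair (A.shift 2 0) (B.shift 2 1) (var 1) (var 0)))) (M.inst p)
  | Γ, idt A a b => (infer Γ A).bind fun S => S.asUniv.bind fun _ =>
      (infer Γ a).bind fun A₁ => (infer Γ b).bind fun A₂ =>
      guardB (eqv A₁ A && eqv A₂ A) S
  | Γ, idp a => (infer Γ a).bind fun A => some (idt A a a)
  | Γ, pathInd A a b M c p => (infer Γ A).bind fun S => S.asUniv.bind fun _ =>
      (infer Γ a).bind fun A₁ => (infer Γ b).bind fun A₂ => (infer Γ p).bind fun P =>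
      (infer (idt A.wk a.wk (var 0) :: A :: Γ) M).bind fun T => T.asUniv.bind fun _ =>
      (infer Γ c).bind fun C =>
      guardB (eqv A₁ A && eqv A₂ A && eqv P (idt A a b) && eqv C (M.inst₂ a (idp a)))
        (M.inst₂ b p)
  | _, nat => some (univ (.n 0))
  | _, zero => some nat
  | Γ, succ n => (infer Γ n).bind fun N => guardB (eqv N nat) nat
  | Γ, natInd M z s n => (infer Γ n).bind fun N => (infer (nat :: Γ) M).bind fun T =>
      T.asUniv.bind fun _ => (infer Γ z).bind fun Z => (infer (M :: nat :: Γ) s).bind fun S =>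
      guardB (eqv N nat && eqv Z (M.inst zero) && eqv S (inst (M.shift 2 1) (succ (var 1))))
        (M.inst n)
  | _, int => some (univ (.n 0))
  | _, izero => some int
  | Γ, ipos n => (infer Γ n).bind fun N => guardB (eqv N nat) int
  | Γ, ineg n => (infer Γ n).bind fun N => guardB (eqv N nat) int
  | Γ, intInd M z p m k => (infer Γ k).bind fun K => (infer (int :: Γ) M).bind fun T =>
      T.asUniv.bind fun _ => (infer Γ z).bind fun Z => (infer (nat :: Γ) p).bind fun P =>
      (infer (nat :: Γ) m).bind fun N =>
      guardB (eqv K int && eqv Z (M.inst izero) && eqv P (inst (M.shift 1 1) (ipos (var 0))) &&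
        eqv N (inst (M.shift 1 1) (ineg (var 0)))) (M.inst k)
  | Γ, trunc A => (infer Γ A).bind fun S => S.asUniv.bind fun _ => some S
  | Γ, tr a => (infer Γ a).bind fun A => some (trunc A)
  | Γ, ann t T => (infer Γ t).bind fun S => (infer Γ T).bind fun U => U.asUniv.bind fun _ =>
      guardB (tyLe Γ S T) T

end ATm

end HoTT

/-! ### Derived rules -/

namespace HoTT

open Tm

namespace Tm

/-- `C[a, b]`: the terms `a` and `b` replace the variables `1` and `0` of `C`. -/
def inst₂ (C a b : Tm) : Tm := (C.sub (liftSub (single a))).inst b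

/-- `M[t]` in a context with `d` more variables, where `t` replaces the variable `0` of `M`. -/
def instUp (d : ℕ) (M t : Tm) : Tm := (M.ren (liftRen fun n => n + d)).inst t

theorem instUp_eq (d : ℕ) (M t : Tm) :
    instUp d M t = M.sub fun n => match n with
      | 0 => t
      | k + 1 => var (k + d) := by
  simp only [instUp, inst_eq, sub_ren]
  congr 1; funext n; cases n <;> rfl

theorem inst₂_eq (C a b : Tm) :
    inst₂ C a b = C.sub fun n => match n with
      | 0 => b
      | 1 => a
      | k + 2 => var k := by
  simp only [inst₂, inst_eq, sub_sub]
  congr 1; funext n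
  match n with
  | 0 => rfl
  | 1 => simp [liftSub, single, wk, sub_ren]; exact sub_var a
  | k + 2 => rfl

theorem wk_wk (t : Tm) : t.wk.wk = t.ren (fun n => n + 2) := by simp [wk, ren_ren]

theorem instUp_wk (d : ℕ) (t u : Tm) : instUp d t.wk u = t.ren (fun n => n + d) := by
  rw [instUp_eq, wk, sub_ren, ren_eq_sub]

theorem inst₂_instUp (M a b t : Tm) : inst₂ (instUp 2 M t) a b = M.inst (inst₂ t a b) := by
  simp only [inst₂_eq, instUp_eq, inst_eq, sub_sub]
  congr 1; funext n; cases n <;> rfl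

theorem inst_instUp (M a t : Tm) : (instUp 1 M t).inst a = M.inst (t.inst a) := by
  simp only [instUp_eq, inst_eq, sub_sub]
  congr 1; funext n; cases n <;> rfl

theorem instUp_one_var (M : Tm) : instUp 1 M (var 0) = M := by
  rw [instUp_eq]; conv_rhs => rw [← sub_var M]
  congr 1; funext n; cases n <;> rfl

theorem instUp_two_var (M : Tm) : instUp 2 M (var 1) = M.wk := by
  rw [instUp_eq, wk, ren_eq_sub]
  congr 1; funext n; cases n <;> rfl

theorem inst₂_sub (C a b : Tm) (σ : ℕ → Tm) :
    (inst₂ C a b).sub σ = inst₂ (C.sub (liftSub (liftSub σ))) (a.sub σ) (b.sub σ) := by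
  simp only [inst₂_eq, sub_sub]
  congr 1; funext n
  match n with
  | 0 => rfl
  | 1 => rfl
  | k + 2 =>
    simp only [liftSub, sub, wk, sub_ren]
    exact (sub_var _).symm

theorem instUp_sub (d : ℕ) (M t : Tm) (σ τ : ℕ → Tm)
    (h : ∀ n, τ (n + d) = (σ n).ren fun n => n + d) :
    (instUp d M t).sub τ = instUp d (M.sub (liftSub σ)) (t.sub τ) := by
  simp only [instUp_eq, sub_sub]
  congr 1; funext n; cases n with
  | zero => rfl
  | succ k =>
    simp only [sub, liftSub, wk, h, ren_eq_sub, sub_sub]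

theorem liftSub_add_one (σ : ℕ → Tm) (n : ℕ) : liftSub σ (n + 1) = (σ n).ren fun n => n + 1 := rfl

theorem liftSub_add_two (σ : ℕ → Tm) (n : ℕ) :
    liftSub (liftSub σ) (n + 2) = (σ n).ren fun n => n + 2 := (wk_wk _)

theorem fst_sub (A B p : Tm) (σ : ℕ → Tm) :
    (fst A B p).sub σ = fst (A.sub σ) (B.sub (liftSub σ)) (p.sub σ) := by
  simp only [fst, sub, wk_sub]
  rfl

/-- The motive of the second projection. -/
theorem snd_eq (A B p : Tm) : snd A B p = .sigmaElim
    (.lam (.sigma A B) (instUp 1 B (fst A.wk (B.ren (liftRen Nat.succ)) (.var 0))))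
    (.lam A (.lam B (.var 0))) p := rfl

theorem snd_sub (A B p : Tm) (σ : ℕ → Tm) :
    (snd A B p).sub σ = snd (A.sub σ) (B.sub (liftSub σ)) (p.sub σ) := by
  have h : (B.ren (liftRen Nat.succ)).sub (liftSub (liftSub σ)) =
      (B.sub (liftSub σ)).ren (liftRen Nat.succ) := by
    simp only [sub_ren, ren_sub]
    congr 1; funext n; cases n with
    | zero => rfl
    | succ k => simp [liftSub, liftRen, wk, ren_ren]
  simp only [snd_eq, sub, liftSub, instUp_sub 1 _ _ σ (liftSub σ) (liftSub_add_one σ), fst_sub,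
    wk_sub, h]

end Tm

namespace Derivable

theorem cumul_le {Γ : Ctx} {A : Tm} {m n : ℕ} (h : m ≤ n) (hA : Derivable Γ (.mem A (.univ m))) :
    Derivable Γ (.mem A (.univ n)) := by
  induction h with
  | refl => exact hA
  | step _ ih => exact ih.cumul

theorem eq_cumul_le {Γ : Ctx} {A B : Tm} {m n : ℕ} (h : m ≤ n)
    (hA : Derivable Γ (.eq A B (.univ m))) : Derivable Γ (.eq A B (.univ n)) := by
  induction h with
  | refl => exact hA
  | step _ ih => exact ih.eq_cumul

theorem pi' {Γ : Ctx} {A B : Tm} {i j : ℕ} (hA : Derivable Γ (.mem A (.univ i)))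
    (hB : Derivable (A :: Γ) (.mem B (.univ j))) : Derivable Γ (.mem (.pi A B) (.univ (max i j))) :=
  .pi (hA.cumul_le (le_max_left _ _)) (hB.cumul_le (le_max_right _ _))

theorem sigma' {Γ : Ctx} {A B : Tm} {i j : ℕ} (hA : Derivable Γ (.mem A (.univ i)))
    (hB : Derivable (A :: Γ) (.mem B (.univ j))) :
    Derivable Γ (.mem (.sigma A B) (.univ (max i j))) :=
  .sigma (hA.cumul_le (le_max_left _ _)) (hB.cumul_le (le_max_right _ _))

theorem pair' {Γ : Ctx} {A B a b : Tm} {i j : ℕ} (hA : Derivable Γ (.mem A (.univ i)))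
    (hB : Derivable (A :: Γ) (.mem B (.univ j))) (ha : Derivable Γ (.mem a A))
    (hb : Derivable Γ (.mem b (B.inst a))) : Derivable Γ (.mem (.pair a b) (.sigma A B)) :=
  .pair (hA.cumul_le (le_max_left _ _)) (hB.cumul_le (le_max_right _ _)) ha hb

theorem inst {Γ : Ctx} {A B a b : Tm} (hΓ : Derivable Γ .ctx)
    (hb : Derivable (A :: Γ) (.mem b B)) (ha : Derivable Γ (.mem a A)) :
    Derivable Γ (.mem (b.inst a) (B.inst a)) := by
  simp only [inst_eq]; exact hb.sub (.single hΓ ha) hΓ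

/-- Substitution of equal terms in a type. -/
theorem inst_congr {Γ : Ctx} {A M a a' : Tm} {i j : ℕ} (hA : Derivable Γ (.mem A (.univ i)))
    (hM : Derivable (A :: Γ) (.mem M (.univ j))) (ha : Derivable Γ (.mem a A))
    (ha' : Derivable Γ (.mem a' A)) (h : Derivable Γ (.eq a a' A)) :
    Derivable Γ (.eq (M.inst a) (M.inst a') (.univ j)) :=
  ((pi_beta hA hM ha).eq_symm.eq_trans (app_congr (.eq_refl (.lam hA hM)) h)).eq_trans
    (pi_beta hA hM ha')

/-- Weakening of a type under a binder by `d` variables. -/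
theorem renUp {Γ Δ : Ctx} {A M C : Tm} {i d : ℕ} (hρ : RenOK (fun n => n + d) Γ Δ)
    (hΔ : Derivable Δ .ctx) (hA : Derivable Γ (.mem A (.univ i)))
    (hM : Derivable (A :: Γ) (.mem M C)) :
    Derivable (A.ren (fun n => n + d) :: Δ)
      (.mem (M.ren (liftRen fun n => n + d)) (C.ren (liftRen fun n => n + d))) :=
  hM.ren (hρ.lift A) (.ctx_cons (hA.ren hρ hΔ))

theorem renOK_two (Γ : Ctx) (A B : Tm) : RenOK (fun n => n + 2) Γ (B :: A :: Γ) := by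
  intro n C hC
  have := (hC.succ (B := A)).succ (B := B)
  rwa [wk_wk] at this

/-- The motive `lam A M` at a term in a larger context. -/
theorem beta_up {Γ Δ : Ctx} {A M t : Tm} {i j d : ℕ} (hρ : RenOK (fun n => n + d) Γ Δ)
    (hΔ : Derivable Δ .ctx) (hA : Derivable Γ (.mem A (.univ i)))
    (hM : Derivable (A :: Γ) (.mem M (.univ j)))
    (ht : Derivable Δ (.mem t (A.ren fun n => n + d))) :
    Derivable Δ (.eq (.app ((Tm.lam A M).ren fun n => n + d) t) (Tm.instUp d M t) (.univ j)) :=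
  pi_beta (hA.ren hρ hΔ) (renUp hρ hΔ hA hM) ht

theorem instUp {Γ Δ : Ctx} {A M t : Tm} {i j d : ℕ} (hρ : RenOK (fun n => n + d) Γ Δ)
    (hΔ : Derivable Δ .ctx) (hA : Derivable Γ (.mem A (.univ i)))
    (hM : Derivable (A :: Γ) (.mem M (.univ j)))
    (ht : Derivable Δ (.mem t (A.ren fun n => n + d))) :
    Derivable Δ (.mem (Tm.instUp d M t) (.univ j)) :=
  Derivable.inst hΔ (renUp hρ hΔ hA hM) ht

end Derivable

end HoTT

namespace HoTT

open Tm

namespace Tm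

theorem instUp_instUp (d : ℕ) (M t u : Tm) :
    instUp d (instUp 1 M t) u = instUp d M (instUp d t u) := by
  simp only [instUp_eq, sub_sub]
  congr 1; funext n; cases n <;> rfl

theorem instUp_fst (d : ℕ) (A B p u : Tm) :
    instUp d (fst A.wk (B.ren (liftRen Nat.succ)) p) u =
      fst (A.ren fun n => n + d) (B.ren (liftRen fun n => n + d)) (instUp d p u) := by
  simp only [instUp_eq, fst_sub]
  congr 1
  · rw [wk, sub_ren, ren_eq_sub]
  · rw [sub_ren, ren_eq_sub]
    congr 1; funext n; cases n <;> rfl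

theorem inst_fst (A B u : Tm) :
    (fst A.wk (B.ren (liftRen Nat.succ)) (var 0)).inst u = fst A B u := by
  simp only [inst_eq, fst_sub]
  congr 1
  · rw [← inst_eq, wk_inst]
  · rw [sub_ren]; conv_rhs => rw [← sub_var B]
    congr 1; funext n; cases n <;> rfl

end Tm

namespace Derivable

variable {Γ : Ctx}

theorem var_zero {A : Tm} (h : Derivable (A :: Γ) .ctx) :
    Derivable (A :: Γ) (.mem (.var 0) A.wk) := h.varTy .zero

theorem var_one {A B : Tm} (h : Derivable (B :: A :: Γ) .ctx) :
    Derivable (B :: A :: Γ) (.mem (.var 1) A.wk.wk) := h.varTy (.succ .zero)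

theorem weaken_eq {A a b B : Tm} (h : Derivable Γ (.eq a b B))
    (hA : Derivable (A :: Γ) .ctx) : Derivable (A :: Γ) (.eq a.wk b.wk B.wk) :=
  h.ren (.wk Γ A) hA

/-- Substitution of equal terms in equal types. -/
theorem inst_congr₂ {A B B' a a' : Tm} {i j : ℕ} (hA : Derivable Γ (.mem A (.univ i)))
    (hB : Derivable (A :: Γ) (.mem B (.univ j))) (hB' : Derivable (A :: Γ) (.mem B' (.univ j)))
    (hBB' : Derivable (A :: Γ) (.eq B B' (.univ j))) (ha : Derivable Γ (.mem a A))
    (ha' : Derivable Γ (.mem a' A)) (h : Derivable Γ (.eq a a' A)) :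
    Derivable Γ (.eq (B.inst a) (B'.inst a') (.univ j)) :=
  ((pi_beta hA hB ha).eq_symm.eq_trans (app_congr (lam_congr hA (.eq_refl hA) hBB') h)).eq_trans
    (pi_beta hA hB' ha')

theorem lam₂_beta {A B C a b c : Tm} {i j : ℕ} (hΓ : Derivable Γ .ctx)
    (hA : Derivable Γ (.mem A (.univ i))) (hB : Derivable (A :: Γ) (.mem B (.univ j)))
    (hc : Derivable (B :: A :: Γ) (.mem c C)) (ha : Derivable Γ (.mem a A))
    (hb : Derivable Γ (.mem b (B.inst a))) :
    Derivable Γ (.eq (.app (.app (.lam A (.lam B c)) a) b) (c.inst₂ a b) (C.inst₂ a b)) := by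
  have hBa : Derivable Γ (.mem (B.inst a) (.univ j)) := Derivable.inst hΓ hB ha
  have h₁ := pi_beta hA (.lam hB hc) ha
  have hc' := hc.sub ((SubOK.single hΓ ha).lift (by rw [← inst_eq]; exact ctx_cons hBa))
    (by rw [← inst_eq]; exact ctx_cons hBa)
  rw [← inst_eq] at hc'
  have h₂ := pi_beta hBa hc' hb
  simp only [inst_eq B, inst_eq (.lam _ _), inst_eq (.pi _ _)] at h₁ h₂ hb
  exact (app_congr h₁ (.eq_refl hb)).eq_trans h₂

section split

variable {A B M c : Tm} {i j k : ℕ}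

theorem split_branch (hA : Derivable Γ (.mem A (.univ i)))
    (hB : Derivable (A :: Γ) (.mem B (.univ j))) :
    Derivable (B :: A :: Γ)
      (.mem (.pair (.var 1) (.var 0)) ((Tm.sigma A B).ren fun n => n + 2)) := by
  have hΔ := ctx_cons hB
  refine pair' (hA.ren (renOK_two Γ A B) hΔ) (renUp (renOK_two Γ A B) hΔ hA hB) ?_ ?_
  · rw [← wk_wk]; exact hΔ.var_one
  · have h := instUp_two_var B
    rw [Tm.instUp] at h
    rw [h]; exact hΔ.var_zero

theorem split_branch_conv (hA : Derivable Γ (.mem A (.univ i)))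
    (hB : Derivable (A :: Γ) (.mem B (.univ j)))
    (hM : Derivable (.sigma A B :: Γ) (.mem M (.univ k))) :
    Derivable (B :: A :: Γ) (.eq (M.instUp 2 (.pair (.var 1) (.var 0)))
      (.app (Tm.lam (.sigma A B) M).wk.wk (.pair (.var 1) (.var 0))) (.univ k)) := by
  rw [wk_wk]
  exact (beta_up (renOK_two Γ A B) (ctx_cons hB) (sigma' hA hB) hM (split_branch hA hB)).eq_symm

theorem split (hA : Derivable Γ (.mem A (.univ i)))
    (hB : Derivable (A :: Γ) (.mem B (.univ j)))
    (hM : Derivable (.sigma A B :: Γ) (.mem M (.univ k)))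
    (hc : Derivable (B :: A :: Γ) (.mem c (M.instUp 2 (.pair (.var 1) (.var 0))))) {p : Tm}
    (hp : Derivable Γ (.mem p (.sigma A B))) :
    Derivable Γ (.mem (.sigmaElim (.lam (.sigma A B) M) (.lam A (.lam B c)) p) (M.inst p)) :=
  conv (sigmaElim (.lam (sigma' hA hB) hM)
      (.lam hA (.lam hB (.conv hc (split_branch_conv hA hB hM)))) hp)
    (pi_beta (sigma' hA hB) hM hp)

theorem split_beta (hΓ : Derivable Γ .ctx) (hA : Derivable Γ (.mem A (.univ i)))
    (hB : Derivable (A :: Γ) (.mem B (.univ j)))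
    (hM : Derivable (.sigma A B :: Γ) (.mem M (.univ k)))
    (hc : Derivable (B :: A :: Γ) (.mem c (M.instUp 2 (.pair (.var 1) (.var 0))))) {a b : Tm}
    (ha : Derivable Γ (.mem a A)) (hb : Derivable Γ (.mem b (B.inst a))) :
    Derivable Γ (.eq (.sigmaElim (.lam (.sigma A B) M) (.lam A (.lam B c)) (.pair a b))
      (c.inst₂ a b) (M.inst (.pair a b))) := by
  have hp := pair' hA hB ha hb
  refine (eq_conv (sigma_beta (.lam (sigma' hA hB) hM)
      (.lam hA (.lam hB (.conv hc (split_branch_conv hA hB hM)))) ha hb)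
    (pi_beta (sigma' hA hB) hM hp)).eq_trans ?_
  have h := lam₂_beta hΓ hA hB hc ha hb
  rw [inst₂_instUp] at h
  rwa [inst₂_eq (.pair _ _)] at h

theorem split_congr {A' B' M' c' p p' : Tm} (hA : Derivable Γ (.mem A (.univ i)))
    (hB : Derivable (A :: Γ) (.mem B (.univ j)))
    (hM : Derivable (.sigma A B :: Γ) (.mem M (.univ k)))
    (hp : Derivable Γ (.mem p (.sigma A B)))
    (hAA' : Derivable Γ (.eq A A' (.univ i))) (hBB' : Derivable (A :: Γ) (.eq B B' (.univ j)))
    (hMM' : Derivable (.sigma A B :: Γ) (.eq M M' (.univ k)))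
    (hcc' : Derivable (B :: A :: Γ) (.eq c c' (M.instUp 2 (.pair (.var 1) (.var 0)))))
    (hpp' : Derivable Γ (.eq p p' (.sigma A B))) :
    Derivable Γ (.eq (.sigmaElim (.lam (.sigma A B) M) (.lam A (.lam B c)) p)
      (.sigmaElim (.lam (.sigma A' B') M') (.lam A' (.lam B' c')) p') (M.inst p)) :=
  eq_conv (sigmaElim_congr (.lam_congr (sigma' hA hB) (sigma_congr
      (hA.cumul_le (le_max_left i j)) (hAA'.eq_cumul_le (le_max_left i j))
      (hBB'.eq_cumul_le (le_max_right i j))) hMM')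
      (.lam_congr hA hAA' (.lam_congr hB hBB' (.eq_conv hcc' (split_branch_conv hA hB hM)))) hpp')
    (pi_beta (sigma' hA hB) hM hp)

end split

section projections

variable {A B p : Tm} {i j : ℕ}

theorem fst_motive (hA : Derivable Γ (.mem A (.univ i)))
    (hB : Derivable (A :: Γ) (.mem B (.univ j))) :
    Derivable (.sigma A B :: Γ) (.mem A.wk (.univ i)) :=
  hA.weaken (ctx_cons (sigma' hA hB))

theorem fst_branch (hB : Derivable (A :: Γ) (.mem B (.univ j))) :
    Derivable (B :: A :: Γ) (.mem (.var 1) (A.wk.instUp 2 (.pair (.var 1) (.var 0)))) := by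
  rw [instUp_wk, ← wk_wk]; exact (ctx_cons hB).var_one

theorem fst (hA : Derivable Γ (.mem A (.univ i))) (hB : Derivable (A :: Γ) (.mem B (.univ j)))
    (hp : Derivable Γ (.mem p (.sigma A B))) : Derivable Γ (.mem (Tm.fst A B p) A) := by
  have h := split hA hB (fst_motive hA hB) (fst_branch hB) hp
  rwa [wk_inst] at h

theorem fst_beta (hΓ : Derivable Γ .ctx) (hA : Derivable Γ (.mem A (.univ i)))
    (hB : Derivable (A :: Γ) (.mem B (.univ j))) {a b : Tm}
    (ha : Derivable Γ (.mem a A)) (hb : Derivable Γ (.mem b (B.inst a))) :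
    Derivable Γ (.eq (Tm.fst A B (.pair a b)) a A) := by
  have h := split_beta hΓ hA hB (fst_motive hA hB) (fst_branch hB) ha hb
  rwa [wk_inst, inst₂_eq] at h

theorem fst_congr {A' B' p' : Tm} (hA : Derivable Γ (.mem A (.univ i)))
    (hB : Derivable (A :: Γ) (.mem B (.univ j))) (hp : Derivable Γ (.mem p (.sigma A B)))
    (hAA' : Derivable Γ (.eq A A' (.univ i))) (hBB' : Derivable (A :: Γ) (.eq B B' (.univ j)))
    (hpp' : Derivable Γ (.eq p p' (.sigma A B))) :
    Derivable Γ (.eq (Tm.fst A B p) (Tm.fst A' B' p') A) := by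
  have h := split_congr hA hB (fst_motive hA hB) hp hAA' hBB'
    (hAA'.weaken_eq (ctx_cons (sigma' hA hB))) (.eq_refl (fst_branch hB)) hpp'
  rwa [wk_inst] at h

theorem fst_up (hA : Derivable Γ (.mem A (.univ i)))
    (hB : Derivable (A :: Γ) (.mem B (.univ j))) :
    Derivable (.sigma A B :: Γ) (.mem (Tm.fst A.wk (B.ren (liftRen Nat.succ)) (.var 0)) A.wk) :=
  have hΔ := ctx_cons (sigma' hA hB)
  fst (fst_motive hA hB) (renUp (.wk _ _) hΔ hA hB) hΔ.var_zero

theorem snd_motive (hA : Derivable Γ (.mem A (.univ i)))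
    (hB : Derivable (A :: Γ) (.mem B (.univ j))) :
    Derivable (.sigma A B :: Γ)
      (.mem (B.instUp 1 (Tm.fst A.wk (B.ren (liftRen Nat.succ)) (.var 0))) (.univ j)) :=
  instUp (.wk _ _) (ctx_cons (sigma' hA hB)) hA hB (fst_up hA hB)

theorem snd_branch (hA : Derivable Γ (.mem A (.univ i)))
    (hB : Derivable (A :: Γ) (.mem B (.univ j))) :
    Derivable (B :: A :: Γ) (.mem (.var 0)
      ((B.instUp 1 (Tm.fst A.wk (B.ren (liftRen Nat.succ)) (.var 0))).instUp 2
        (.pair (.var 1) (.var 0)))) := by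
  have hΔ := ctx_cons hB
  have hA₂ := hA.ren (renOK_two Γ A B) hΔ
  have hB₂ := renUp (renOK_two Γ A B) hΔ hA hB
  have h₁ : Derivable (B :: A :: Γ) (.mem (.var 1) (A.ren fun n => n + 2)) := by
    rw [← wk_wk]; exact hΔ.var_one
  have h₀ : Derivable (B :: A :: Γ)
      (.mem (.var 0) ((B.ren (liftRen fun n => n + 2)).inst (.var 1))) := by
    have h := instUp_two_var B
    rw [Tm.instUp] at h
    rw [h]; exact hΔ.var_zero
  rw [instUp_instUp, instUp_fst]
  refine conv (i := j) h₀ (inst_congr hA₂ hB₂ h₁ (fst hA₂ hB₂ (split_branch hA hB)) ?_)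
  exact (fst_beta hΔ hA₂ hB₂ h₁ h₀).eq_symm

theorem snd (hA : Derivable Γ (.mem A (.univ i)))
    (hB : Derivable (A :: Γ) (.mem B (.univ j)))
    (hp : Derivable Γ (.mem p (.sigma A B))) :
    Derivable Γ (.mem (Tm.snd A B p) (B.inst (Tm.fst A B p))) := by
  have h := split hA hB (snd_motive hA hB) (snd_branch hA hB) hp
  rwa [inst_instUp, inst_fst] at h

theorem snd_beta (hΓ : Derivable Γ .ctx) (hA : Derivable Γ (.mem A (.univ i)))
    (hB : Derivable (A :: Γ) (.mem B (.univ j))) {a b : Tm}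
    (ha : Derivable Γ (.mem a A)) (hb : Derivable Γ (.mem b (B.inst a))) :
    Derivable Γ (.eq (Tm.snd A B (.pair a b)) b (B.inst (Tm.fst A B (.pair a b)))) := by
  have h := split_beta hΓ hA hB (snd_motive hA hB) (snd_branch hA hB) ha hb
  rwa [inst_instUp, inst_fst, inst₂_eq] at h

theorem snd_congr {A' B' p' : Tm} {i' j' : ℕ} (hA : Derivable Γ (.mem A (.univ i)))
    (hB : Derivable (A :: Γ) (.mem B (.univ j))) (hp : Derivable Γ (.mem p (.sigma A B)))
    (hA' : Derivable Γ (.mem A' (.univ i')))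
    (hB' : Derivable (A' :: Γ) (.mem B' (.univ j')))
    (hB'' : Derivable (A :: Γ) (.mem B' (.univ j)))
    (hAA' : Derivable Γ (.eq A A' (.univ i))) (hBB' : Derivable (A :: Γ) (.eq B B' (.univ j)))
    (hpp' : Derivable Γ (.eq p p' (.sigma A B))) :
    Derivable Γ (.eq (Tm.snd A B p) (Tm.snd A' B' p') (B.inst (Tm.fst A B p))) := by
  have hΔ := ctx_cons (sigma' hA hB)
  have hS := sigma_congr (hA.cumul_le (le_max_left i j)) (hAA'.eq_cumul_le (le_max_left i j))
      (hBB'.eq_cumul_le (le_max_right i j))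
  have hρ := RenOK.wk Γ (.sigma A B)
  have hB₁ := renUp hρ hΔ hA hB
  have hBB₁ := hBB'.ren (hρ.lift A) (.ctx_cons (hA.weaken hΔ))
  have hf : Derivable (.sigma A B :: Γ) (.eq
      (Tm.fst A.wk (B.ren (liftRen Nat.succ)) (.var 0))
      (Tm.fst A'.wk (B'.ren (liftRen Nat.succ)) (.var 0)) A.wk) :=
    fst_congr (hA.weaken hΔ) hB₁ hΔ.var_zero (hAA'.weaken_eq hΔ) hBB₁ (.eq_refl hΔ.var_zero)
  have hf' : Derivable (.sigma A B :: Γ)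
      (.mem (Tm.fst A'.wk (B'.ren (liftRen Nat.succ)) (.var 0)) A.wk) :=
    conv (fst (hA'.weaken hΔ) (renUp hρ hΔ hA' hB') (conv hΔ.var_zero (hS.weaken_eq hΔ)))
      (hAA'.weaken_eq hΔ).eq_symm
  have hMM' := inst_congr₂ (hA.weaken hΔ) hB₁ (renUp hρ hΔ hA hB'') hBB₁ (fst_up hA hB) hf' hf
  have h := split_congr hA hB (snd_motive hA hB) hp hAA' hBB' hMM'
    (.eq_refl (snd_branch hA hB)) hpp'
  rwa [inst_instUp, inst_fst] at h

end projections

section pathInd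

variable {A a M c : Tm} {i k : ℕ}

theorem idt_up (hA : Derivable Γ (.mem A (.univ i))) (ha : Derivable Γ (.mem a A)) :
    Derivable (A :: Γ) (.mem (.idt A.wk a.wk (.var 0)) (.univ i)) :=
  have hΔ := ctx_cons hA
  .idt (hA.weaken hΔ) (ha.weaken hΔ) hΔ.var_zero

theorem inst_idt_up (A a b : Tm) : (Tm.idt A.wk a.wk (.var 0)).inst b = .idt A a b := by
  rw [inst_eq, Tm.sub, ← inst_eq, ← inst_eq, wk_inst, wk_inst]; rfl

theorem path_motive (hΓ : Derivable Γ .ctx) (hA : Derivable Γ (.mem A (.univ i)))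
    (ha : Derivable Γ (.mem a A))
    (hM : Derivable (.idt A.wk a.wk (.var 0) :: A :: Γ) (.mem M (.univ k))) {b p : Tm}
    (hb : Derivable Γ (.mem b A)) (hp : Derivable Γ (.mem p (.idt A a b))) :
    Derivable Γ (.eq (.app (.app (.lam A (.lam (.idt A.wk a.wk (.var 0)) M)) b) p)
      (M.inst₂ b p) (.univ k)) :=
  lam₂_beta hΓ hA (idt_up hA ha) hM hb (by rwa [inst_idt_up])

theorem pathInd (hΓ : Derivable Γ .ctx) (hA : Derivable Γ (.mem A (.univ i)))
    (ha : Derivable Γ (.mem a A))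
    (hM : Derivable (.idt A.wk a.wk (.var 0) :: A :: Γ) (.mem M (.univ k)))
    (hc : Derivable Γ (.mem c (M.inst₂ a (.idp a)))) {b p : Tm}
    (hb : Derivable Γ (.mem b A)) (hp : Derivable Γ (.mem p (.idt A a b))) :
    Derivable Γ (.mem (.pathElim (.lam A (.lam (.idt A.wk a.wk (.var 0)) M)) c p)
      (M.inst₂ b p)) :=
  conv (pathElim (.lam hA (.lam (idt_up hA ha) hM))
      (.conv hc (path_motive hΓ hA ha hM ha (.idp ha)).eq_symm) hp)
    (path_motive hΓ hA ha hM hb hp)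

theorem pathInd_beta (hΓ : Derivable Γ .ctx) (hA : Derivable Γ (.mem A (.univ i)))
    (ha : Derivable Γ (.mem a A))
    (hM : Derivable (.idt A.wk a.wk (.var 0) :: A :: Γ) (.mem M (.univ k)))
    (hc : Derivable Γ (.mem c (M.inst₂ a (.idp a)))) :
    Derivable Γ (.eq (.pathElim (.lam A (.lam (.idt A.wk a.wk (.var 0)) M)) c (.idp a)) c
      (M.inst₂ a (.idp a))) :=
  have h := path_motive hΓ hA ha hM ha (.idp ha)
  eq_conv (path_beta (.lam hA (.lam (idt_up hA ha) hM)) ha (.conv hc h.eq_symm)) h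

theorem pathInd_congr {A' a' M' c' b p p' : Tm} (hΓ : Derivable Γ .ctx)
    (hA : Derivable Γ (.mem A (.univ i))) (ha : Derivable Γ (.mem a A))
    (hM : Derivable (.idt A.wk a.wk (.var 0) :: A :: Γ) (.mem M (.univ k)))
    (hb : Derivable Γ (.mem b A)) (hp : Derivable Γ (.mem p (.idt A a b)))
    (hAA' : Derivable Γ (.eq A A' (.univ i))) (haa' : Derivable Γ (.eq a a' A))
    (hMM' : Derivable (.idt A.wk a.wk (.var 0) :: A :: Γ) (.eq M M' (.univ k)))
    (hcc' : Derivable Γ (.eq c c' (M.inst₂ a (.idp a))))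
    (hpp' : Derivable Γ (.eq p p' (.idt A a b))) :
    Derivable Γ (.eq (.pathElim (.lam A (.lam (.idt A.wk a.wk (.var 0)) M)) c p)
      (.pathElim (.lam A' (.lam (.idt A'.wk a'.wk (.var 0)) M')) c' p') (M.inst₂ b p)) :=
  have hΔ := ctx_cons hA
  eq_conv (pathElim_congr (.lam_congr hA hAA' (.lam_congr (idt_up hA ha)
      (.idt_congr (hAA'.weaken_eq hΔ) (haa'.weaken_eq hΔ) (.eq_refl hΔ.var_zero)) hMM'))
      (.eq_conv hcc' (path_motive hΓ hA ha hM ha (.idp ha)).eq_symm) hpp')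
    (path_motive hΓ hA ha hM hb hp)

end pathInd

section natInd

variable {M z s : Tm} {k : ℕ}

theorem nat_branch (hΓ : Derivable Γ .ctx) (hM : Derivable (.nat :: Γ) (.mem M (.univ k))) :
    Derivable Γ (.eq (.pi .nat (.pi M (M.instUp 2 (.succ (.var 1)))))
      (.pi .nat (arrow (.app (Tm.lam .nat M).wk (.var 0))
        (.app (Tm.lam .nat M).wk (.succ (.var 0))))) (.univ k)) := by
  have hN : Derivable Γ (.mem .nat (.univ k)) := cumul_le (Nat.zero_le k) (.nat hΓ)
  have hΔ := ctx_cons hM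
  refine pi_congr hN (.eq_refl hN) (pi_congr hM ?_ ?_)
  · have h := beta_up (.wk Γ .nat) (ctx_cons hN) hN hM (ctx_cons hN).var_zero
    rw [instUp_one_var] at h
    exact h.eq_symm
  · have h := beta_up (t := .succ (.var 1)) (renOK_two Γ .nat M) hΔ hN hM (.succ hΔ.var_one)
    rw [← wk_wk] at h
    exact h.eq_symm

theorem natInd (hΓ : Derivable Γ .ctx) (hM : Derivable (.nat :: Γ) (.mem M (.univ k)))
    (hz : Derivable Γ (.mem z (M.inst .zero)))
    (hs : Derivable (M :: .nat :: Γ) (.mem s (M.instUp 2 (.succ (.var 1))))) {n : Tm}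
    (hn : Derivable Γ (.mem n .nat)) :
    Derivable Γ (.mem (.natElim (.lam .nat M) z (.lam .nat (.lam M s)) n) (M.inst n)) :=
  have hN := nat hΓ
  conv (natElim (.lam hN hM) (.conv hz (pi_beta hN hM (.zero hΓ)).eq_symm)
      (.conv (.lam hN (.lam hM hs)) (nat_branch hΓ hM)) hn)
    (pi_beta hN hM hn)

theorem natInd_beta_zero (hΓ : Derivable Γ .ctx)
    (hM : Derivable (.nat :: Γ) (.mem M (.univ k)))
    (hz : Derivable Γ (.mem z (M.inst .zero)))
    (hs : Derivable (M :: .nat :: Γ) (.mem s (M.instUp 2 (.succ (.var 1))))) :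
    Derivable Γ (.eq (.natElim (.lam .nat M) z (.lam .nat (.lam M s)) .zero) z
      (M.inst .zero)) :=
  have hN := nat hΓ
  eq_conv (nat_beta_zero (.lam hN hM) (.conv hz (pi_beta hN hM (.zero hΓ)).eq_symm)
      (.conv (.lam hN (.lam hM hs)) (nat_branch hΓ hM)))
    (pi_beta hN hM (.zero hΓ))

theorem natInd_beta_succ (hΓ : Derivable Γ .ctx)
    (hM : Derivable (.nat :: Γ) (.mem M (.univ k)))
    (hz : Derivable Γ (.mem z (M.inst .zero)))
    (hs : Derivable (M :: .nat :: Γ) (.mem s (M.instUp 2 (.succ (.var 1))))) {n : Tm}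
    (hn : Derivable Γ (.mem n .nat)) :
    Derivable Γ (.eq (.natElim (.lam .nat M) z (.lam .nat (.lam M s)) (.succ n))
      (s.inst₂ n (.natElim (.lam .nat M) z (.lam .nat (.lam M s)) n)) (M.inst (.succ n))) := by
  have hN := nat hΓ
  refine (eq_conv (nat_beta_succ (.lam hN hM) (.conv hz (pi_beta hN hM (.zero hΓ)).eq_symm)
      (.conv (.lam hN (.lam hM hs)) (nat_branch hΓ hM)) hn)
    (pi_beta hN hM (.succ hn))).eq_trans ?_
  have h := lam₂_beta hΓ hN hM hs hn (natInd hΓ hM hz hs hn)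
  rw [inst₂_instUp] at h
  rwa [inst₂_eq (.succ _)] at h

theorem natInd_congr {M' z' s' n n' : Tm} (hΓ : Derivable Γ .ctx)
    (hM : Derivable (.nat :: Γ) (.mem M (.univ k))) (hn : Derivable Γ (.mem n .nat))
    (hMM' : Derivable (.nat :: Γ) (.eq M M' (.univ k)))
    (hzz' : Derivable Γ (.eq z z' (M.inst .zero)))
    (hss' : Derivable (M :: .nat :: Γ) (.eq s s' (M.instUp 2 (.succ (.var 1)))))
    (hnn' : Derivable Γ (.eq n n' .nat)) :
    Derivable Γ (.eq (.natElim (.lam .nat M) z (.lam .nat (.lam M s)) n)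
      (.natElim (.lam .nat M') z' (.lam .nat (.lam M' s')) n') (M.inst n)) :=
  have hN := nat hΓ
  eq_conv (natElim_congr (.lam_congr hN (.eq_refl hN) hMM')
      (.eq_conv hzz' (pi_beta hN hM (.zero hΓ)).eq_symm)
      (.eq_conv (.lam_congr hN (.eq_refl hN) (.lam_congr hM hMM' hss')) (nat_branch hΓ hM)) hnn')
    (pi_beta hN hM hn)

end natInd

section intInd

variable {M z p m : Tm} {k : ℕ}

theorem int_branch (hΓ : Derivable Γ .ctx) (hM : Derivable (.int :: Γ) (.mem M (.univ k)))
    {t : Tm} (ht : Derivable (.nat :: Γ) (.mem t .int)) :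
    Derivable (.nat :: Γ) (.eq (M.instUp 1 t) (.app (Tm.lam .int M).wk t) (.univ k)) :=
  (beta_up (.wk Γ .nat) (ctx_cons (.nat hΓ)) (.int hΓ) hM ht).eq_symm

theorem intInd (hΓ : Derivable Γ .ctx) (hM : Derivable (.int :: Γ) (.mem M (.univ k)))
    (hz : Derivable Γ (.mem z (M.inst .izero)))
    (hp : Derivable (.nat :: Γ) (.mem p (M.instUp 1 (.ipos (.var 0)))))
    (hm : Derivable (.nat :: Γ) (.mem m (M.instUp 1 (.ineg (.var 0))))) {x : Tm}
    (hx : Derivable Γ (.mem x .int)) :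
    Derivable Γ (.mem (.intElim (.lam .int M) z (.lam .nat p) (.lam .nat m) x) (M.inst x)) :=
  have hN := nat hΓ
  have hZ := int hΓ
  have h0 := (ctx_cons hN).var_zero
  conv (intElim (.lam hZ hM) (.conv hz (pi_beta hZ hM (.izero hΓ)).eq_symm)
      (.lam hN (.conv hp (int_branch hΓ hM (.ipos h0))))
      (.lam hN (.conv hm (int_branch hΓ hM (.ineg h0)))) hx)
    (pi_beta hZ hM hx)

theorem intInd_beta_zero (hΓ : Derivable Γ .ctx)
    (hM : Derivable (.int :: Γ) (.mem M (.univ k)))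
    (hz : Derivable Γ (.mem z (M.inst .izero)))
    (hp : Derivable (.nat :: Γ) (.mem p (M.instUp 1 (.ipos (.var 0)))))
    (hm : Derivable (.nat :: Γ) (.mem m (M.instUp 1 (.ineg (.var 0))))) :
    Derivable Γ (.eq (.intElim (.lam .int M) z (.lam .nat p) (.lam .nat m) .izero) z
      (M.inst .izero)) :=
  have hN := nat hΓ
  have hZ := int hΓ
  have h0 := (ctx_cons hN).var_zero
  eq_conv (int_beta_zero (.lam hZ hM) (.conv hz (pi_beta hZ hM (.izero hΓ)).eq_symm)
      (.lam hN (.conv hp (int_branch hΓ hM (.ipos h0))))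
      (.lam hN (.conv hm (int_branch hΓ hM (.ineg h0)))))
    (pi_beta hZ hM (.izero hΓ))

theorem intInd_beta_pos (hΓ : Derivable Γ .ctx)
    (hM : Derivable (.int :: Γ) (.mem M (.univ k)))
    (hz : Derivable Γ (.mem z (M.inst .izero)))
    (hp : Derivable (.nat :: Γ) (.mem p (M.instUp 1 (.ipos (.var 0)))))
    (hm : Derivable (.nat :: Γ) (.mem m (M.instUp 1 (.ineg (.var 0))))) {n : Tm}
    (hn : Derivable Γ (.mem n .nat)) :
    Derivable Γ (.eq (.intElim (.lam .int M) z (.lam .nat p) (.lam .nat m) (.ipos n)) (p.inst n)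
      (M.inst (.ipos n))) := by
  have hN := nat hΓ
  have hZ := int hΓ
  have h0 := (ctx_cons hN).var_zero
  refine (eq_conv (int_beta_pos (.lam hZ hM) (.conv hz (pi_beta hZ hM (.izero hΓ)).eq_symm)
      (.lam hN (.conv hp (int_branch hΓ hM (.ipos h0))))
      (.lam hN (.conv hm (int_branch hΓ hM (.ineg h0)))) hn)
    (pi_beta hZ hM (.ipos hn))).eq_trans ?_
  have h := pi_beta hN hp hn
  rwa [inst_instUp, inst_eq (.ipos _)] at h

theorem intInd_beta_neg (hΓ : Derivable Γ .ctx)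
    (hM : Derivable (.int :: Γ) (.mem M (.univ k)))
    (hz : Derivable Γ (.mem z (M.inst .izero)))
    (hp : Derivable (.nat :: Γ) (.mem p (M.instUp 1 (.ipos (.var 0)))))
    (hm : Derivable (.nat :: Γ) (.mem m (M.instUp 1 (.ineg (.var 0))))) {n : Tm}
    (hn : Derivable Γ (.mem n .nat)) :
    Derivable Γ (.eq (.intElim (.lam .int M) z (.lam .nat p) (.lam .nat m) (.ineg n)) (m.inst n)
      (M.inst (.ineg n))) := by
  have hN := nat hΓ
  have hZ := int hΓ
  have h0 := (ctx_cons hN).var_zero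
  refine (eq_conv (int_beta_neg (.lam hZ hM) (.conv hz (pi_beta hZ hM (.izero hΓ)).eq_symm)
      (.lam hN (.conv hp (int_branch hΓ hM (.ipos h0))))
      (.lam hN (.conv hm (int_branch hΓ hM (.ineg h0)))) hn)
    (pi_beta hZ hM (.ineg hn))).eq_trans ?_
  have h := pi_beta hN hm hn
  rwa [inst_instUp, inst_eq (.ineg _)] at h

theorem intInd_congr {M' z' p' m' x x' : Tm} (hΓ : Derivable Γ .ctx)
    (hM : Derivable (.int :: Γ) (.mem M (.univ k))) (hx : Derivable Γ (.mem x .int))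
    (hMM' : Derivable (.int :: Γ) (.eq M M' (.univ k)))
    (hzz' : Derivable Γ (.eq z z' (M.inst .izero)))
    (hpp' : Derivable (.nat :: Γ) (.eq p p' (M.instUp 1 (.ipos (.var 0)))))
    (hmm' : Derivable (.nat :: Γ) (.eq m m' (M.instUp 1 (.ineg (.var 0)))))
    (hxx' : Derivable Γ (.eq x x' .int)) :
    Derivable Γ (.eq (.intElim (.lam .int M) z (.lam .nat p) (.lam .nat m) x)
      (.intElim (.lam .int M') z' (.lam .nat p') (.lam .nat m') x') (M.inst x)) :=
  have hN := nat hΓ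
  have hZ := int hΓ
  have h0 := (ctx_cons hN).var_zero
  eq_conv (intElim_congr (.lam_congr hZ (.eq_refl hZ) hMM')
      (.eq_conv hzz' (pi_beta hZ hM (.izero hΓ)).eq_symm)
      (.lam_congr hN (.eq_refl hN) (.eq_conv hpp' (int_branch hΓ hM (.ipos h0))))
      (.lam_congr hN (.eq_refl hN) (.eq_conv hmm' (int_branch hΓ hM (.ineg h0)))) hxx')
    (pi_beta hZ hM hx)

end intInd

end Derivable

end HoTT

namespace HoTT

open Tm

/-! ### Erasure and substitution -/

namespace Lv

theorem eval_succ (v : ℕ × ℕ) (l : Lv) : l.succ.eval v = l.eval v + 1 := by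
  induction l with
  | max a b iha ihb =>
    simp only [succ, eval, iha, ihb]
    exact Nat.succ_max_succ _ _
  | _ => rfl

theorem leAtom_sound (v : ℕ × ℕ) {a b : Lv} (ha : ∀ c d, a ≠ max c d) (h : leAtom a b = true) :
    a.eval v ≤ b.eval v := by
  induction b with
  | max b c ihb ihc =>
    simp only [leAtom, Bool.or_eq_true] at h
    simp only [eval]
    rcases h with h | h
    · exact (ihb h).trans (le_max_left _ _)
    · exact (ihc h).trans (le_max_right _ _)
  | _ =>
    cases a with
    | max c d => exact absurd rfl (ha c d)
    | _ => simp only [leAtom, Nat.ble_eq, Bool.false_eq_true] at h <;> simp only [eval] <;> omega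

theorem le_sound (v : ℕ × ℕ) {a b : Lv} (h : le a b = true) : a.eval v ≤ b.eval v := by
  induction a with
  | max a c iha ihc =>
    simp only [le, Bool.and_eq_true] at h
    exact max_le (iha h.1) (ihc h.2)
  | _ => exact leAtom_sound v (by simp) (by simpa only [le] using h)

theorem eval_sup (v : ℕ × ℕ) (a b : Lv) : (sup a b).eval v = Nat.max (a.eval v) (b.eval v) := by
  unfold sup
  cases h : le a b with
  | true => exact (max_eq_right (le_sound v h)).symm
  | false =>
    cases h' : le b a with
    | true => exact (max_eq_left (le_sound v h')).symm
    | false => rfl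

end Lv

/-- The renaming that raises by `d` the variables that are at least `c`. -/
def shiftRen (d c n : ℕ) : ℕ := bif Nat.ble c n then n + d else n

theorem shiftRen_zero (d : ℕ) : shiftRen d 0 = fun n => n + d := by
  funext n
  have : Nat.ble 0 n = true := by rw [Nat.ble_eq]; omega
  simp [shiftRen, this]

theorem shiftRen_succ (d c : ℕ) : shiftRen d (c + 1) = liftRen (shiftRen d c) := by
  funext n
  cases n with
  | zero => rfl
  | succ n =>
    simp only [shiftRen, liftRen, Nat.ble]
    cases Nat.ble c n <;> simp; omega

namespace ATm

variable {v : ℕ × ℕ}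

theorem erase_trav {f : ℕ → ℕ → ATm} {g : ℕ → Lv → ATm} {σ : ℕ → ℕ → Tm}
    (hf : ∀ k n, (f k n).erase v = σ k n) (hg : ∀ k l, (g k l).erase v = .univ (l.eval v))
    (hσ : ∀ k, σ (k + 1) = liftSub (σ k)) (t : ATm) (k : ℕ) :
    (t.trav f g k).erase v = (t.erase v).sub (σ k) := by
  induction t generalizing k with
  | snd A B p ihA ihB ihp => simp only [trav, erase, snd_sub, ihA, ihB, ihp, hσ]
  | fst A B p ihA ihB ihp => simp only [trav, erase, fst_sub, ihA, ihB, ihp, hσ]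
  | pathInd A a b M c p ihA iha ihb ihM ihc ihp =>
    simp only [trav, erase, sub, ihA, iha, ihM, ihc, ihp, hσ, wk_sub]
    rfl
  | _ => simp only [trav, erase, sub, *]

theorem erase_shift (d c : ℕ) (t : ATm) :
    (t.shift d c).erase v = (t.erase v).ren (shiftRen d c) := by
  rw [ren_eq_sub]
  refine erase_trav (σ := fun k n => Tm.var (shiftRen d k n)) (fun _ _ => rfl) (fun _ _ => rfl)
    (fun k => ?_) t c
  rw [shiftRen_succ, liftSub_comp_ren]

theorem erase_wk (t : ATm) : t.wk.erase v = (t.erase v).wk := by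
  rw [wk, erase_shift, shiftRen_zero]; rfl

/-- The substitution of `s` for the variable `c`. -/
def instSub (v : ℕ × ℕ) (s : ATm) (c n : ℕ) : Tm := (instVar s c n).erase v

theorem instSub_lt (s : ATm) {c n : ℕ} (h : n < c) : instSub v s c n = .var n := by
  have : Nat.ble c n = false := by rw [← Bool.not_eq_true, Nat.ble_eq]; omega
  simp [instSub, instVar, this, erase]

theorem instSub_self (s : ATm) (c : ℕ) :
    instSub v s c c = (s.erase v).ren fun n => n + c := by
  have : Nat.ble c c = true := by rw [Nat.ble_eq]
  simp [instSub, instVar, this, erase_shift, shiftRen_zero]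

theorem instSub_gt (s : ATm) {c n : ℕ} (h : c < n) : instSub v s c n = .var (n - 1) := by
  have h₁ : Nat.ble c n = true := by rw [Nat.ble_eq]; omega
  have h₂ : Nat.beq c n = false := by rw [← Bool.not_eq_true, Nat.beq_eq]; omega
  simp [instSub, instVar, h₁, h₂, erase]

theorem instSub_succ (s : ATm) (c : ℕ) : instSub v s (c + 1) = liftSub (instSub v s c) := by
  funext n
  cases n with
  | zero => rw [instSub_lt _ (by omega)]; rfl
  | succ n =>
    rw [liftSub]
    rcases lt_trichotomy n c with h | rfl | h
    · rw [instSub_lt _ h, instSub_lt _ (by omega)]; rfl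
    · rw [instSub_self, instSub_self, Tm.wk, ren_ren]; rfl
    · rw [instSub_gt _ h, instSub_gt _ (by omega), Tm.wk, Tm.ren]
      congr 1; omega

theorem instSub_zero (s : ATm) : instSub v s 0 = single (s.erase v) := by
  funext n
  cases n with
  | zero =>
    rw [instSub_self, single]
    simp only [Nat.add_zero, ren_eq_sub, sub_var]
  | succ n => rw [instSub_gt _ (by omega)]; rfl

theorem erase_instAt (s : ATm) (c : ℕ) (t : ATm) :
    (instAt s c t).erase v = (t.erase v).sub (instSub v s c) :=
  erase_trav (σ := instSub v s) (fun _ _ => rfl) (fun _ _ => rfl) (instSub_succ s) t c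

theorem erase_inst (B a : ATm) : (B.inst a).erase v = (B.erase v).inst (a.erase v) := by
  rw [inst, erase_instAt, instSub_zero, inst_eq]

theorem erase_inst₂ (C a b : ATm) :
    (C.inst₂ a b).erase v = (C.erase v).inst₂ (a.erase v) (b.erase v) := by
  rw [inst₂, erase_inst, erase_instAt, instSub_succ, instSub_zero, Tm.inst₂]

/-- The erasure of a context. -/
def eraseCtx (v : ℕ × ℕ) (Γ : ACtx) : Ctx := Γ.map (erase v)

end ATm

/-! ### The typing of annotated terms -/

/-- The inclusion of types: the relation generated by judgmental equality and the inclusions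
between universes. -/
inductive TyLe (Γ : Ctx) : Tm → Tm → Prop
  | refl {S} : TyLe Γ S S
  | eq {S T k} : Derivable Γ (.eq S T (.univ k)) → TyLe Γ S T
  | univ {m n} : m ≤ n → TyLe Γ (.univ m) (.univ n)
  | trans {S T U} : TyLe Γ S T → TyLe Γ T U → TyLe Γ S U

namespace TyLe

variable {Γ Δ : Ctx} {S T a b : Tm}

theorem mem (h : TyLe Γ S T) (ha : Derivable Γ (.mem a S)) : Derivable Γ (.mem a T) := by
  induction h with
  | refl => exact ha
  | eq h => exact ha.conv h
  | univ h => exact ha.cumul_le h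
  | trans _ _ ih₁ ih₂ => exact ih₂ (ih₁ ha)

theorem mem_eq (h : TyLe Γ S T) (ha : Derivable Γ (.eq a b S)) : Derivable Γ (.eq a b T) := by
  induction h with
  | refl => exact ha
  | eq h => exact ha.eq_conv h
  | univ h => exact ha.eq_cumul_le h
  | trans _ _ ih₁ ih₂ => exact ih₂ (ih₁ ha)

theorem sub {σ : ℕ → Tm} (h : TyLe Γ S T) (hσ : SubOK σ Γ Δ) (hΔ : Derivable Δ .ctx) :
    TyLe Δ (S.sub σ) (T.sub σ) := by
  induction h with
  | refl => exact .refl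
  | eq h => exact .eq (h.sub hσ hΔ)
  | univ h => exact .univ h
  | trans _ _ ih₁ ih₂ => exact ih₁.trans ih₂

end TyLe

namespace ATm

/-- `W v Γ t T`: in the context `Γ`, the annotated term `t` is well typed, of type `T`. -/
def W (v : ℕ × ℕ) : Ctx → ATm → Tm → Prop
  | Γ, var n, T => VarTy Γ n T
  | _, univ l, T => T = .univ (l.eval v + 1)
  | Γ, pi A B, T => ∃ k l, W v Γ A (.univ k) ∧ W v (A.erase v :: Γ) B (.univ l) ∧
      T = .univ (max k l)
  | Γ, lam A b, T => ∃ k B, W v Γ A (.univ k) ∧ W v (A.erase v :: Γ) b B ∧ T = .pi (A.erase v) B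
  | Γ, app f a, T => ∃ A B, W v Γ f (.pi A B) ∧ W v Γ a A ∧ T = B.inst (a.erase v)
  | Γ, sigma A B, T => ∃ k l, W v Γ A (.univ k) ∧ W v (A.erase v :: Γ) B (.univ l) ∧
      T = .univ (max k l)
  | Γ, pair A B a b, T => ∃ k l, W v Γ A (.univ k) ∧ W v (A.erase v :: Γ) B (.univ l) ∧
      W v Γ a (A.erase v) ∧ W v Γ b ((B.erase v).inst (a.erase v)) ∧
      T = .sigma (A.erase v) (B.erase v)
  | Γ, fst A B p, T => ∃ k l, W v Γ A (.univ k) ∧ W v (A.erase v :: Γ) B (.univ l) ∧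
      W v Γ p (.sigma (A.erase v) (B.erase v)) ∧ T = A.erase v
  | Γ, snd A B p, T => ∃ k l, W v Γ A (.univ k) ∧ W v (A.erase v :: Γ) B (.univ l) ∧
      W v Γ p (.sigma (A.erase v) (B.erase v)) ∧
      T = (B.erase v).inst (.fst (A.erase v) (B.erase v) (p.erase v))
  | Γ, split A B M c p, T => ∃ k l m, W v Γ A (.univ k) ∧ W v (A.erase v :: Γ) B (.univ l) ∧
      W v (.sigma (A.erase v) (B.erase v) :: Γ) M (.univ m) ∧
      W v (B.erase v :: A.erase v :: Γ) c ((M.erase v).instUp 2 (.pair (.var 1) (.var 0))) ∧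
      W v Γ p (.sigma (A.erase v) (B.erase v)) ∧ T = (M.erase v).inst (p.erase v)
  | Γ, idt A a b, T => ∃ k, W v Γ A (.univ k) ∧ W v Γ a (A.erase v) ∧ W v Γ b (A.erase v) ∧
      T = .univ k
  | Γ, idp a, T => ∃ A, W v Γ a A ∧ T = .idt A (a.erase v) (a.erase v)
  | Γ, pathInd A a b M c p, T => ∃ k l, W v Γ A (.univ k) ∧ W v Γ a (A.erase v) ∧
      W v Γ b (A.erase v) ∧
      W v (.idt (A.erase v).wk (a.erase v).wk (.var 0) :: A.erase v :: Γ) M (.univ l) ∧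
      W v Γ c ((M.erase v).inst₂ (a.erase v) (.idp (a.erase v))) ∧
      W v Γ p (.idt (A.erase v) (a.erase v) (b.erase v)) ∧
      T = (M.erase v).inst₂ (b.erase v) (p.erase v)
  | _, nat, T => T = .univ 0
  | _, zero, T => T = .nat
  | Γ, succ n, T => W v Γ n .nat ∧ T = .nat
  | Γ, natInd M z s n, T => ∃ k, W v (.nat :: Γ) M (.univ k) ∧
      W v Γ z ((M.erase v).inst .zero) ∧
      W v (M.erase v :: .nat :: Γ) s ((M.erase v).instUp 2 (.succ (.var 1))) ∧
      W v Γ n .nat ∧ T = (M.erase v).inst (n.erase v)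
  | _, int, T => T = .univ 0
  | _, izero, T => T = .int
  | Γ, ipos n, T => W v Γ n .nat ∧ T = .int
  | Γ, ineg n, T => W v Γ n .nat ∧ T = .int
  | Γ, intInd M z p m x, T => ∃ k, W v (.int :: Γ) M (.univ k) ∧
      W v Γ z ((M.erase v).inst .izero) ∧
      W v (.nat :: Γ) p ((M.erase v).instUp 1 (.ipos (.var 0))) ∧
      W v (.nat :: Γ) m ((M.erase v).instUp 1 (.ineg (.var 0))) ∧
      W v Γ x .int ∧ T = (M.erase v).inst (x.erase v)
  | Γ, trunc A, T => ∃ k, W v Γ A (.univ k) ∧ T = .univ k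
  | Γ, tr a, T => ∃ A, W v Γ a A ∧ T = .trunc A
  | Γ, ann t X, T => ∃ S k, W v Γ t S ∧ W v Γ X (.univ k) ∧ TyLe Γ S (X.erase v) ∧ T = X.erase v

variable {v : ℕ × ℕ}

/-- Well typed annotated terms stand for derivable typing judgments. -/
theorem W.sound {Γ : Ctx} {t : ATm} {T : Tm} (hΓ : Derivable Γ .ctx) (h : W v Γ t T) :
    Derivable Γ (.mem (t.erase v) T) := by
  induction t generalizing Γ T with
  | var n => exact hΓ.varTy h
  | univ l => cases h; exact .univ hΓ
  | pi A B ihA ihB =>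
    obtain ⟨k, l, hA, hB, rfl⟩ := h
    have hA := ihA hΓ hA
    exact .pi' hA (ihB (.ctx_cons hA) hB)
  | lam A b ihA ihb =>
    obtain ⟨k, B, hA, hb, rfl⟩ := h
    have hA := ihA hΓ hA
    exact .lam hA (ihb (.ctx_cons hA) hb)
  | app f a ihf iha =>
    obtain ⟨A, B, hf, ha, rfl⟩ := h
    exact .app (ihf hΓ hf) (iha hΓ ha)
  | sigma A B ihA ihB =>
    obtain ⟨k, l, hA, hB, rfl⟩ := h
    have hA := ihA hΓ hA
    exact .sigma' hA (ihB (.ctx_cons hA) hB)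
  | pair A B a b ihA ihB iha ihb =>
    obtain ⟨k, l, hA, hB, ha, hb, rfl⟩ := h
    have hA := ihA hΓ hA
    exact .pair' hA (ihB (.ctx_cons hA) hB) (iha hΓ ha) (ihb hΓ hb)
  | fst A B p ihA ihB ihp =>
    obtain ⟨k, l, hA, hB, hp, rfl⟩ := h
    have hA := ihA hΓ hA
    exact .fst hA (ihB (.ctx_cons hA) hB) (ihp hΓ hp)
  | snd A B p ihA ihB ihp =>
    obtain ⟨k, l, hA, hB, hp, rfl⟩ := h
    have hA := ihA hΓ hA
    exact .snd hA (ihB (.ctx_cons hA) hB) (ihp hΓ hp)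
  | split A B M c p ihA ihB ihM ihc ihp =>
    obtain ⟨k, l, m, hA, hB, hM, hc, hp, rfl⟩ := h
    have hA := ihA hΓ hA
    have hB := ihB (.ctx_cons hA) hB
    exact .split hA hB (ihM (.ctx_cons (.sigma' hA hB)) hM) (ihc (.ctx_cons hB) hc) (ihp hΓ hp)
  | idt A a b ihA iha ihb =>
    obtain ⟨k, hA, ha, hb, rfl⟩ := h
    exact .idt (ihA hΓ hA) (iha hΓ ha) (ihb hΓ hb)
  | idp a iha =>
    obtain ⟨A, ha, rfl⟩ := h
    exact .idp (iha hΓ ha)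
  | pathInd A a b M c p ihA iha ihb ihM ihc ihp =>
    obtain ⟨k, l, hA, ha, hb, hM, hc, hp, rfl⟩ := h
    have hA := ihA hΓ hA
    have ha := iha hΓ ha
    exact .pathInd hΓ hA ha (ihM (.ctx_cons (.idt_up hA ha)) hM) (ihc hΓ hc) (ihb hΓ hb)
      (ihp hΓ hp)
  | nat => cases h; exact .nat hΓ
  | zero => cases h; exact .zero hΓ
  | succ n ihn => obtain ⟨hn, rfl⟩ := h; exact .succ (ihn hΓ hn)
  | natInd M z s n ihM ihz ihs ihn =>
    obtain ⟨k, hM, hz, hs, hn, rfl⟩ := h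
    have hM := ihM (.ctx_cons (.nat hΓ)) hM
    exact .natInd hΓ hM (ihz hΓ hz) (ihs (.ctx_cons hM) hs) (ihn hΓ hn)
  | int => cases h; exact .int hΓ
  | izero => cases h; exact .izero hΓ
  | ipos n ihn => obtain ⟨hn, rfl⟩ := h; exact .ipos (ihn hΓ hn)
  | ineg n ihn => obtain ⟨hn, rfl⟩ := h; exact .ineg (ihn hΓ hn)
  | intInd M z p m x ihM ihz ihp ihm ihx =>
    obtain ⟨k, hM, hz, hp, hm, hx, rfl⟩ := h
    have hN := Derivable.ctx_cons (Derivable.nat hΓ)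
    exact .intInd hΓ (ihM (.ctx_cons (.int hΓ)) hM) (ihz hΓ hz) (ihp hN hp) (ihm hN hm)
      (ihx hΓ hx)
  | trunc A ihA => obtain ⟨k, hA, rfl⟩ := h; exact .trunc (ihA hΓ hA)
  | tr a iha => obtain ⟨A, ha, rfl⟩ := h; exact .tr (iha hΓ ha)
  | ann t X iht ihX =>
    obtain ⟨S, k, ht, -, hS, rfl⟩ := h
    exact hS.mem (iht hΓ ht)

/-- The condition on replacements `f` of variables, with erasures `σ`, that makes them preserve
typing. -/
structure TravOK (v : ℕ × ℕ) (f : ℕ → ℕ → ATm) (σ : ℕ → ℕ → Tm)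
    (R : ℕ → Ctx → Ctx → Prop) : Prop where
  erase : ∀ k n, (f k n).erase v = σ k n
  succ : ∀ k, σ (k + 1) = liftSub (σ k)
  lift : ∀ {k Γ Δ} (A : Tm), R k Γ Δ → R (k + 1) (A :: Γ) (A.sub (σ k) :: Δ)
  var : ∀ {k Γ Δ n A}, R k Γ Δ → Derivable Δ .ctx → VarTy Γ n A → W v Δ (f k n) (A.sub (σ k))

theorem W.trav {f : ℕ → ℕ → ATm} {σ : ℕ → ℕ → Tm} {R : ℕ → Ctx → Ctx → Prop}
    (ok : TravOK v f σ R) {k : ℕ} {Γ Δ : Ctx} (hR : R k Γ Δ) (hΔ : Derivable Δ .ctx) {t : ATm}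
    {T : Tm} (h : W v Γ t T) : W v Δ (t.trav f (fun _ l => .univ l) k) (T.sub (σ k)) := by
  have he (t : ATm) (k : ℕ) : (t.trav f (fun _ l => .univ l) k).erase v = (t.erase v).sub (σ k) :=
    erase_trav ok.erase (fun _ _ => rfl) ok.succ t k
  have ctx {A : ATm} {Δ : Ctx} {k i : ℕ} (hΔ : Derivable Δ .ctx)
      (h : W v Δ (A.trav f (fun _ l => .univ l) k) (.univ i)) :
      Derivable ((A.erase v).sub (σ k) :: Δ) .ctx := by
    rw [← he]; exact .ctx_cons (h.sound hΔ)
  induction t generalizing k Γ Δ T with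
  | var n => exact ok.var hR hΔ h
  | univ l => cases h; rfl
  | pi A B ihA ihB =>
    obtain ⟨i, l, hA, hB, rfl⟩ := h
    have hA := ihA hR hΔ hA
    refine ⟨i, l, hA, ?_, rfl⟩
    rw [he]
    exact ihB (ok.lift _ hR) (ctx hΔ hA) hB
  | lam A b ihA ihb =>
    obtain ⟨i, B, hA, hb, rfl⟩ := h
    have hA := ihA hR hΔ hA
    have hb := ihb (ok.lift _ hR) (ctx hΔ hA) hb
    rw [ok.succ] at hb
    refine ⟨i, _, hA, ?_, by rw [he]; rfl⟩
    rw [he]; exact hb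
  | app g a ihg iha =>
    obtain ⟨A, B, hg, ha, rfl⟩ := h
    exact ⟨_, _, ihg hR hΔ hg, iha hR hΔ ha, by rw [he, inst_sub]⟩
  | sigma A B ihA ihB =>
    obtain ⟨i, l, hA, hB, rfl⟩ := h
    have hA := ihA hR hΔ hA
    refine ⟨i, l, hA, ?_, rfl⟩
    rw [he]
    exact ihB (ok.lift _ hR) (ctx hΔ hA) hB
  | pair A B a b ihA ihB iha ihb =>
    obtain ⟨i, l, hA, hB, ha, hb, rfl⟩ := h
    have hA := ihA hR hΔ hA
    have hb := ihb hR hΔ hb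
    rw [inst_sub] at hb
    have := ihB (ok.lift _ hR) (ctx hΔ hA) hB
    refine ⟨i, l, hA, ?_, ?_, ?_, ?_⟩ <;> simp only [he, ok.succ] at this ⊢
    · exact this
    · exact iha hR hΔ ha
    · exact hb
    · rfl
  | fst A B p ihA ihB ihp =>
    obtain ⟨i, l, hA, hB, hp, rfl⟩ := h
    have hA := ihA hR hΔ hA
    have hB := ihB (ok.lift _ hR) (ctx hΔ hA) hB
    have hp := ihp hR hΔ hp
    refine ⟨i, l, hA, ?_, ?_, ?_⟩ <;> simp only [he, ok.succ] at hB ⊢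
    · exact hB
    · exact hp
  | snd A B p ihA ihB ihp =>
    obtain ⟨i, l, hA, hB, hp, rfl⟩ := h
    have hA := ihA hR hΔ hA
    have hB := ihB (ok.lift _ hR) (ctx hΔ hA) hB
    have hp := ihp hR hΔ hp
    refine ⟨i, l, hA, ?_, ?_, ?_⟩ <;> simp only [he, ok.succ, inst_sub, fst_sub] at hB ⊢
    · exact hB
    · exact hp
  | split A B M c p ihA ihB ihM ihc ihp =>
    obtain ⟨i, l, m, hA, hB, hM, hc, hp, rfl⟩ := h
    have hA := ihA hR hΔ hA
    have hB := ihB (ok.lift _ hR) (ctx hΔ hA) hB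
    have hp := ihp hR hΔ hp
    have hS : Derivable ((Tm.sigma (A.erase v) (B.erase v)).sub (σ k) :: Δ) .ctx := by
      have := hB.sound (ctx hΔ hA)
      rw [he, ok.succ] at this
      have hA := hA.sound hΔ
      rw [he] at hA
      exact .ctx_cons (.sigma' hA this)
    have hM := ihM (ok.lift _ hR) hS hM
    have hc := ihc (ok.lift _ (ok.lift _ hR)) (ctx (ctx hΔ hA) hB) hc
    rw [ok.succ (k + 1), ok.succ k, instUp_sub 2 _ _ _ _ (liftSub_add_two (σ k))] at hc
    refine ⟨i, l, m, hA, ?_, ?_, ?_, ?_, ?_⟩ <;>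
      simp only [he, ok.succ, inst_sub] at hB hM hc ⊢
    · exact hB
    · exact hM
    · exact hc
    · exact hp
  | idt A a b ihA iha ihb =>
    obtain ⟨i, hA, ha, hb, rfl⟩ := h
    refine ⟨i, ihA hR hΔ hA, ?_, ?_, rfl⟩ <;> rw [he]
    · exact iha hR hΔ ha
    · exact ihb hR hΔ hb
  | idp a iha =>
    obtain ⟨A, ha, rfl⟩ := h
    exact ⟨_, iha hR hΔ ha, by rw [he]; rfl⟩
  | pathInd A a b M c p ihA iha ihb ihM ihc ihp =>
    obtain ⟨i, l, hA, ha, hb, hM, hc, hp, rfl⟩ := h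
    have hA := ihA hR hΔ hA
    have ha := iha hR hΔ ha
    have hb := ihb hR hΔ hb
    have hc := ihc hR hΔ hc
    have hp := ihp hR hΔ hp
    have e : (Tm.idt (A.erase v).wk (a.erase v).wk (.var 0)).sub (liftSub (σ k)) =
        .idt ((A.erase v).sub (σ k)).wk ((a.erase v).sub (σ k)).wk (.var 0) := by
      simp only [Tm.sub, wk_sub]; rfl
    have hP : Derivable ((Tm.idt (A.erase v).wk (a.erase v).wk (.var 0)).sub (σ (k + 1)) ::
        (A.erase v).sub (σ k) :: Δ) .ctx := by
      rw [ok.succ, e]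
      have ha := ha.sound hΔ
      have hA := hA.sound hΔ
      rw [he] at hA ha
      exact .ctx_cons (.idt_up hA ha)
    have hM := ihM (ok.lift _ (ok.lift _ hR)) hP hM
    refine ⟨i, l, hA, ?_, ?_, ?_, ?_, ?_, ?_⟩ <;>
      simp only [he, ok.succ, inst₂_sub, e] at hM hc ⊢
    · exact ha
    · exact hb
    · exact hM
    · exact hc
    · exact hp
  | nat => cases h; rfl
  | zero => cases h; rfl
  | succ n ihn => obtain ⟨hn, rfl⟩ := h; exact ⟨ihn hR hΔ hn, rfl⟩
  | natInd M z s n ihM ihz ihs ihn =>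
    obtain ⟨i, hM, hz, hs, hn, rfl⟩ := h
    have hM := ihM (ok.lift .nat hR) (.ctx_cons (.nat hΔ)) hM
    have hz := ihz hR hΔ hz
    have hn := ihn hR hΔ hn
    have hs := ihs (ok.lift _ (ok.lift .nat hR)) (ctx (.ctx_cons (.nat hΔ)) hM) hs
    rw [ok.succ (k + 1), ok.succ k, instUp_sub 2 _ _ _ _ (liftSub_add_two (σ k))] at hs
    refine ⟨i, hM, ?_, ?_, hn, ?_⟩ <;> simp only [he, ok.succ, inst_sub] at hz hs ⊢
    · exact hz
    · exact hs
  | int => cases h; rfl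
  | izero => cases h; rfl
  | ipos n ihn => obtain ⟨hn, rfl⟩ := h; exact ⟨ihn hR hΔ hn, rfl⟩
  | ineg n ihn => obtain ⟨hn, rfl⟩ := h; exact ⟨ihn hR hΔ hn, rfl⟩
  | intInd M z p m x ihM ihz ihp ihm ihx =>
    obtain ⟨i, hM, hz, hp, hm, hx, rfl⟩ := h
    have hN : Derivable (.nat :: Δ) .ctx := .ctx_cons (.nat hΔ)
    have hM := ihM (ok.lift .int hR) (.ctx_cons (.int hΔ)) hM
    have hz := ihz hR hΔ hz
    have hp := ihp (ok.lift .nat hR) hN hp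
    have hm := ihm (ok.lift .nat hR) hN hm
    rw [ok.succ, instUp_sub 1 _ _ _ _ (liftSub_add_one (σ k))] at hp hm
    refine ⟨i, hM, ?_, ?_, ?_, ihx hR hΔ hx, ?_⟩ <;> simp only [he, ok.succ, inst_sub] at hz ⊢
    · exact hz
    · exact hp
    · exact hm
  | trunc A ihA => obtain ⟨i, hA, rfl⟩ := h; exact ⟨i, ihA hR hΔ hA, rfl⟩
  | tr a iha => obtain ⟨A, ha, rfl⟩ := h; exact ⟨_, iha hR hΔ ha, rfl⟩
  | ann t X iht ihX =>
    obtain ⟨S, i, ht, hX, hS, rfl⟩ := h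
    refine ⟨_, i, iht hR hΔ ht, ihX hR hΔ hX, ?_, by rw [he]⟩
    rw [he]
    refine hS.sub (fun n A hA => ?_) hΔ
    rw [← ok.erase]
    exact (ok.var hR hΔ hA).sound hΔ

theorem W.shift {d c : ℕ} {Γ Δ : Ctx} (h : RenOK (shiftRen d c) Γ Δ) (hΔ : Derivable Δ .ctx)
    {t : ATm} {T : Tm} (ht : W v Γ t T) : W v Δ (t.shift d c) (T.ren (shiftRen d c)) := by
  rw [ren_eq_sub]
  refine ht.trav (σ := fun k n => Tm.var (shiftRen d k n))
    (R := fun k Γ Δ => RenOK (shiftRen d k) Γ Δ) ⟨fun _ _ => rfl, fun k => ?_, ?_, ?_⟩ h hΔ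
  · rw [shiftRen_succ, liftSub_comp_ren]
  · intro k Γ Δ A h
    rw [← ren_eq_sub, shiftRen_succ]
    exact h.lift A
  · intro k Γ Δ n A h _ hA
    rw [← ren_eq_sub]
    exact h n A hA

theorem renOK_shift (d : ℕ) {Γ Δ : Ctx} (h : RenOK (fun n => n + d) Γ Δ) :
    RenOK (shiftRen d 0) Γ Δ := by rwa [shiftRen_zero]

theorem W.wk {Γ : Ctx} {A : Tm} (hA : Derivable (A :: Γ) .ctx) {t : ATm} {T : Tm}
    (ht : W v Γ t T) : W v (A :: Γ) t.wk T.wk := by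
  have := ht.shift (renOK_shift 1 (.wk Γ A)) hA
  rwa [shiftRen_zero] at this

/-- `Γ` is obtained from `Δ` by adding the variable `c`, for which `s` is substituted; the term
`s`, of type `S`, is in the context `Δ₀` of which `Δ` is an extension by `c` variables. -/
structure InstOK (v : ℕ × ℕ) (s : ATm) (S : Tm) (Δ₀ : Ctx) (c : ℕ) (Γ Δ : Ctx) : Prop where
  up : RenOK (fun n => n + c) Δ₀ Δ
  lt : ∀ n A, n < c → VarTy Γ n A → VarTy Δ n (A.sub (instSub v s c))
  self : ∀ A, VarTy Γ c A → A.sub (instSub v s c) = S.ren fun n => n + c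
  gt : ∀ n A, c ≤ n → VarTy Γ (n + 1) A → VarTy Δ n (A.sub (instSub v s c))

theorem InstOK.lift {s : ATm} {S : Tm} {Δ₀ : Ctx} {c : ℕ} {Γ Δ : Ctx}
    (h : InstOK v s S Δ₀ c Γ Δ) (A : Tm) :
    InstOK v s S Δ₀ (c + 1) (A :: Γ) (A.sub (instSub v s c) :: Δ) := by
  constructor
  · intro n B hB
    have := (h.up n B hB).succ (B := A.sub (instSub v s c))
    rwa [Tm.wk, ren_ren] at this
  · intro n B hn hB
    rw [instSub_succ]
    rcases hB.cons_cases with ⟨rfl, rfl⟩ | ⟨m, A', rfl, h', rfl⟩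
    · rw [wk_sub]; exact .zero
    · rw [wk_sub]; exact (h.lt m A' (by omega) h').succ
  · intro B hB
    rw [instSub_succ]
    rcases hB.cons_cases with ⟨h0, rfl⟩ | ⟨m, A', hm, h', rfl⟩
    · omega
    · cases hm
      rw [wk_sub, h.self A' h', Tm.wk, ren_ren]; rfl
  · intro n B hn hB
    rw [instSub_succ]
    rcases hB.cons_cases with ⟨h0, rfl⟩ | ⟨m, A', hm, h', rfl⟩
    · omega
    · cases hm
      obtain ⟨n, rfl⟩ : ∃ m, n = m + 1 := ⟨n - 1, by omega⟩
      rw [wk_sub]; exact (h.gt n A' (by omega) h').succ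

theorem W.instAt {s : ATm} {S : Tm} {Δ₀ : Ctx} (hs : W v Δ₀ s S) {c : ℕ} {Γ Δ : Ctx}
    (h : InstOK v s S Δ₀ c Γ Δ) (hΔ : Derivable Δ .ctx) {t : ATm} {T : Tm} (ht : W v Γ t T) :
    W v Δ (instAt s c t) (T.sub (instSub v s c)) := by
  refine ht.trav (σ := instSub v s)
    (R := fun k Γ Δ => InstOK v s S Δ₀ k Γ Δ)
    ⟨fun _ _ => rfl, instSub_succ s, fun A h => h.lift A, ?_⟩ h hΔ
  intro k Γ Δ n A h hΔ hA
  rcases lt_trichotomy n k with hn | rfl | hn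
  · have : instVar s k n = .var n := by
      have : Nat.ble k n = false := by rw [← Bool.not_eq_true, Nat.ble_eq]; omega
      simp [instVar, this]
    rw [this]; exact h.lt n A hn hA
  · have : instVar s n n = s.shift n 0 := by
      have : Nat.ble n n = true := by rw [Nat.ble_eq]
      simp [instVar, this]
    rw [this, h.self A hA, ← shiftRen_zero]
    exact hs.shift (renOK_shift n h.up) hΔ
  · obtain ⟨n, rfl⟩ : ∃ m, n = m + 1 := ⟨n - 1, by omega⟩
    have : instVar s k (n + 1) = .var n := by
      have h₁ : Nat.ble k (n + 1) = true := by rw [Nat.ble_eq]; omega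
      have h₂ : Nat.beq k (n + 1) = false := by rw [← Bool.not_eq_true, Nat.beq_eq]; omega
      simp [instVar, h₁, h₂]
    rw [this]; exact h.gt n A (by omega) hA

end ATm

end HoTT

namespace HoTT

open Tm

namespace ATm

variable {v : ℕ × ℕ}

theorem InstOK.zero {Γ : Ctx} {A : Tm} (s : ATm) : InstOK v s A Γ 0 (A :: Γ) Γ := by
  constructor
  · intro n B hB
    simpa only [Nat.add_zero, ren_eq_sub, sub_var] using hB
  · intro n B hn; omega
  · intro B hB
    rcases hB.cons_cases with ⟨-, rfl⟩ | ⟨m, A', hm, -⟩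
    · rw [instSub_zero, ← inst_eq, wk_inst]
      simp only [Nat.add_zero, ren_eq_sub, sub_var]
    · omega
  · intro n B hn hB
    rcases hB.cons_cases with ⟨h, -⟩ | ⟨m, A', hm, h', rfl⟩
    · omega
    · cases hm
      rwa [instSub_zero, ← inst_eq, wk_inst]

theorem W.inst {Γ : Ctx} (hΓ : Derivable Γ .ctx) {t a : ATm} {T A : Tm} (ht : W v (A :: Γ) t T)
    (ha : W v Γ a A) : W v Γ (t.inst a) (T.inst (a.erase v)) := by
  rw [inst_eq, ← instSub_zero]
  exact ha.instAt (.zero a) hΓ ht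

theorem W.inst₂ {Γ : Ctx} (hΓ : Derivable Γ .ctx) {t a b : ATm} {T A B : Tm}
    (hB : Derivable (B.inst (a.erase v) :: Γ) .ctx)
    (ht : W v (B :: A :: Γ) t T) (ha : W v Γ a A) (hb : W v Γ b (B.inst (a.erase v))) :
    W v Γ (t.inst₂ a b) (T.inst₂ (a.erase v) (b.erase v)) := by
  refine W.inst hΓ (A := B.inst (a.erase v)) ?_ hb
  rw [← instSub_zero, ← instSub_succ]
  rw [inst_eq, ← instSub_zero] at hB ⊢
  exact ha.instAt ((InstOK.zero a).lift B) hB ht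

theorem erase_strip (t : ATm) : t.strip.erase v = t.erase v := by
  induction t with
  | ann t T iht => exact iht
  | _ => rfl

theorem W.strip {Γ : Ctx} {t : ATm} {T : Tm} (h : W v Γ t T) :
    ∃ S, W v Γ t.strip S ∧ TyLe Γ S T := by
  induction t generalizing T with
  | ann t X iht =>
    obtain ⟨S, k, ht, -, hS, rfl⟩ := h
    obtain ⟨S', h', hS'⟩ := iht ht
    exact ⟨S', h', hS'.trans hS⟩
  | _ => exact ⟨T, h, .refl⟩

theorem eqv_sound {t u : ATm} (h : eqv t u = true) : t.erase v = u.erase v := by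
  induction t generalizing u with
  | ann t T iht => exact iht (by simpa only [eqv] using h)
  | univ l =>
    rw [← erase_strip u]
    unfold eqv at h
    split at h
    · rename_i e
      rw [e]
      simp only [Bool.and_eq_true] at h
      exact congrArg Tm.univ (le_antisymm (Lv.le_sound v h.1) (Lv.le_sound v h.2))
    · cases h
  | var n =>
    rw [← erase_strip u]
    unfold eqv at h
    split at h
    · rename_i e
      rw [e, Nat.beq_eq.mp h]
    · cases h
  | _ =>
    rw [← erase_strip u]
    unfold eqv at h
    split at h
    · grind [erase]
    · cases h

theorem asUniv_sound {t : ATm} {l : Lv} (h : t.asUniv = some l) :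
    t.erase v = .univ (l.eval v) := by
  rw [← erase_strip t]
  unfold asUniv at h
  split at h
  · rename_i e; cases h; rw [e]; rfl
  · cases h

theorem strip_of_asPi {t A B : ATm} (h : t.asPi = some (A, B)) : t.strip = pi A B := by
  unfold asPi at h
  split at h
  · rename_i e; cases h; exact e
  · cases h

/-- The well formed contexts of annotated types. -/
def CxOK (v : ℕ × ℕ) : ACtx → Prop
  | [] => True
  | A :: Γ => CxOK v Γ ∧ ∃ k, W v (eraseCtx v Γ) A (.univ k)

theorem CxOK.ctx {Γ : ACtx} (h : CxOK v Γ) : Derivable (eraseCtx v Γ) .ctx := by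
  induction Γ with
  | nil => exact .ctx_nil
  | cons A Γ ih =>
    obtain ⟨hΓ, k, hA⟩ := h
    exact .ctx_cons (hA.sound (ih hΓ))

theorem CxOK.getElem? {Γ : ACtx} (h : CxOK v Γ) {n : ℕ} {A : ATm} (hA : Γ[n]? = some A) :
    ∃ Δ k, W v Δ A (.univ k) ∧ RenOK (fun m => m + (n + 1)) Δ (eraseCtx v Γ) := by
  induction Γ generalizing n with
  | nil => simp at hA
  | cons B Γ ih =>
    obtain ⟨hΓ, k, hB⟩ := h
    cases n with
    | zero =>
      simp only [List.getElem?_cons_zero, Option.some.injEq] at hA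
      subst hA
      exact ⟨_, k, hB, .wk _ _⟩
    | succ n =>
      obtain ⟨Δ, k, hA, hρ⟩ := ih hΓ (by simpa using hA)
      refine ⟨Δ, k, hA, fun m C hC => ?_⟩
      have := (hρ m C hC).succ (B := B.erase v)
      rwa [Tm.wk, ren_ren] at this

theorem CxOK.var {Γ : ACtx} (h : CxOK v Γ) {n : ℕ} {A : ATm} (hA : Γ[n]? = some A) {T : Tm}
    (hT : VarTy (eraseCtx v Γ) n T) :
    (A.shift (n + 1) 0).erase v = T ∧
      ∃ k, W v (eraseCtx v Γ) (A.shift (n + 1) 0) (.univ k) := by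
  obtain ⟨Δ, k, hA', hρ⟩ := h.getElem? hA
  obtain ⟨B, hB, rfl⟩ := hT
  have : B = A.erase v := by
    simp only [eraseCtx, List.getElem?_map, hA, Option.map_some, Option.some.injEq] at hB
    exact hB.symm
  refine ⟨?_, k, hA'.shift (renOK_shift _ hρ) h.ctx⟩
  rw [erase_shift, shiftRen_zero, this]

/-- A well typed term has the type that `typeOf` returns. -/
theorem typeOf_sound {Γ : ACtx} (hΓ : CxOK v Γ) {t : ATm} {T : Tm} {T' : ATm}
    (ht : W v (eraseCtx v Γ) t T) (h : typeOf Γ t = some T') :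
    T'.erase v = T ∧ ∃ k, W v (eraseCtx v Γ) T' (.univ k) := by
  have univ_case {Γ : ACtx} {S A : ATm} {l : Lv} {i : ℕ} (hl : S.asUniv = some l)
      (e : S.erase v = .univ i) : l.eval v = i := by
    rw [asUniv_sound hl] at e; exact Tm.univ.inj e
  induction t generalizing Γ T T' with
  | var n =>
    simp only [typeOf, Option.map_eq_some_iff] at h
    obtain ⟨A, hA, rfl⟩ := h
    exact hΓ.var hA ht
  | univ l =>
    cases h; cases ht
    exact ⟨by rw [erase, Lv.eval_succ], _, rfl⟩
  | pi A B ihA ihB =>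
    obtain ⟨i, j, hA, hB, rfl⟩ := ht
    simp only [typeOf, Option.bind_eq_some_iff] at h
    obtain ⟨S, hS, k, hk, U, hU, l, hl, h⟩ := h
    cases h
    have e₁ := asUniv_sound (v := v) hk
    have e₂ := asUniv_sound (v := v) hl
    rw [(ihA hΓ hA hS).1] at e₁
    rw [(ihB (Γ := A :: Γ) ⟨hΓ, _, hA⟩ hB hU).1] at e₂
    refine ⟨?_, _, rfl⟩
    rw [erase, Lv.eval_sup, ← Tm.univ.inj e₁, ← Tm.univ.inj e₂]
  | lam A b ihA ihb =>
    obtain ⟨i, B, hA, hb, rfl⟩ := ht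
    simp only [typeOf, Option.bind_eq_some_iff] at h
    obtain ⟨B', hB', h⟩ := h
    cases h
    obtain ⟨rfl, k, hB⟩ := ihb (Γ := A :: Γ) ⟨hΓ, _, hA⟩ hb hB'
    exact ⟨rfl, _, _, _, hA, hB, rfl⟩
  | app f a ihf iha =>
    obtain ⟨A, B, hf, ha, rfl⟩ := ht
    simp only [typeOf, Option.bind_eq_some_iff] at h
    obtain ⟨F, hF, ⟨A', B'⟩, hAB, h⟩ := h
    cases h
    obtain ⟨eF, k, hF⟩ := ihf hΓ hf hF
    obtain ⟨S, hS, -⟩ := hF.strip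
    rw [← erase_strip, strip_of_asPi hAB] at eF
    rw [strip_of_asPi hAB] at hS
    cases eF
    obtain ⟨i, j, -, hB, -⟩ := hS
    exact ⟨erase_inst _ _, j, W.inst hΓ.ctx hB ha⟩
  | sigma A B ihA ihB =>
    obtain ⟨i, j, hA, hB, rfl⟩ := ht
    simp only [typeOf, Option.bind_eq_some_iff] at h
    obtain ⟨S, hS, k, hk, U, hU, l, hl, h⟩ := h
    cases h
    have e₁ := asUniv_sound (v := v) hk
    have e₂ := asUniv_sound (v := v) hl
    rw [(ihA hΓ hA hS).1] at e₁
    rw [(ihB (Γ := A :: Γ) ⟨hΓ, _, hA⟩ hB hU).1] at e₂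
    refine ⟨?_, _, rfl⟩
    rw [erase, Lv.eval_sup, ← Tm.univ.inj e₁, ← Tm.univ.inj e₂]
  | pair A B a b =>
    obtain ⟨i, j, hA, hB, ha, hb, rfl⟩ := ht
    cases h
    exact ⟨rfl, _, _, _, hA, hB, rfl⟩
  | fst A B p =>
    obtain ⟨i, j, hA, hB, hp, rfl⟩ := ht
    cases h
    exact ⟨rfl, _, hA⟩
  | snd A B p =>
    obtain ⟨i, j, hA, hB, hp, rfl⟩ := ht
    cases h
    exact ⟨erase_inst _ _, _, W.inst hΓ.ctx (a := fst A B p) hB ⟨_, _, hA, hB, hp, rfl⟩⟩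
  | split A B M c p =>
    obtain ⟨i, j, k, hA, hB, hM, hc, hp, rfl⟩ := ht
    cases h
    exact ⟨erase_inst _ _, _, W.inst hΓ.ctx hM hp⟩
  | idt A a b ihA =>
    obtain ⟨i, hA, ha, hb, rfl⟩ := ht
    exact ihA hΓ hA h
  | idp a iha =>
    obtain ⟨A, ha, rfl⟩ := ht
    simp only [typeOf, Option.bind_eq_some_iff] at h
    obtain ⟨A', hA', h⟩ := h
    cases h
    obtain ⟨rfl, k, hA⟩ := iha hΓ ha hA'
    exact ⟨rfl, k, k, hA, ha, ha, rfl⟩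
  | pathInd A a b M c p =>
    obtain ⟨i, k, hA, ha, hb, hM, hc, hp, rfl⟩ := ht
    cases h
    refine ⟨erase_inst₂ _ _ _, _, W.inst₂ hΓ.ctx ?_ hM hb ?_⟩ <;> rw [Derivable.inst_idt_up]
    · exact .ctx_cons (.idt (hA.sound hΓ.ctx) (ha.sound hΓ.ctx) (hb.sound hΓ.ctx))
    · exact hp
  | natInd M z s n =>
    obtain ⟨k, hM, hz, hs, hn, rfl⟩ := ht
    cases h
    exact ⟨erase_inst _ _, _, W.inst hΓ.ctx hM hn⟩
  | intInd M z p m x =>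
    obtain ⟨k, hM, hz, hp, hm, hx, rfl⟩ := ht
    cases h
    exact ⟨erase_inst _ _, _, W.inst hΓ.ctx hM hx⟩
  | trunc A ihA =>
    obtain ⟨i, hA, rfl⟩ := ht
    exact ihA hΓ hA h
  | tr a iha =>
    obtain ⟨A, ha, rfl⟩ := ht
    simp only [typeOf, Option.bind_eq_some_iff] at h
    obtain ⟨A', hA', h⟩ := h
    cases h
    obtain ⟨rfl, k, hA⟩ := iha hΓ ha hA'
    exact ⟨rfl, k, k, hA, rfl⟩
  | ann t X =>
    obtain ⟨S, k, -, hX, -, rfl⟩ := ht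
    cases h
    exact ⟨rfl, k, hX⟩
  | nat => cases h; cases ht; exact ⟨rfl, _, rfl⟩
  | int => cases h; cases ht; exact ⟨rfl, _, rfl⟩
  | zero => cases h; cases ht; exact ⟨rfl, 0, rfl⟩
  | izero => cases h; cases ht; exact ⟨rfl, 0, rfl⟩
  | succ n => cases h; obtain ⟨-, rfl⟩ := ht; exact ⟨rfl, 0, rfl⟩
  | ipos n => cases h; obtain ⟨-, rfl⟩ := ht; exact ⟨rfl, 0, rfl⟩
  | ineg n => cases h; obtain ⟨-, rfl⟩ := ht; exact ⟨rfl, 0, rfl⟩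

/-! ### Change of the type of a variable -/

theorem ren_inst_var (t : Tm) : (t.ren (shiftRen 1 1)).inst (.var 0) = t := by
  rw [shiftRen_succ, shiftRen_zero]
  exact instUp_one_var t

theorem ren_instSub_var (t : Tm) (X : ATm) :
    (t.ren (shiftRen 1 2)).sub (instSub v (ann (var 0) X) 1) = t := by
  rw [sub_ren]; conv_rhs => rw [← sub_var t]
  congr 1; funext n
  match n with
  | 0 => rfl
  | 1 => rfl
  | k + 2 => rfl

theorem erase_retype (A A' u : ATm) : (retype A A' u).erase v = u.erase v := by
  unfold retype
  cases eqv A A' with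
  | true => rfl
  | false =>
    rw [cond_false, erase_instAt, erase_shift, instSub_zero, ← inst_eq]
    exact ren_inst_var _

theorem erase_retype₁ (A A' u : ATm) : (retype₁ A A' u).erase v = u.erase v := by
  unfold retype₁
  cases eqv A A' with
  | true => rfl
  | false =>
    rw [cond_false, erase_instAt, erase_shift]
    exact ren_instSub_var _ _

section retype

variable {Γ : Ctx} {A A' u : ATm} {T : Tm} {k k' : ℕ}

theorem W.retype_var (hΓ : Derivable Γ .ctx) (hA : W v Γ A (.univ k)) (hA' : W v Γ A' (.univ k'))
    (h : TyLe Γ (A.erase v) (A'.erase v)) :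
    W v (A.erase v :: Γ) (ann (var 0) A'.wk) (A'.erase v).wk := by
  have hΔ := Derivable.ctx_cons (hA.sound hΓ)
  refine ⟨_, k', .zero, hA'.wk hΔ, ?_, (erase_wk _).symm⟩
  have := h.sub (σ := fun n => .var (n + 1)) (Δ := A.erase v :: Γ) (fun n C hC => ?_) hΔ
  · rwa [← ren_eq_sub, ← ren_eq_sub, ← Tm.wk, ← Tm.wk, ← erase_wk A'] at this
  · rw [← ren_eq_sub]; exact hΔ.varTy hC.succ

theorem W.retype (hΓ : Derivable Γ .ctx) (hA : W v Γ A (.univ k)) (hA' : W v Γ A' (.univ k'))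
    (h : TyLe Γ (A.erase v) (A'.erase v)) (hu : W v (A'.erase v :: Γ) u T) :
    W v (A.erase v :: Γ) (retype A A' u) T := by
  unfold ATm.retype
  cases e : eqv A A' with
  | true => rwa [cond_true, eqv_sound (v := v) e]
  | false =>
    have hΔ := Derivable.ctx_cons (hA.sound hΓ)
    have hA'Δ := (hA'.wk hΔ).sound hΔ
    rw [erase_wk] at hA'Δ
    rw [cond_false, ← ren_inst_var T]
    refine W.inst (a := ann (var 0) A'.wk) hΔ (hu.shift ?_ (.ctx_cons hA'Δ))
      (retype_var hΓ hA hA' h)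
    rw [shiftRen_succ, shiftRen_zero]
    exact (RenOK.wk Γ _).lift _

theorem W.retype₁ (hΓ : Derivable Γ .ctx) (hA : W v Γ A (.univ k)) (hA' : W v Γ A' (.univ k'))
    (h : TyLe Γ (A.erase v) (A'.erase v)) {B : ATm} {i : ℕ}
    (hB : W v (A'.erase v :: Γ) B (.univ i)) (hB' : Derivable (B.erase v :: A.erase v :: Γ) .ctx)
    (hu : W v (B.erase v :: A'.erase v :: Γ) u T) :
    W v (B.erase v :: A.erase v :: Γ) (retype₁ A A' u) T := by
  unfold ATm.retype₁
  cases e : eqv A A' with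
  | true => rwa [cond_true, eqv_sound (v := v) e]
  | false =>
    have hΔ := Derivable.ctx_cons (hA.sound hΓ)
    have hA'Δ := (hA'.wk hΔ).sound hΔ
    rw [erase_wk] at hA'Δ
    have hρ : RenOK (shiftRen 1 1) (A'.erase v :: Γ) ((A'.erase v).wk :: A.erase v :: Γ) := by
      rw [shiftRen_succ, shiftRen_zero]
      exact (RenOK.wk Γ _).lift _
    have hu := hu.shift (d := 1) (c := 2) (by rw [shiftRen_succ]; exact hρ.lift (B.erase v))
      (.ctx_cons ((hB.shift hρ (.ctx_cons hA'Δ)).sound (.ctx_cons hA'Δ)|> fun h => by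
        rwa [erase_shift] at h))
    rw [cond_false, ← ren_instSub_var T A'.wk]
    have := (InstOK.zero (v := v) (Γ := A.erase v :: Γ) (A := (A'.erase v).wk)
      (ann (var 0) A'.wk)).lift ((B.erase v).ren (shiftRen 1 1))
    rw [instSub_zero, ← inst_eq] at this
    have e₂ := ren_inst_var (B.erase v)
    simp only [erase] at this
    rw [e₂] at this
    exact (retype_var hΓ hA hA' h).instAt this hB' hu

end retype

end ATm

end HoTT

namespace HoTT

open Tm

namespace ATm

variable {v : ℕ × ℕ}

/-! ### Soundness of reduction and conversion -/

/-- The reduction procedure `w` preserves types and judgmental equality. -/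
def WhSound (v : ℕ × ℕ) (w : ACtx → ATm → ATm) : Prop :=
  ∀ {Γ t T}, CxOK v Γ → W v (eraseCtx v Γ) t T → W v (eraseCtx v Γ) (w Γ t) T ∧
    Derivable (eraseCtx v Γ) (.eq (t.erase v) ((w Γ t).erase v) T)

/-- Terms that the conversion procedure `cv` identifies are judgmentally equal in every type that
includes both of their types. -/
def CvSound (v : ℕ × ℕ) (cv : ACtx → ATm → ATm → Bool) : Prop :=
  ∀ {Γ t u S T C}, CxOK v Γ → W v (eraseCtx v Γ) t S → W v (eraseCtx v Γ) u T →
    TyLe (eraseCtx v Γ) S C → TyLe (eraseCtx v Γ) T C → cv Γ t u = true →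
    Derivable (eraseCtx v Γ) (.eq (t.erase v) (u.erase v) C)

variable {w : ACtx → ATm → ATm} {cv : ACtx → ATm → ATm → Bool} {Γ : ACtx}

theorem CvSound.ty (hc : CvSound v cv) (hΓ : CxOK v Γ) {A A' : ATm} {k k' : ℕ}
    (hA : W v (eraseCtx v Γ) A (.univ k)) (hA' : W v (eraseCtx v Γ) A' (.univ k'))
    (h : cv Γ A A' = true) :
    Derivable (eraseCtx v Γ) (.eq (A.erase v) (A'.erase v) (.univ (max k k'))) :=
  hc hΓ hA hA' (.univ (le_max_left _ _)) (.univ (le_max_right _ _)) h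

theorem asPair_sound (hw : WhSound v w) (hc : CvSound v cv) (hΓ : CxOK v Γ) {A B p : ATm}
    {i j : ℕ} (hA : W v (eraseCtx v Γ) A (.univ i))
    (hB : W v (A.erase v :: eraseCtx v Γ) B (.univ j))
    (hp : W v (eraseCtx v Γ) p (.sigma (A.erase v) (B.erase v))) {a b : ATm}
    (h : asPair w cv Γ A B p = some (a, b)) :
    W v (eraseCtx v Γ) a (A.erase v) ∧
      W v (eraseCtx v Γ) b ((B.erase v).inst (a.erase v)) ∧
      Derivable (eraseCtx v Γ) (.eq (p.erase v) (.pair (a.erase v) (b.erase v))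
        (.sigma (A.erase v) (B.erase v))) := by
  obtain ⟨hp', e⟩ := hw hΓ hp
  unfold asPair at h
  split at h
  · rename_i A' B' a' b' ep
    cases h
    rw [ep] at hp' e
    obtain ⟨i', j', -, -, ha, hb, eS⟩ := hp'
    obtain ⟨e₁, e₂⟩ := Tm.sigma.inj eS
    rw [e₁, e₂]
    exact ⟨ha, hb, by rw [← e₁, ← e₂]; exact e⟩
  · rename_i p' X ep
    split at h
    · rename_i A' B' a' b'
      rw [ep] at hp' e
      obtain ⟨S, k, ⟨i', j', hA', hB', ha, hb, rfl⟩, hX, -, -⟩ := hp'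
      simp only [guardB, Bool.cond_eq_ite, Option.ite_none_right_eq_some, Bool.and_eq_true,
        Option.some.injEq, Prod.mk.injEq] at h
      obtain ⟨⟨h₁, h₂⟩, rfl, rfl⟩ := h
      have ha' : W v (eraseCtx v Γ) (ann a' A) (A.erase v) :=
        ⟨_, i, ha, hA, .eq (hc.ty hΓ hA' hA h₁), rfl⟩
      have hBa := W.inst hΓ.ctx hB ha'
      have e₂ := hc.ty hΓ (W.inst hΓ.ctx hB' ha) hBa h₂
      rw [erase_inst] at e₂
      exact ⟨ha', ⟨_, j, hb, hBa, .eq e₂, (erase_inst _ _).symm⟩, e⟩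
    · cases h
  · cases h

theorem isRefl_sound (hw : WhSound v w) (hc : CvSound v cv) (hΓ : CxOK v Γ) {A a b p : ATm}
    {i : ℕ} (hA : W v (eraseCtx v Γ) A (.univ i)) (ha : W v (eraseCtx v Γ) a (A.erase v))
    (hb : W v (eraseCtx v Γ) b (A.erase v))
    (hp : W v (eraseCtx v Γ) p (.idt (A.erase v) (a.erase v) (b.erase v)))
    (h : isRefl w cv Γ A a b p = true) :
    Derivable (eraseCtx v Γ) (.eq (a.erase v) (b.erase v) (A.erase v)) ∧
      Derivable (eraseCtx v Γ) (.eq (.idp (a.erase v)) (p.erase v)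
        (.idt (A.erase v) (a.erase v) (a.erase v))) := by
  obtain ⟨hp', e⟩ := hw hΓ hp
  have hA₁ := hA.sound hΓ.ctx
  have ha₁ := ha.sound hΓ.ctx
  unfold isRefl at h
  split at h
  · rename_i x ep
    rw [ep] at hp' e
    obtain ⟨X, hx, eX⟩ := hp'
    injection eX with e₁ e₂ e₃
    rw [e₃, ← e₂] at e ⊢
    rw [erase, ← e₂] at e
    exact ⟨.eq_refl ha₁, e.eq_symm⟩
  · rename_i p' Y ep
    split at h
    · rename_i x
      rw [ep] at hp' e
      obtain ⟨S, k, ⟨X, hx, rfl⟩, hY, -, eY⟩ := hp'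
      split at h
      · rename_i X' hX'
        obtain ⟨rfl, l, hX⟩ := typeOf_sound hΓ hx hX'
        simp only [Bool.and_eq_true] at h
        obtain ⟨⟨h₁, h₂⟩, h₃⟩ := h
        have eA := hc.ty hΓ hA hX h₁
        have e₂ := hc hΓ ha hx .refl (.eq eA.eq_symm) h₂
        have e₃ := hc hΓ hb hx .refl (.eq eA.eq_symm) h₃
        have eab := e₂.eq_trans e₃.eq_symm
        refine ⟨eab, (Derivable.idp_congr e₂).eq_trans
          (Derivable.eq_conv (i := i) e.eq_symm ?_)⟩
        exact .idt_congr (.eq_refl hA₁) (.eq_refl ha₁) eab.eq_symm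
      · cases h
    · cases h
  · cases h

theorem cast_sound (hΓ : CxOK v Γ) {t X : ATm} {S : Tm} {k : ℕ} (ht : W v (eraseCtx v Γ) t S)
    (hX : W v (eraseCtx v Γ) X (.univ k)) (h : TyLe (eraseCtx v Γ) S (X.erase v)) :
    W v (eraseCtx v Γ) (cast Γ t X) (X.erase v) ∧ (cast Γ t X).erase v = t.erase v := by
  unfold cast
  split
  · rename_i S' hS'
    obtain ⟨rfl, -⟩ := typeOf_sound hΓ ht hS'
    cases e : eqv S' X with
    | true => exact ⟨eqv_sound (v := v) e ▸ ht, rfl⟩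
    | false => exact ⟨⟨_, k, ht, hX, h, rfl⟩, rfl⟩
  · exact ⟨⟨_, k, ht, hX, h, rfl⟩, rfl⟩

theorem WhSound.trans (hw : WhSound v w) (hΓ : CxOK v Γ) {t u : ATm} {T : Tm}
    (hu : W v (eraseCtx v Γ) u T)
    (h : Derivable (eraseCtx v Γ) (.eq (t.erase v) (u.erase v) T)) :
    W v (eraseCtx v Γ) (w Γ u) T ∧
      Derivable (eraseCtx v Γ) (.eq (t.erase v) ((w Γ u).erase v) T) :=
  ⟨(hw hΓ hu).1, h.eq_trans (hw hΓ hu).2⟩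

theorem whnfStep_sound (hw : WhSound v w) (hc : CvSound v cv) : WhSound v (whnfStep w cv) := by
  intro Γ t T hΓ ht
  have hΔ := hΓ.ctx
  have self : W v (eraseCtx v Γ) t T ∧
      Derivable (eraseCtx v Γ) (.eq (t.erase v) (t.erase v) T) := ⟨ht, .eq_refl (ht.sound hΔ)⟩
  cases t with
  | app f a =>
    obtain ⟨A, B, hf, ha, rfl⟩ := ht
    obtain ⟨hf', ef⟩ := hw hΓ hf
    have ha₁ := ha.sound hΔ
    have stuck : W v (eraseCtx v Γ) (app (w Γ f) a) (B.inst (a.erase v)) ∧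
        Derivable (eraseCtx v Γ) (.eq ((app f a).erase v) ((app (w Γ f) a).erase v)
          (B.inst (a.erase v))) :=
      ⟨⟨A, B, hf', ha, rfl⟩, .app_congr ef (.eq_refl ha₁)⟩
    simp only [whnfStep]
    split
    · rename_i A₁ b e
      rw [e] at hf' stuck
      obtain ⟨k, B₁, hA₁, hb, eAB⟩ := hf'
      cases eAB
      refine hw.trans hΓ (W.inst hΔ hb ha) (stuck.2.eq_trans ?_)
      rw [erase_inst]
      exact .pi_beta (hA₁.sound hΔ) (hb.sound (.ctx_cons (hA₁.sound hΔ))) ha₁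
    · rename_i f' X e
      rw [e] at hf' stuck
      split
      · rename_i A₁ b A' B' eX
        obtain ⟨S, k, ⟨i, B₁, hA₁, hb, rfl⟩, hX, -, eAB⟩ := hf'
        split
        · rename_i B₂ hB₂
          cases hcv : (cv Γ A' A₁ && cv Γ B₂ (B'.inst a)) with
          | false => exact stuck
          | true =>
            rw [Bool.and_eq_true] at hcv
            obtain ⟨Y, hX', -⟩ := hX.strip
            rw [eX] at hX'
            rw [← erase_strip, eX] at eAB
            cases eAB
            obtain ⟨k', l', hA', hB', -⟩ := hX'
            have eA := hc.ty hΓ hA' hA₁ hcv.1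
            have haA : W v (eraseCtx v Γ) (ann a A₁) (A₁.erase v) :=
              ⟨_, i, ha, hA₁, .eq eA, rfl⟩
            have hb' := W.inst hΔ hb haA
            obtain ⟨eB₂, l, hB₂'⟩ := typeOf_sound hΓ hb' hB₂
            have hBa := W.inst hΔ hB' ha
            have eB := hc.ty hΓ hB₂' hBa hcv.2
            rw [eB₂, erase_inst] at eB
            refine hw.trans hΓ ⟨_, l', hb', hBa, .eq (by rw [erase_inst]; exact eB),
              (erase_inst _ _).symm⟩ (stuck.2.eq_trans ?_)
            have := Derivable.pi_beta (hA₁.sound hΔ) (hb.sound (.ctx_cons (hA₁.sound hΔ)))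
              (ha₁.conv eA)
            simp only [erase, erase_inst]
            exact this.eq_conv eB
        · exact stuck
      · exact stuck
    · rename_i f' h₁ h₂
      exact stuck
  | fst A B p =>
    obtain ⟨i, j, hA, hB, hp, rfl⟩ := ht
    simp only [whnfStep]
    split
    · rename_i a b e
      obtain ⟨ha, hb, ep⟩ := asPair_sound hw hc hΓ hA hB hp e
      have hA₁ := hA.sound hΔ
      have hB₁ := hB.sound (.ctx_cons hA₁)
      exact hw.trans hΓ ha ((Derivable.fst_congr hA₁ hB₁ (hp.sound hΔ) (.eq_refl hA₁)
        (.eq_refl hB₁) ep).eq_trans (.fst_beta hΔ hA₁ hB₁ (ha.sound hΔ) (hb.sound hΔ)))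
    · exact self
  | snd A B p =>
    obtain ⟨i, j, hA, hB, hp, rfl⟩ := ht
    simp only [whnfStep]
    split
    · rename_i a b e
      obtain ⟨ha, hb, ep⟩ := asPair_sound hw hc hΓ hA hB hp e
      have hA₁ := hA.sound hΔ
      have hB₁ := hB.sound (.ctx_cons hA₁)
      have hp₁ := hp.sound hΔ
      have ha₁ := ha.sound hΔ
      have hb₁ := hb.sound hΔ
      have hpp := Derivable.pair' hA₁ hB₁ ha₁ hb₁
      have e₁ := Derivable.fst_congr hA₁ hB₁ hp₁ (.eq_refl hA₁) (.eq_refl hB₁) ep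
      have e₂ := Derivable.fst_beta hΔ hA₁ hB₁ ha₁ hb₁
      have hf : W v (eraseCtx v Γ) (fst A B p) (A.erase v) := ⟨i, j, hA, hB, hp, rfl⟩
      have hBf := W.inst hΔ hB hf
      have e₃ := Derivable.inst_congr hA₁ hB₁ ha₁ (hf.sound hΔ) (e₁.eq_trans e₂).eq_symm
      have e₄ := Derivable.inst_congr hA₁ hB₁ (.fst hA₁ hB₁ hpp) (hf.sound hΔ) e₁.eq_symm
      refine hw.trans hΓ ⟨_, j, hb, hBf, .eq (k := j) ?_, (erase_inst B (fst A B p)).symm⟩ ?_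
      · rw [erase_inst]; exact e₃
      · exact (Derivable.snd_congr hA₁ hB₁ hp₁ hA₁ hB₁ hB₁ (.eq_refl hA₁) (.eq_refl hB₁)
          ep).eq_trans (.eq_conv (.snd_beta hΔ hA₁ hB₁ ha₁ hb₁) e₄)
    · exact self
  | split A B M c p =>
    obtain ⟨i, j, k, hA, hB, hM, hc', hp, rfl⟩ := ht
    simp only [whnfStep]
    split
    · rename_i a b e
      obtain ⟨ha, hb, ep⟩ := asPair_sound hw hc hΓ hA hB hp e
      have hA₁ := hA.sound hΔ
      have hB₁ := hB.sound (.ctx_cons hA₁)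
      have hp₁ := hp.sound hΔ
      have ha₁ := ha.sound hΔ
      have hb₁ := hb.sound hΔ
      have hM₁ := hM.sound (.ctx_cons (.sigma' hA₁ hB₁))
      have hc₁ := hc'.sound (.ctx_cons hB₁)
      have hMp := W.inst hΔ hM hp
      have hcab := W.inst₂ hΔ (.ctx_cons (Derivable.inst hΔ hB₁ ha₁)) hc' ha hb
      rw [inst₂_instUp, inst₂_eq (.pair _ _)] at hcab
      have e₃ := Derivable.inst_congr (.sigma' hA₁ hB₁) hM₁ (.pair' hA₁ hB₁ ha₁ hb₁) hp₁
        ep.eq_symm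
      refine hw.trans hΓ ⟨_, k, hcab, hMp, .eq (k := k) ?_, (erase_inst _ _).symm⟩ ?_
      · rw [erase_inst]; exact e₃
      · simp only [erase, erase_inst₂]
        exact (Derivable.split_congr hA₁ hB₁ hM₁ hp₁ (.eq_refl hA₁) (.eq_refl hB₁)
          (.eq_refl hM₁) (.eq_refl hc₁) ep).eq_trans
          (.eq_conv (.split_beta hΔ hA₁ hB₁ hM₁ hc₁ ha₁ hb₁) e₃)
    · exact self
  | pathInd A a b M c p =>
    obtain ⟨i, k, hA, ha, hb, hM, hc', hp, rfl⟩ := ht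
    simp only [whnfStep]
    cases e : isRefl w cv Γ A a b p with
    | false => exact self
    | true =>
      obtain ⟨eab, ep⟩ := isRefl_sound hw hc hΓ hA ha hb hp e
      have hA₁ := hA.sound hΔ
      have hp₁ := hp.sound hΔ
      have ha₁ := ha.sound hΔ
      have hb₁ := hb.sound hΔ
      have hM₁ := hM.sound (.ctx_cons (.idt_up hA₁ ha₁))
      have hc₁ := hc'.sound hΔ
      have hMp := W.inst₂ hΔ (b := p) (by
        rw [Derivable.inst_idt_up]; exact .ctx_cons (.idt hA₁ ha₁ hb₁)) hM hb (by
        rw [Derivable.inst_idt_up]; exact hp)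
      have e₁ := Derivable.path_motive hΔ hA₁ ha₁ hM₁ hb₁ hp₁
      have e₂ := Derivable.path_motive hΔ hA₁ ha₁ hM₁ ha₁ (.idp ha₁)
      have eC := Derivable.app_congr
        (.eq_refl (.lam hA₁ (.lam (.idt_up hA₁ ha₁) hM₁))) eab
      rw [show (Tm.pi (.idt (A.erase v).wk (a.erase v).wk (.var 0)) (.univ k)).inst (a.erase v) =
        .pi (.idt (A.erase v) (a.erase v) (a.erase v)) (.univ k) from
          congrArg (fun P => Tm.pi P (.univ k)) (Derivable.inst_idt_up _ _ _)] at eC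
      have e₃ := Derivable.app_congr eC ep
      have e₄ := (e₂.eq_symm.eq_trans e₃).eq_trans e₁
      refine hw.trans hΓ ⟨_, k, hc', hMp, .eq (k := k) ?_, (erase_inst₂ _ _ _).symm⟩ ?_
      · rw [erase_inst₂]; exact e₄
      · have eT := Derivable.idt_congr (i := i) (.eq_refl hA₁) (.eq_refl ha₁) eab
        exact (Derivable.pathInd_congr hΔ hA₁ ha₁ hM₁ hb₁ hp₁ (.eq_refl hA₁) (.eq_refl ha₁)
          (.eq_refl hM₁) (.eq_refl hc₁) (.eq_conv ep.eq_symm eT)).eq_trans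
          (.eq_conv (.pathInd_beta hΔ hA₁ ha₁ hM₁ hc₁) e₄)
  | natInd M z s n =>
    obtain ⟨k, hM, hz, hs, hn, rfl⟩ := ht
    have hN := Derivable.nat hΔ
    have hM₁ := hM.sound (.ctx_cons hN)
    have hz₁ := hz.sound hΔ
    have hs₁ := hs.sound (.ctx_cons hM₁)
    have hMn := W.inst hΔ hM hn
    obtain ⟨hn', en⟩ := hw hΓ hn
    have e₃ := Derivable.inst_congr hN hM₁ (hn'.sound hΔ) (hn.sound hΔ) en.eq_symm
    have e₄ := Derivable.natInd_congr hΔ hM₁ (hn.sound hΔ) (.eq_refl hM₁) (.eq_refl hz₁)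
      (.eq_refl hs₁) en
    simp only [whnfStep]
    split
    · rename_i e
      rw [e] at hn' e₃ e₄
      refine hw.trans hΓ ⟨_, k, hz, hMn, .eq (k := k) ?_, (erase_inst _ _).symm⟩ ?_
      · rw [erase_inst]; exact e₃
      · exact e₄.eq_trans (.eq_conv (.natInd_beta_zero hΔ hM₁ hz₁ hs₁) e₃)
    · rename_i m e
      rw [e] at hn' e₃ e₄
      obtain ⟨hm, -⟩ := hn'
      have hr : W v (eraseCtx v Γ) (natInd M z s m) ((M.erase v).inst (m.erase v)) :=
        ⟨k, hM, hz, hs, hm, rfl⟩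
      have hsm := W.inst₂ hΔ (.ctx_cons (Derivable.inst hΔ hM₁ (hm.sound hΔ))) hs hm hr
      rw [inst₂_instUp, inst₂_eq (.succ _)] at hsm
      refine hw.trans hΓ ⟨_, k, hsm, hMn, .eq (k := k) ?_, (erase_inst _ _).symm⟩ ?_
      · rw [erase_inst]; exact e₃
      · simp only [erase, erase_inst₂] at e₄ ⊢
        exact e₄.eq_trans (.eq_conv (.natInd_beta_succ hΔ hM₁ hz₁ hs₁ (hm.sound hΔ)) e₃)
    · exact self
  | intInd M z p m x =>
    obtain ⟨k, hM, hz, hp, hm, hx, rfl⟩ := ht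
    have hZ := Derivable.int hΔ
    have hN := Derivable.ctx_cons (Derivable.nat hΔ)
    have hM₁ := hM.sound (.ctx_cons hZ)
    have hz₁ := hz.sound hΔ
    have hp₁ := hp.sound hN
    have hm₁ := hm.sound hN
    have hMx := W.inst hΔ hM hx
    obtain ⟨hx', ex⟩ := hw hΓ hx
    have e₃ := Derivable.inst_congr hZ hM₁ (hx'.sound hΔ) (hx.sound hΔ) ex.eq_symm
    have e₄ := Derivable.intInd_congr hΔ hM₁ (hx.sound hΔ) (.eq_refl hM₁) (.eq_refl hz₁)
      (.eq_refl hp₁) (.eq_refl hm₁) ex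
    simp only [whnfStep]
    split
    · rename_i e
      rw [e] at hx' e₃ e₄
      refine hw.trans hΓ ⟨_, k, hz, hMx, .eq (k := k) ?_, (erase_inst _ _).symm⟩ ?_
      · rw [erase_inst]; exact e₃
      · exact e₄.eq_trans (.eq_conv (.intInd_beta_zero hΔ hM₁ hz₁ hp₁ hm₁) e₃)
    · rename_i n e
      rw [e] at hx' e₃ e₄
      obtain ⟨hn, -⟩ := hx'
      have hpn := W.inst hΔ hp hn
      rw [inst_instUp, inst_eq (.ipos _)] at hpn
      refine hw.trans hΓ ⟨_, k, hpn, hMx, .eq (k := k) ?_, (erase_inst _ _).symm⟩ ?_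
      · rw [erase_inst]; exact e₃
      · simp only [erase, erase_inst] at e₄ ⊢
        exact e₄.eq_trans (.eq_conv (.intInd_beta_pos hΔ hM₁ hz₁ hp₁ hm₁ (hn.sound hΔ)) e₃)
    · rename_i n e
      rw [e] at hx' e₃ e₄
      obtain ⟨hn, -⟩ := hx'
      have hmn := W.inst hΔ hm hn
      rw [inst_instUp, inst_eq (.ineg _)] at hmn
      refine hw.trans hΓ ⟨_, k, hmn, hMx, .eq (k := k) ?_, (erase_inst _ _).symm⟩ ?_
      · rw [erase_inst]; exact e₃
      · simp only [erase, erase_inst] at e₄ ⊢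
        exact e₄.eq_trans (.eq_conv (.intInd_beta_neg hΔ hM₁ hz₁ hp₁ hm₁ (hn.sound hΔ)) e₃)
    · exact self
  | ann t X =>
    obtain ⟨S, k, ht, hX, hS, rfl⟩ := ht
    obtain ⟨ht', et⟩ := hw hΓ ht
    have key {x : ATm} {S' : Tm} (hx : W v (eraseCtx v Γ) x S')
        (hS' : TyLe (eraseCtx v Γ) S' (X.erase v))
        (ex : Derivable (eraseCtx v Γ) (.eq (t.erase v) (x.erase v) (X.erase v))) :
        W v (eraseCtx v Γ) (bif isIntro x then cast Γ x X else ann x X) (X.erase v) ∧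
        Derivable (eraseCtx v Γ) (.eq ((ann t X).erase v)
          ((bif isIntro x then cast Γ x X else ann x X).erase v) (X.erase v)) := by
      cases isIntro x with
      | true =>
        obtain ⟨h₁, h₂⟩ := cast_sound hΓ hx hX hS'
        exact ⟨h₁, by rw [cond_true, h₂]; exact ex⟩
      | false => exact ⟨⟨S', k, hx, hX, hS', rfl⟩, ex⟩
    simp only [whnfStep]
    split
    · rename_i x Y e
      rw [e] at ht' et
      obtain ⟨S', k', hx, hY, hS', rfl⟩ := ht'
      exact key hx (hS'.trans hS) (hS.mem_eq et)
    · exact key ht' hS (hS.mem_eq et)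
  | _ => exact self

end ATm

end HoTT

namespace HoTT

open Tm

namespace ATm

variable {v : ℕ × ℕ} {w : ACtx → ATm → ATm} {cv : ACtx → ATm → ATm → Bool} {Γ : ACtx}

theorem convTerm_sound (hc : CvSound v cv) (hΓ : CxOK v Γ) {t u : ATm} {S T : Tm}
    (ht : W v (eraseCtx v Γ) t S) (hu : W v (eraseCtx v Γ) u T)
    (h : convTerm cv Γ t u = true) :
    Derivable (eraseCtx v Γ) (.eq (t.erase v) (u.erase v) S) := by
  unfold convTerm at h
  rw [Bool.or_eq_true] at h
  rcases h with h | h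
  · rw [← eqv_sound (v := v) h]; exact .eq_refl (ht.sound hΓ.ctx)
  · split at h
    · rename_i S' T' hS hT
      obtain ⟨rfl, k, hS⟩ := typeOf_sound hΓ ht hS
      obtain ⟨rfl, l, hT⟩ := typeOf_sound hΓ hu hT
      rw [Bool.and_eq_true] at h
      exact hc hΓ ht hu .refl (.eq (hc.ty hΓ hS hT h.1).eq_symm) h.2
    · cases h

theorem W.appVar {Γ : Ctx} {f : ATm} {A B : Tm} {i : ℕ} (hA : Derivable Γ (.mem A (.univ i)))
    (hf : W v Γ f (.pi A B)) : W v (A :: Γ) (app f.wk (var 0)) B := by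
  refine ⟨A.wk, B.ren (liftRen fun n => n + 1), hf.wk (.ctx_cons hA), .zero, ?_⟩
  exact (instUp_one_var B).symm

theorem convEta_sound (hc : CvSound v cv) (hΓ : CxOK v Γ) {f A b : ATm} {S T : Tm}
    (hf : W v (eraseCtx v Γ) f S) (hb : W v (eraseCtx v Γ) (lam A b) T)
    (h : convEta cv Γ f A b = true) :
    Derivable (eraseCtx v Γ) (.eq (f.erase v) ((lam A b).erase v) S) := by
  have hΔ := hΓ.ctx
  unfold convEta at h
  split at h
  · rename_i F hF
    obtain ⟨rfl, k, hF⟩ := typeOf_sound hΓ hf hF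
    split at h
    · rename_i A' B' eF
      obtain ⟨U, hF', -⟩ := hF.strip
      rw [← erase_strip F, eF] at hf ⊢
      rw [eF] at hF'
      obtain ⟨i, j, hA', hB', -⟩ := hF'
      obtain ⟨i', B₁, hA, hb, -⟩ := hb
      rw [Bool.and_eq_true] at h
      have eA := hc.ty hΓ hA' hA h.1
      have hb' := W.retype hΔ hA' hA (.eq eA) hb
      have hA'₁ := hA'.sound hΔ
      have hΓ' : CxOK v (A' :: Γ) := ⟨hΓ, i, hA'⟩
      replace h := h.2
      split at h
      · rename_i B hB
        obtain ⟨rfl, j', hB⟩ := typeOf_sound hΓ' hb' hB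
        rw [Bool.and_eq_true] at h
        have eB := hc.ty hΓ' hB' hB h.1
        have e := hc hΓ' (hf.appVar hA'₁) hb' .refl (.eq eB.eq_symm) h.2
        simp only [erase, erase_wk, erase_retype] at e ⊢
        exact (Derivable.pi_eta (hf.sound hΔ)).eq_trans
          (.lam_congr (hA'₁.cumul_le (le_max_left i i')) eA e)
      · cases h
    · cases h
  · cases h

theorem eq_univ_max {Γ : Ctx} {A B C : Tm} {m n : ℕ}
    (h : Derivable Γ (.eq A B (.univ (max m n)))) (hm : TyLe Γ (.univ m) C)
    (hn : TyLe Γ (.univ n) C) : Derivable Γ (.eq A B C) := by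
  rcases le_total m n with hmn | hmn
  · rw [max_eq_right hmn] at h; exact hn.mem_eq h
  · rw [max_eq_left hmn] at h; exact hm.mem_eq h

/-- Conversion of families of types over equal types. -/
theorem CvSound.family (hc : CvSound v cv) (hΓ : CxOK v Γ) {A A' B B' : ATm} {i j i' j' : ℕ}
    (hA : W v (eraseCtx v Γ) A (.univ i)) (hA' : W v (eraseCtx v Γ) A' (.univ i'))
    (hB : W v (A.erase v :: eraseCtx v Γ) B (.univ j))
    (hB' : W v (A'.erase v :: eraseCtx v Γ) B' (.univ j')) (h₁ : cv Γ A A' = true)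
    (h₂ : cv (A :: Γ) B (retype A A' B') = true) :
    Derivable (eraseCtx v Γ) (.eq (A.erase v) (A'.erase v) (.univ (max i i'))) ∧
      Derivable (A.erase v :: eraseCtx v Γ) (.eq (B.erase v) (B'.erase v) (.univ (max j j'))) ∧
      W v (A.erase v :: eraseCtx v Γ) (retype A A' B') (.univ j') := by
  have eA := hc.ty hΓ hA hA' h₁
  have hB₁ := W.retype hΓ.ctx hA hA' (.eq eA) hB'
  have eB := hc.ty (Γ := A :: Γ) ⟨hΓ, i, hA⟩ hB hB₁ h₂
  rw [erase_retype] at eB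
  exact ⟨eA, eB, hB₁⟩

theorem convHead_sound (hc : CvSound v cv) : CvSound v (convHead cv) := by
  intro Γ t u S T C hΓ ht hu hS hT h
  have hΔ := hΓ.ctx
  cases t with
  | pi A B =>
    simp only [convHead] at h
    split at h
    · rename_i A' B'
      obtain ⟨i, j, hA, hB, rfl⟩ := ht
      obtain ⟨i', j', hA', hB', rfl⟩ := hu
      rw [Bool.and_eq_true] at h
      obtain ⟨eA, eB, -⟩ := hc.family hΓ hA hA' hB hB' h.1 h.2
      refine eq_univ_max (m := max i j) (n := max i' j') ?_ hS hT
      exact .pi_congr ((hA.sound hΔ).cumul_le (by omega)) (eA.eq_cumul_le (by omega))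
        (eB.eq_cumul_le (by omega))
    · cases h
  | sigma A B =>
    simp only [convHead] at h
    split at h
    · rename_i A' B'
      obtain ⟨i, j, hA, hB, rfl⟩ := ht
      obtain ⟨i', j', hA', hB', rfl⟩ := hu
      rw [Bool.and_eq_true] at h
      obtain ⟨eA, eB, -⟩ := hc.family hΓ hA hA' hB hB' h.1 h.2
      refine eq_univ_max (m := max i j) (n := max i' j') ?_ hS hT
      exact .sigma_congr ((hA.sound hΔ).cumul_le (by omega)) (eA.eq_cumul_le (by omega))
        (eB.eq_cumul_le (by omega))
    · cases h
  | lam A b =>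
    simp only [convHead] at h
    split at h
    · rename_i A' b'
      obtain ⟨i, B, hA, hb, rfl⟩ := ht
      obtain ⟨i', B', hA', hb', rfl⟩ := hu
      rw [Bool.and_eq_true] at h
      have eA := hc.ty hΓ hA hA' h.1
      have e := convTerm_sound hc (Γ := A :: Γ) ⟨hΓ, i, hA⟩ hb
        (W.retype hΔ hA hA' (.eq eA) hb') h.2
      rw [erase_retype] at e
      exact hS.mem_eq (.lam_congr ((hA.sound hΔ).cumul_le (le_max_left i i')) eA e)
    · cases h
  | app f a =>
    simp only [convHead] at h
    split at h
    · obtain ⟨A, B, hf, ha, rfl⟩ := ht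
      obtain ⟨A', B', hf', ha', rfl⟩ := hu
      rw [Bool.and_eq_true] at h
      exact hS.mem_eq (.app_congr (convTerm_sound hc hΓ hf hf' h.1)
        (convTerm_sound hc hΓ ha ha' h.2))
    · cases h
  | pair A B a b =>
    simp only [convHead] at h
    split at h
    · obtain ⟨i, j, hA, hB, ha, hb, rfl⟩ := ht
      obtain ⟨i', j', hA', hB', ha', hb', rfl⟩ := hu
      rw [Bool.and_eq_true] at h
      have hA₁ := hA.sound hΔ
      exact hS.mem_eq (.pair_congr (hA₁.cumul_le (le_max_left i j))
        ((hB.sound (.ctx_cons hA₁)).cumul_le (le_max_right i j))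
        (convTerm_sound hc hΓ ha ha' h.1) (convTerm_sound hc hΓ hb hb' h.2))
    · cases h
  | fst A B p =>
    simp only [convHead] at h
    split at h
    · obtain ⟨i, j, hA, hB, hp, rfl⟩ := ht
      obtain ⟨i', j', hA', hB', hp', rfl⟩ := hu
      simp only [Bool.and_eq_true] at h
      obtain ⟨⟨h₁, h₂⟩, h₃⟩ := h
      obtain ⟨eA, eB, -⟩ := hc.family hΓ hA hA' hB hB' h₁ h₂
      have hA₁ := (hA.sound hΔ).cumul_le (le_max_left i i')
      have hB₁ := (hB.sound (.ctx_cons hA₁)).cumul_le (le_max_left j j')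
      have eS := Derivable.sigma_congr (i := max (max i i') (max j j'))
        (hA₁.cumul_le (by omega)) (eA.eq_cumul_le (by omega)) (eB.eq_cumul_le (by omega))
      exact hS.mem_eq (.fst_congr hA₁ hB₁ (hp.sound hΔ) eA eB
        (hc hΓ hp hp' .refl (.eq eS.eq_symm) h₃))
    · cases h
  | snd A B p =>
    simp only [convHead] at h
    split at h
    · obtain ⟨i, j, hA, hB, hp, rfl⟩ := ht
      obtain ⟨i', j', hA', hB', hp', rfl⟩ := hu
      simp only [Bool.and_eq_true] at h
      obtain ⟨⟨h₁, h₂⟩, h₃⟩ := h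
      obtain ⟨eA, eB, hB''⟩ := hc.family hΓ hA hA' hB hB' h₁ h₂
      have hA₁ := (hA.sound hΔ).cumul_le (le_max_left i i')
      have hB₁ := (hB.sound (.ctx_cons hA₁)).cumul_le (le_max_left j j')
      have hA'₁ := hA'.sound hΔ
      have hB''₁ := (hB''.sound (.ctx_cons hA₁)).cumul_le (le_max_right j j')
      rw [erase_retype] at hB''₁
      have eS := Derivable.sigma_congr (i := max (max i i') (max j j'))
        (hA₁.cumul_le (by omega)) (eA.eq_cumul_le (by omega)) (eB.eq_cumul_le (by omega))
      exact hS.mem_eq (.snd_congr hA₁ hB₁ (hp.sound hΔ) hA'₁ (hB'.sound (.ctx_cons hA'₁))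
        hB''₁ eA eB (hc hΓ hp hp' .refl (.eq eS.eq_symm) h₃))
    · cases h
  | split A B M c p =>
    simp only [convHead] at h
    split at h
    · rename_i A' B' M' c' p'
      obtain ⟨i, j, k, hA, hB, hM, hcc, hp, rfl⟩ := ht
      obtain ⟨i', j', k', hA', hB', hM', hcc', hp', rfl⟩ := hu
      simp only [Bool.and_eq_true] at h
      obtain ⟨⟨⟨⟨h₁, h₂⟩, h₃⟩, h₄⟩, h₅⟩ := h
      obtain ⟨eA, eB, hB''⟩ := hc.family hΓ hA hA' hB hB' h₁ h₂
      have hA₁ := (hA.sound hΔ).cumul_le (le_max_left i i')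
      have hB₁ := (hB.sound (.ctx_cons hA₁)).cumul_le (le_max_left j j')
      have eS := Derivable.sigma_congr (i := max (max i i') (max j j'))
        (hA₁.cumul_le (by omega)) (eA.eq_cumul_le (by omega)) (eB.eq_cumul_le (by omega))
      have hSg : W v (eraseCtx v Γ) (sigma A B) (.univ (max i j)) := ⟨i, j, hA, hB, rfl⟩
      have hSg' : W v (eraseCtx v Γ) (sigma A' B') (.univ (max i' j')) := ⟨i', j', hA', hB', rfl⟩
      have hM₂ := W.retype hΔ hSg hSg' (.eq eS) hM'
      have eM := hc.ty (Γ := sigma A B :: Γ) ⟨hΓ, _, hSg⟩ hM hM₂ h₄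
      rw [erase_retype] at eM
      have hM₁ := (hM.sound (.ctx_cons (hSg.sound hΔ))).cumul_le (le_max_left k k')
      have hctx' : Derivable (B'.erase v :: A.erase v :: eraseCtx v Γ) .ctx := by
        have := hB''.sound (.ctx_cons hA₁)
        rw [erase_retype] at this
        exact .ctx_cons this
      have hc₁ := W.retype₁ hΔ hA hA' (.eq eA) hB' hctx' hcc'
      rw [← erase_retype A A' B'] at hc₁
      have eB' := eB
      rw [← erase_retype A A' B'] at eB'
      have hc₂ := W.retype (.ctx_cons hA₁) hB hB'' (.eq eB') hc₁
      have hctx : Derivable (B.erase v :: A.erase v :: eraseCtx v Γ) .ctx := .ctx_cons hB₁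
      have hΓ₂ : CxOK v (B :: A :: Γ) := ⟨⟨hΓ, i, hA⟩, j, hB⟩
      -- the motives are equal at the pair of the two variables
      have eMp := (eM.ren ((renOK_shift 2 (Derivable.renOK_two (eraseCtx v Γ) (A.erase v)
          (B.erase v))).lift _) (.ctx_cons (by
            rw [shiftRen_zero]
            exact (hSg.sound hΔ).ren (Derivable.renOK_two _ _ _) hctx))).sub
          (.single hctx (by
            rw [shiftRen_zero]
            exact Derivable.split_branch hA₁ hB₁)) hctx
      simp only [Judgment.ren, Judgment.sub, ← inst_eq, shiftRen_zero] at eMp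
      have ec := hc hΓ₂ hcc hc₂ .refl (.eq eMp.eq_symm) h₅
      rw [erase_retype, erase_retype₁] at ec
      exact hS.mem_eq (.split_congr hA₁ hB₁ hM₁ (hp.sound hΔ) eA eB eM ec
        (hc hΓ hp hp' .refl (.eq eS.eq_symm) h₃))
    · cases h
  | idt A a b =>
    simp only [convHead] at h
    split at h
    · obtain ⟨i, hA, ha, hb, rfl⟩ := ht
      obtain ⟨i', hA', ha', hb', rfl⟩ := hu
      simp only [Bool.and_eq_true] at h
      obtain ⟨⟨h₁, h₂⟩, h₃⟩ := h
      have eA := hc.ty hΓ hA hA' h₁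
      exact eq_univ_max (.idt_congr eA (hc hΓ ha ha' .refl (.eq eA.eq_symm) h₂)
        (hc hΓ hb hb' .refl (.eq eA.eq_symm) h₃)) hS hT
    · cases h
  | idp a =>
    simp only [convHead] at h
    split at h
    · obtain ⟨A, ha, rfl⟩ := ht
      obtain ⟨A', ha', rfl⟩ := hu
      exact hS.mem_eq (.idp_congr (convTerm_sound hc hΓ ha ha' h))
    · cases h
  | pathInd A a b M c p =>
    simp only [convHead] at h
    split at h
    · rename_i A' a' b' M' c' p'
      obtain ⟨i, k, hA, ha, hb, hM, hcc, hp, rfl⟩ := ht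
      obtain ⟨i', k', hA', ha', hb', hM', hcc', hp', rfl⟩ := hu
      simp only [Bool.and_eq_true] at h
      obtain ⟨⟨⟨⟨⟨h₁, h₂⟩, h₃⟩, h₄⟩, h₅⟩, h₆⟩ := h
      have eA := hc.ty hΓ hA hA' h₁
      have ea := hc hΓ ha ha' .refl (.eq eA.eq_symm) h₂
      have eb := hc hΓ hb hb' .refl (.eq eA.eq_symm) h₃
      have hA₁ := (hA.sound hΔ).cumul_le (le_max_left i i')
      have hA'₁ := hA'.sound hΔ
      have ha₁ := ha.sound hΔ
      have ha'₁ := ha'.sound hΔ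
      have hp₁ := hp.sound hΔ
      have ep := hc hΓ hp hp' .refl (.eq (Derivable.idt_congr eA ea eb).eq_symm) h₄
      have hΔA := Derivable.ctx_cons hA₁
      have hΔA' := Derivable.ctx_cons hA'₁
      have hP {A a : ATm} {i : ℕ} (hA : W v (eraseCtx v Γ) A (.univ i))
          (ha : W v (eraseCtx v Γ) a (A.erase v)) :
          W v (A.erase v :: eraseCtx v Γ) (idt A.wk a.wk (var 0)) (.univ i) := by
        have hΔA := Derivable.ctx_cons (hA.sound hΔ)
        refine ⟨i, hA.wk hΔA, ?_, ?_, rfl⟩ <;> rw [erase_wk]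
        · exact ha.wk hΔA
        · exact .zero
      have eP (A a : ATm) : (idt A.wk a.wk (var 0)).erase v =
          .idt (A.erase v).wk (a.erase v).wk (.var 0) := by simp only [erase, erase_wk]
      have hP₂ := W.retype hΔ hA hA' (.eq eA) (hP hA' ha')
      have ePP : Derivable (A.erase v :: eraseCtx v Γ) (.eq
          ((idt A.wk a.wk (var 0)).erase v)
          ((ATm.retype A A' (idt A'.wk a'.wk (var 0))).erase v) (.univ (max i i'))) := by
        rw [erase_retype, eP, eP]
        exact .idt_congr (eA.weaken_eq hΔA) (ea.weaken_eq hΔA) (.eq_refl hΔA.var_zero)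
      have hM₁ : W v ((idt A'.wk a'.wk (var 0)).erase v :: A'.erase v :: eraseCtx v Γ) M'
          (.univ k') := by rw [eP]; exact hM'
      have hctx : Derivable ((idt A'.wk a'.wk (var 0)).erase v :: A.erase v :: eraseCtx v Γ)
          .ctx := by
        have := hP₂.sound hΔA
        rw [erase_retype] at this
        exact .ctx_cons this
      have hM₂ := W.retype₁ hΔ hA hA' (.eq eA) (hP hA' ha') hctx hM₁
      rw [← erase_retype A A' (idt A'.wk a'.wk (var 0))] at hM₂
      have hM₃ := W.retype hΔA (hP hA ha) hP₂ (.eq ePP) hM₂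
      have hM₀ : W v ((idt A.wk a.wk (var 0)).erase v :: A.erase v :: eraseCtx v Γ) M
          (.univ k) := by rw [eP]; exact hM
      have eM := hc.ty (Γ := idt A.wk a.wk (var 0) :: A :: Γ) ⟨⟨hΓ, i, hA⟩, i, hP hA ha⟩ hM₀
        hM₃ h₅
      rw [erase_retype, erase_retype₁] at eM
      change Derivable ((idt A.wk a.wk (var 0)).erase v :: A.erase v :: eraseCtx v Γ) _ at eM
      rw [eP] at eM
      have hMk := (hM.sound (.ctx_cons (.idt_up hA₁ ha₁))).cumul_le (le_max_left k k')
      -- the motives are equal at the reflexivity path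
      have eMa : Derivable (eraseCtx v Γ) (.eq ((M.erase v).inst₂ (a.erase v) (.idp (a.erase v)))
          ((M'.erase v).inst₂ (a'.erase v) (.idp (a'.erase v))) (.univ (max k k'))) := by
        have e₁ := Derivable.path_motive hΔ hA₁ ha₁ hMk ha₁ (.idp ha₁)
        have e₂ := Derivable.path_motive hΔ hA'₁ ha'₁
          (hM'.sound (.ctx_cons (.idt_up hA'₁ ha'₁))) ha'₁ (.idp ha'₁)
        have e₃ := Derivable.lam_congr hA₁ eA (.lam_congr (.idt_up hA₁ ha₁)
          (.idt_congr (eA.weaken_eq hΔA) (ea.weaken_eq hΔA) (.eq_refl hΔA.var_zero)) eM)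
        have e₄ := Derivable.app_congr e₃ ea
        rw [show (Tm.pi (.idt (A.erase v).wk (a.erase v).wk (.var 0))
          (.univ (max k k'))).inst (a.erase v) =
          .pi (.idt (A.erase v) (a.erase v) (a.erase v)) (.univ (max k k')) from
            congrArg (fun P => Tm.pi P (.univ (max k k'))) (Derivable.inst_idt_up _ _ _)] at e₄
        exact (e₁.eq_symm.eq_trans (.app_congr e₄ (.idp_congr ea))).eq_trans
          (e₂.eq_cumul_le (le_max_right k k'))
      exact hS.mem_eq (.pathInd_congr hΔ hA₁ ha₁ hMk (hb.sound hΔ) hp₁ eA ea eM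
        (hc hΓ hcc hcc' .refl (.eq eMa.eq_symm) h₆) ep)
    · cases h
  | succ n =>
    simp only [convHead] at h
    split at h
    · obtain ⟨hn, rfl⟩ := ht
      obtain ⟨hn', rfl⟩ := hu
      exact hS.mem_eq (.succ_congr (hc hΓ hn hn' .refl .refl h))
    · cases h
  | natInd M z s n =>
    simp only [convHead] at h
    split at h
    · rename_i M' z' s' n'
      obtain ⟨k, hM, hz, hs, hn, rfl⟩ := ht
      obtain ⟨k', hM', hz', hs', hn', rfl⟩ := hu
      simp only [Bool.and_eq_true] at h
      obtain ⟨⟨⟨h₁, h₂⟩, h₃⟩, h₄⟩ := h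
      have hN := Derivable.nat hΔ
      have hΔN := Derivable.ctx_cons hN
      have hΓN : CxOK v (nat :: Γ) := ⟨hΓ, 0, rfl⟩
      have eM := hc.ty hΓN hM hM' h₂
      have hM₁ := (hM.sound hΔN).cumul_le (le_max_left k k')
      have hM'₁ := (hM'.sound hΔN).cumul_le (le_max_right k k')
      have e₀ := Derivable.inst_congr₂ hN hM₁ hM'₁ eM (.zero hΔ) (.zero hΔ)
        (.eq_refl (.zero hΔ))
      have hs₁ := W.retype hΔN hM hM' (.eq eM) hs'
      have hctx : Derivable (M.erase v :: .nat :: eraseCtx v Γ) .ctx := .ctx_cons hM₁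
      have e₁ := (eM.ren ((Derivable.renOK_two (eraseCtx v Γ) .nat (M.erase v)).lift .nat)
          (.ctx_cons (.nat hctx))).sub (.single hctx (.succ hctx.var_one)) hctx
      simp only [Judgment.ren, Judgment.sub, ← inst_eq] at e₁
      have es := hc (Γ := M :: nat :: Γ) ⟨hΓN, k, hM⟩ hs hs₁ .refl (.eq e₁.eq_symm) h₄
      rw [erase_retype] at es
      exact hS.mem_eq (.natInd_congr hΔ hM₁ (hn.sound hΔ) eM
        (hc hΓ hz hz' .refl (.eq e₀.eq_symm) h₃) es (hc hΓ hn hn' .refl .refl h₁))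
    · cases h
  | ipos n =>
    simp only [convHead] at h
    split at h
    · obtain ⟨hn, rfl⟩ := ht
      obtain ⟨hn', rfl⟩ := hu
      exact hS.mem_eq (.ipos_congr (hc hΓ hn hn' .refl .refl h))
    · cases h
  | ineg n =>
    simp only [convHead] at h
    split at h
    · obtain ⟨hn, rfl⟩ := ht
      obtain ⟨hn', rfl⟩ := hu
      exact hS.mem_eq (.ineg_congr (hc hΓ hn hn' .refl .refl h))
    · cases h
  | intInd M z p m x =>
    simp only [convHead] at h
    split at h
    · rename_i M' z' p' m' x'
      obtain ⟨k, hM, hz, hp, hm, hx, rfl⟩ := ht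
      obtain ⟨k', hM', hz', hp', hm', hx', rfl⟩ := hu
      simp only [Bool.and_eq_true] at h
      obtain ⟨⟨⟨⟨h₁, h₂⟩, h₃⟩, h₄⟩, h₅⟩ := h
      have hZ := Derivable.int hΔ
      have hΔZ := Derivable.ctx_cons hZ
      have hΓN : CxOK v (nat :: Γ) := ⟨hΓ, 0, rfl⟩
      have hΔN : Derivable (.nat :: eraseCtx v Γ) .ctx := hΓN.ctx
      have eM := hc.ty (Γ := int :: Γ) ⟨hΓ, 0, rfl⟩ hM hM' h₂
      have hM₁ := (hM.sound hΔZ).cumul_le (le_max_left k k')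
      have hM'₁ := (hM'.sound hΔZ).cumul_le (le_max_right k k')
      have e₀ := Derivable.inst_congr₂ hZ hM₁ hM'₁ eM (.izero hΔ) (.izero hΔ)
        (.eq_refl (.izero hΔ))
      have e₁ {t : Tm} (ht : Derivable (.nat :: eraseCtx v Γ) (.mem t .int)) :
          Derivable (.nat :: eraseCtx v Γ) (.eq ((M.erase v).instUp 1 t)
            ((M'.erase v).instUp 1 t) (.univ (max k k'))) := by
        have := (eM.ren ((RenOK.wk (eraseCtx v Γ) .nat).lift .int)
          (.ctx_cons (.int hΔN))).sub (.single hΔN ht) hΔN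
        simp only [Judgment.ren, Judgment.sub, ← inst_eq] at this
        exact this
      exact hS.mem_eq (.intInd_congr hΔ hM₁ (hx.sound hΔ) eM
        (hc hΓ hz hz' .refl (.eq e₀.eq_symm) h₃)
        (hc hΓN hp hp' .refl (.eq (e₁ (.ipos hΔN.var_zero)).eq_symm) h₄)
        (hc hΓN hm hm' .refl (.eq (e₁ (.ineg hΔN.var_zero)).eq_symm) h₅)
        (hc hΓ hx hx' .refl .refl h₁))
    · cases h
  | trunc A =>
    simp only [convHead] at h
    split at h
    · obtain ⟨k, hA, rfl⟩ := ht
      obtain ⟨k', hA', rfl⟩ := hu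
      exact eq_univ_max (.trunc_congr (hc.ty hΓ hA hA' h)) hS hT
    · cases h
  | tr a =>
    simp only [convHead] at h
    split at h
    · obtain ⟨A, ha, rfl⟩ := ht
      obtain ⟨A', ha', rfl⟩ := hu
      exact hS.mem_eq (.tr_congr (convTerm_sound hc hΓ ha ha' h))
    · cases h
  | _ => cases h

theorem convStep_sound (hw : WhSound v w) (hc : CvSound v cv) : CvSound v (convStep w cv) := by
  intro Γ t u S T C hΓ ht hu hS hT h
  unfold convStep at h
  rw [Bool.or_eq_true] at h
  rcases h with h | h
  · rw [← eqv_sound (v := v) h]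
    exact .eq_refl (hS.mem (ht.sound hΓ.ctx))
  · obtain ⟨ht₁, et⟩ := hw hΓ ht
    obtain ⟨hu₁, eu⟩ := hw hΓ hu
    obtain ⟨S', ht', hS'⟩ := ht₁.strip
    obtain ⟨T', hu', hT'⟩ := hu₁.strip
    rw [← erase_strip (w Γ t)] at et
    rw [← erase_strip (w Γ u)] at eu
    refine (hS.mem_eq et).eq_trans (.eq_trans ?_ (hT.mem_eq eu).eq_symm)
    replace hS' := hS'.trans hS
    replace hT' := hT'.trans hT
    simp only [Bool.or_eq_true] at h
    rcases h with h | h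
    · rw [← eqv_sound (v := v) h]
      exact .eq_refl (hS'.mem (ht'.sound hΓ.ctx))
    · split at h
      · rename_i A b _ e
        rw [e] at ht' ⊢
        cases hl : isLam (w Γ u).strip with
        | true =>
          rw [hl] at h
          exact convHead_sound hc hΓ ht' hu' hS' hT' h
        | false =>
          rw [hl] at h
          exact (hT'.mem_eq (convEta_sound hc hΓ hu' ht' h)).eq_symm
      · rename_i A b e _
        rw [e] at hu' ⊢
        exact hS'.mem_eq (convEta_sound hc hΓ ht' hu' h)
      · exact convHead_sound hc hΓ ht' hu' hS' hT' h

theorem reduceConv_sound (n : ℕ) : WhSound v (reduceConv n).1 ∧ CvSound v (reduceConv n).2 := by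
  induction n with
  | zero =>
    refine ⟨fun hΓ h => ⟨h, .eq_refl (h.sound hΓ.ctx)⟩, fun {Γ t u S T C} hΓ ht _ hS _ h => ?_⟩
    rw [← eqv_sound (v := v) (t := t) (u := u) h]
    exact .eq_refl (hS.mem (ht.sound hΓ.ctx))
  | succ n ih => exact ⟨whnfStep_sound ih.1 ih.2, convStep_sound ih.1 ih.2⟩

theorem conv_sound : CvSound v conv := (reduceConv_sound depth).2

theorem tyLe_sound (hΓ : CxOK v Γ) {S T : ATm} {k l : ℕ} (hS : W v (eraseCtx v Γ) S (.univ k))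
    (hT : W v (eraseCtx v Γ) T (.univ l)) (h : tyLe Γ S T = true) :
    TyLe (eraseCtx v Γ) (S.erase v) (T.erase v) := by
  unfold tyLe at h
  rw [Bool.or_eq_true] at h
  rcases h with h | h
  · exact .eq (conv_sound.ty hΓ hS hT h)
  · split at h
    · rename_i m n eS eT
      rw [← erase_strip S, ← erase_strip T, eS, eT]
      exact .univ (Lv.le_sound v h)
    · cases h

/-! ### Soundness of type inference -/

theorem guardB_eq_some {α : Type} {b : Bool} {x y : α} :
    guardB b x = some y ↔ b = true ∧ x = y := by
  cases b <;> simp [guardB]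

theorem typeOf_of_infer {t : ATm} {T : ATm} (h : infer Γ t = some T) :
    typeOf Γ t = some T := by
  induction t generalizing Γ T with
  | var | univ | nat | zero | int | izero => exact h
  | _ =>
    simp only [infer, typeOf, Option.bind_eq_some_iff, guardB_eq_some] at h ⊢
    grind

/-- A term for which type inference succeeds is well typed. -/
theorem infer_sound (hΓ : CxOK v Γ) {t T : ATm} (h : infer Γ t = some T) :
    W v (eraseCtx v Γ) t (T.erase v) := by
  induction t generalizing Γ T with
  | var n =>
    simp only [infer, Option.map_eq_some_iff] at h
    obtain ⟨A, hA, rfl⟩ := h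
    exact ⟨A.erase v, by simp [eraseCtx, hA], by rw [erase_shift, shiftRen_zero]⟩
  | univ l => cases h; simp only [erase, W, Lv.eval_succ]
  | pi A B ihA ihB =>
    simp only [infer, Option.bind_eq_some_iff, Option.some.injEq] at h
    obtain ⟨S, hS, k, hk, U, hU, l, hl, rfl⟩ := h
    have hA := ihA hΓ hS
    rw [asUniv_sound hk] at hA
    have hB := ihB (Γ := A :: Γ) ⟨hΓ, _, hA⟩ hU
    rw [asUniv_sound hl] at hB
    exact ⟨_, _, hA, hB, by rw [erase, Lv.eval_sup]⟩
  | lam A b ihA ihb =>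
    simp only [infer, Option.bind_eq_some_iff, Option.some.injEq] at h
    obtain ⟨S, hS, k, hk, B, hB, rfl⟩ := h
    have hA := ihA hΓ hS
    rw [asUniv_sound hk] at hA
    exact ⟨_, _, hA, ihb (Γ := A :: Γ) ⟨hΓ, _, hA⟩ hB, rfl⟩
  | app f a ihf iha =>
    simp only [infer, Option.bind_eq_some_iff, guardB_eq_some] at h
    obtain ⟨F, hF, ⟨A, B⟩, hAB, A', hA', e, rfl⟩ := h
    have hf := ihf hΓ hF
    rw [← erase_strip, strip_of_asPi hAB] at hf
    have ha := iha hΓ hA'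
    rw [eqv_sound e] at ha
    exact ⟨_, _, hf, ha, erase_inst _ _⟩
  | sigma A B ihA ihB =>
    simp only [infer, Option.bind_eq_some_iff, Option.some.injEq] at h
    obtain ⟨S, hS, k, hk, U, hU, l, hl, rfl⟩ := h
    have hA := ihA hΓ hS
    rw [asUniv_sound hk] at hA
    have hB := ihB (Γ := A :: Γ) ⟨hΓ, _, hA⟩ hU
    rw [asUniv_sound hl] at hB
    exact ⟨_, _, hA, hB, by rw [erase, Lv.eval_sup]⟩
  | pair A B a b ihA ihB iha ihb =>
    simp only [infer, Option.bind_eq_some_iff, guardB_eq_some, Bool.and_eq_true] at h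
    obtain ⟨S, hS, k, hk, U, hU, l, hl, A', hA', B', hB', ⟨e₁, e₂⟩, rfl⟩ := h
    have hA := ihA hΓ hS
    rw [asUniv_sound hk] at hA
    have hB := ihB (Γ := A :: Γ) ⟨hΓ, _, hA⟩ hU
    rw [asUniv_sound hl] at hB
    have ha := iha hΓ hA'
    rw [eqv_sound e₁] at ha
    have hb := ihb hΓ hB'
    rw [eqv_sound e₂, erase_inst] at hb
    exact ⟨_, _, hA, hB, ha, hb, rfl⟩
  | fst A B p ihA ihB ihp =>
    simp only [infer, Option.bind_eq_some_iff, guardB_eq_some] at h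
    obtain ⟨S, hS, k, hk, U, hU, l, hl, P, hP, e, rfl⟩ := h
    have hA := ihA hΓ hS
    rw [asUniv_sound hk] at hA
    have hB := ihB (Γ := A :: Γ) ⟨hΓ, _, hA⟩ hU
    rw [asUniv_sound hl] at hB
    have hp := ihp hΓ hP
    rw [eqv_sound e] at hp
    exact ⟨_, _, hA, hB, hp, rfl⟩
  | snd A B p ihA ihB ihp =>
    simp only [infer, Option.bind_eq_some_iff, guardB_eq_some] at h
    obtain ⟨S, hS, k, hk, U, hU, l, hl, P, hP, e, rfl⟩ := h
    have hA := ihA hΓ hS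
    rw [asUniv_sound hk] at hA
    have hB := ihB (Γ := A :: Γ) ⟨hΓ, _, hA⟩ hU
    rw [asUniv_sound hl] at hB
    have hp := ihp hΓ hP
    rw [eqv_sound e] at hp
    exact ⟨_, _, hA, hB, hp, erase_inst B (fst A B p)⟩
  | split A B M c p ihA ihB ihM ihc ihp =>
    simp only [infer, Option.bind_eq_some_iff, guardB_eq_some, Bool.and_eq_true] at h
    obtain ⟨S, hS, k, hk, U, hU, l, hl, V, hV, m, hm, C, hC, P, hP, ⟨e₁, e₂⟩, rfl⟩ := h
    have hA := ihA hΓ hS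
    rw [asUniv_sound hk] at hA
    have hB := ihB (Γ := A :: Γ) ⟨hΓ, _, hA⟩ hU
    rw [asUniv_sound hl] at hB
    have hM := ihM (Γ := sigma A B :: Γ) ⟨hΓ, _, _, _, hA, hB, rfl⟩ hV
    rw [asUniv_sound hm] at hM
    have hc := ihc (Γ := B :: A :: Γ) ⟨⟨hΓ, _, hA⟩, _, hB⟩ hC
    rw [eqv_sound e₂, erase_inst, erase_shift, shiftRen_succ, shiftRen_zero] at hc
    have hp := ihp hΓ hP
    rw [eqv_sound e₁] at hp
    exact ⟨_, _, _, hA, hB, hM, hc, hp, erase_inst _ _⟩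
  | idt A a b ihA iha ihb =>
    simp only [infer, Option.bind_eq_some_iff, guardB_eq_some, Bool.and_eq_true] at h
    obtain ⟨S, hS, k, hk, A₁, hA₁, A₂, hA₂, ⟨e₁, e₂⟩, rfl⟩ := h
    have hA := ihA hΓ hS
    have ha := iha hΓ hA₁
    have hb := ihb hΓ hA₂
    rw [asUniv_sound hk] at hA
    rw [eqv_sound e₁] at ha
    rw [eqv_sound e₂] at hb
    exact ⟨_, hA, ha, hb, asUniv_sound hk⟩
  | idp a iha =>
    simp only [infer, Option.bind_eq_some_iff, Option.some.injEq] at h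
    obtain ⟨A, hA, rfl⟩ := h
    exact ⟨_, iha hΓ hA, rfl⟩
  | pathInd A a b M c p ihA iha ihb ihM ihc ihp =>
    simp only [infer, Option.bind_eq_some_iff, guardB_eq_some, Bool.and_eq_true] at h
    obtain ⟨S, hS, k, hk, A₁, hA₁, A₂, hA₂, P, hP, U, hU, l, hl, C, hC,
      ⟨⟨⟨e₁, e₂⟩, e₃⟩, e₄⟩, rfl⟩ := h
    have hA := ihA hΓ hS
    have ha := iha hΓ hA₁
    have hb := ihb hΓ hA₂
    rw [asUniv_sound hk] at hA
    rw [eqv_sound e₁] at ha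
    rw [eqv_sound e₂] at hb
    have hΔA := Derivable.ctx_cons (hA.sound hΓ.ctx)
    have hI : W v (A.erase v :: eraseCtx v Γ) (idt A.wk a.wk (var 0)) (.univ (k.eval v)) := by
      refine ⟨_, hA.wk hΔA, ?_, ?_, rfl⟩ <;> rw [erase_wk]
      · exact ha.wk hΔA
      · exact .zero
    have hM := ihM (Γ := idt A.wk a.wk (var 0) :: A :: Γ) ⟨⟨hΓ, _, hA⟩, _, hI⟩ hU
    rw [asUniv_sound hl] at hM
    simp only [eraseCtx, List.map_cons, erase, erase_wk] at hM
    have hc := ihc hΓ hC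
    rw [eqv_sound e₄, erase_inst₂] at hc
    have hp := ihp hΓ hP
    rw [eqv_sound e₃] at hp
    exact ⟨_, _, hA, ha, hb, hM, hc, hp, erase_inst₂ _ _ _⟩
  | nat => cases h; rfl
  | zero => cases h; rfl
  | succ n ihn =>
    simp only [infer, Option.bind_eq_some_iff, guardB_eq_some] at h
    obtain ⟨N, hN, e, rfl⟩ := h
    have hn := ihn hΓ hN
    rw [eqv_sound e] at hn
    exact ⟨hn, rfl⟩
  | natInd M z s n ihM ihz ihs ihn =>
    simp only [infer, Option.bind_eq_some_iff, guardB_eq_some, Bool.and_eq_true] at h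
    obtain ⟨N, hN, U, hU, k, hk, Z, hZ, S, hS, ⟨⟨e₁, e₂⟩, e₃⟩, rfl⟩ := h
    have hn := ihn hΓ hN
    have hΓN : CxOK v (nat :: Γ) := ⟨hΓ, 0, rfl⟩
    have hM := ihM hΓN hU
    rw [asUniv_sound hk] at hM
    have hz := ihz hΓ hZ
    have hs := ihs (Γ := M :: nat :: Γ) ⟨hΓN, _, hM⟩ hS
    rw [eqv_sound e₁] at hn
    rw [eqv_sound e₂, erase_inst] at hz
    rw [eqv_sound e₃, erase_inst, erase_shift, shiftRen_succ, shiftRen_zero] at hs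
    exact ⟨_, hM, hz, hs, hn, erase_inst _ _⟩
  | int => cases h; rfl
  | izero => cases h; rfl
  | ipos n ihn =>
    simp only [infer, Option.bind_eq_some_iff, guardB_eq_some] at h
    obtain ⟨N, hN, e, rfl⟩ := h
    have hn := ihn hΓ hN
    rw [eqv_sound e] at hn
    exact ⟨hn, rfl⟩
  | ineg n ihn =>
    simp only [infer, Option.bind_eq_some_iff, guardB_eq_some] at h
    obtain ⟨N, hN, e, rfl⟩ := h
    have hn := ihn hΓ hN
    rw [eqv_sound e] at hn
    exact ⟨hn, rfl⟩
  | intInd M z p m x ihM ihz ihp ihm ihx =>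
    simp only [infer, Option.bind_eq_some_iff, guardB_eq_some, Bool.and_eq_true] at h
    obtain ⟨K, hK, U, hU, k, hk, Z, hZ, P, hP, N, hN, ⟨⟨⟨e₁, e₂⟩, e₃⟩, e₄⟩, rfl⟩ := h
    have hx := ihx hΓ hK
    have hM := ihM (Γ := int :: Γ) ⟨hΓ, 0, rfl⟩ hU
    rw [asUniv_sound hk] at hM
    have hz := ihz hΓ hZ
    have hp := ihp (Γ := nat :: Γ) ⟨hΓ, 0, rfl⟩ hP
    have hm := ihm (Γ := nat :: Γ) ⟨hΓ, 0, rfl⟩ hN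
    rw [eqv_sound e₁] at hx
    rw [eqv_sound e₂, erase_inst] at hz
    rw [eqv_sound e₃, erase_inst, erase_shift, shiftRen_succ, shiftRen_zero] at hp
    rw [eqv_sound e₄, erase_inst, erase_shift, shiftRen_succ, shiftRen_zero] at hm
    exact ⟨_, hM, hz, hp, hm, hx, erase_inst _ _⟩
  | trunc A ihA =>
    simp only [infer, Option.bind_eq_some_iff, Option.some.injEq] at h
    obtain ⟨S, hS, k, hk, rfl⟩ := h
    have hA := ihA hΓ hS
    rw [asUniv_sound hk] at hA
    exact ⟨_, hA, asUniv_sound hk⟩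
  | tr a iha =>
    simp only [infer, Option.bind_eq_some_iff, Option.some.injEq] at h
    obtain ⟨A, hA, rfl⟩ := h
    exact ⟨_, iha hΓ hA, rfl⟩
  | ann t X iht ihX =>
    simp only [infer, Option.bind_eq_some_iff, guardB_eq_some] at h
    obtain ⟨S, hS, U, hU, k, hk, e, rfl⟩ := h
    have ht := iht hΓ hS
    have hX := ihX hΓ hU
    rw [asUniv_sound hk] at hX
    obtain ⟨-, l, hS'⟩ := typeOf_sound hΓ ht (typeOf_of_infer hS)
    exact ⟨_, _, ht, hX, tyLe_sound hΓ hS' hX e, rfl⟩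

end ATm

end HoTT

namespace HoTT

/-! ### Elaboration

Surface terms, in which most annotations are left out, are turned into annotated terms.  Nothing is
proved about the elaborator: its results are checked. -/

/-- Surface terms: terms with variables as de Bruijn levels, in which types of bound variables,
motives of inductions and leading arguments of variables may be left out. -/
inductive Sf : Type
  /-- the variable of level `n`, applied to `k` implicit arguments -/
  | lv (n k : ℕ)
  | univ (l : Lv)
  | pi (A B : Sf)
  | lam (b : Sf)
  | lamT (A b : Sf)
  | app (f a : Sf)
  | sigma (A B : Sf)
  | pair (a b : Sf)
  | pr1 (p : Sf)
  | pr2 (p : Sf)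
  /-- `∑`-induction with the goal as the motive; `c` is under two binders -/
  | split (p c : Sf)
  /-- the type `a = b` of paths in the type of `a` -/
  | eq (a b : Sf)
  | idt (A a b : Sf)
  | refl
  | idp (a : Sf)
  /-- path induction on a variable, with the goal as the motive -/
  | ind (p c : Sf)
  /-- path induction with the motive `M`, which is under two binders -/
  | J (M c p : Sf)
  | inv (p : Sf)
  | concat (p q : Sf)
  /-- the action of `x ↦ f` on a path, where `f` is under one binder -/
  | ap (f p : Sf)
  /-- transport in the family `x ↦ B`, where `B` is under one binder -/
  | tp (B p b : Sf)
  | zero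
  | succ (n : Sf)
  /-- induction with the goal as the motive; `s` is under two binders -/
  | natInd (n z s : Sf)
  | int
  | izero
  | ipos (n : Sf)
  | ineg (n : Sf)
  /-- induction with the goal as the motive; `p` and `m` are under one binder -/
  | intInd (k z p m : Sf)
  | trunc (A : Sf)
  | tr (a : Sf)
  | ann (t T : Sf)
  /-- `b` is under a binder, to which `a` is assigned -/
  | lett (a b : Sf)

namespace ATm

/-- Replacement of the variable `k` by the variable `l`; the term is under `c` binders more. -/
def replVar (k l c : ℕ) (t : ATm) : ATm :=
  t.trav (fun c n => var (bif Nat.beq n (k + c) then l + c else n)) (fun _ l => univ l) c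

/-- Metavariables are encoded as universes of large constant level. -/
def mvar (m : ℕ) : ATm := univ (.n (1000000 + m))

/-- The number of a metavariable. -/
def isMvar : ATm → Option ℕ
  | univ (.n k) => bif Nat.ble 1000000 k then some (k - 1000000) else none
  | _ => none

/-- The value of the metavariable `m`. -/
def lookupM (σ : List (ℕ × ATm)) (m : ℕ) : Option ATm := match σ with
  | [] => none
  | (k, t) :: σ => bif Nat.beq k m then some t else lookupM σ m

/-- Replacement of solved metavariables. -/
def zonk (σ : List (ℕ × ATm)) (c : ℕ) (t : ATm) : ATm :=
  t.trav (fun _ n => var n) (fun c l => match isMvar (univ l) with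
    | some m => match lookupM σ m with
      | some t => t.shift c 0
      | none => univ l
    | none => univ l) c

/-- Whether all variables and metavariables of a term satisfy `p` (which depends on the number of
binders) and `q`. -/
def allVar (p : ℕ → ℕ → Bool) (q : ℕ → Bool) : ℕ → ATm → Bool
  | c, var n => p c n
  | _, univ l => match isMvar (univ l) with
    | some m => q m
    | none => true
  | c, pi A B => A.allVar p q c && B.allVar p q (c + 1)
  | c, lam A b => A.allVar p q c && b.allVar p q (c + 1)
  | c, app f a => f.allVar p q c && a.allVar p q c
  | c, sigma A B => A.allVar p q c && B.allVar p q (c + 1)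
  | c, pair A B a b => A.allVar p q c && B.allVar p q (c + 1) && a.allVar p q c && b.allVar p q c
  | c, fst A B x => A.allVar p q c && B.allVar p q (c + 1) && x.allVar p q c
  | c, snd A B x => A.allVar p q c && B.allVar p q (c + 1) && x.allVar p q c
  | c, split A B M g x => A.allVar p q c && B.allVar p q (c + 1) && M.allVar p q (c + 1) &&
      g.allVar p q (c + 2) && x.allVar p q c
  | c, idt A a b => A.allVar p q c && a.allVar p q c && b.allVar p q c
  | c, idp a => a.allVar p q c
  | c, pathInd A a b M e x => A.allVar p q c && a.allVar p q c && b.allVar p q c &&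
      M.allVar p q (c + 2) && e.allVar p q c && x.allVar p q c
  | _, nat => true
  | _, zero => true
  | c, succ n => n.allVar p q c
  | c, natInd M z s n => M.allVar p q (c + 1) && z.allVar p q c && s.allVar p q (c + 2) &&
      n.allVar p q c
  | _, int => true
  | _, izero => true
  | c, ipos n => n.allVar p q c
  | c, ineg n => n.allVar p q c
  | c, intInd M z x m k => M.allVar p q (c + 1) && z.allVar p q c && x.allVar p q (c + 1) &&
      m.allVar p q (c + 1) && k.allVar p q c
  | c, trunc A => A.allVar p q c
  | c, tr a => a.allVar p q c
  | c, ann t T => t.allVar p q c && T.allVar p q c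

/-- The term has no metavariables. -/
def noMvar (t : ATm) : Bool := t.allVar (fun _ _ => true) (fun _ => false) 0

/-- The term `t` without its `c` most recent variables, if it does not use them. -/
def lower (c : ℕ) (t : ATm) : Option ATm :=
  bif Nat.beq c 0 then some t
  else guardB (t.allVar (fun d n => Nat.blt n d || Nat.ble (d + c) n) (fun _ => true) 0)
    (Nat.rec t (fun _ u => u.inst (univ (.n 0))) c)

/-- The weak head normal form of a term, without annotations. -/
def wh (Γ : ACtx) (t : ATm) : ATm := (whnf Γ t).strip

/-- The weak head normal form of a term that is not already an application. -/
def whApp (Γ : ACtx) (t : ATm) : ATm := match t.strip with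
  | app f a => app f a
  | _ => wh Γ t

/-- Values of some of the metavariables. -/
abbrev Sol : Type := List (ℕ × ATm)

/-- The value `t`, found under `c` binders, for the metavariable `m`, if it has none yet. -/
def solve (m c : ℕ) (t : ATm) (σ : Sol) : Sol := match lookupM σ m with
  | some _ => σ
  | none => match lower c t with
    | some t => (m, t) :: σ
    | none => σ

/-- First order matching of a pattern with metavariables against a term.  A metavariable applied to
the most recent bound variable is solved by abstraction. -/
def mtch : ACtx → ℕ → ATm → ATm → Sol → Sol
  | Γ, c, ann p _, t, σ => mtch Γ c p t σ
  | _, c, univ l, t, σ => match isMvar (univ l) with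
    | some m => solve m c t σ
    | none => σ
  | Γ, c, pi A B, t, σ =>
    match wh Γ t with
    | pi A' B' => mtch (A' :: Γ) (c + 1) B B' (mtch Γ c A A' σ)
    | _ => σ
  | Γ, c, sigma A B, t, σ =>
    match wh Γ t with
    | sigma A' B' => mtch (A' :: Γ) (c + 1) B B' (mtch Γ c A A' σ)
    | _ => σ
  | Γ, c, idt A a b, t, σ =>
    match wh Γ t with
    | idt A' a' b' => mtch Γ c b b' (mtch Γ c a a' (mtch Γ c A A' σ))
    | _ => σ
  | Γ, c, trunc A, t, σ =>
    match wh Γ t with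
    | trunc A' => mtch Γ c A A' σ
    | _ => σ
  | Γ, c, app f a, t, σ =>
    match isMvar f.strip, a.strip, Γ with
    | some m, var 0, A :: _ => match lookupM σ m with
      | some _ => σ
      | none => match lower (c - 1) (lam A t) with
        | some u => match lower (c - 1) A with
          | some _ => (m, match u with
            | lam A' b => match b.strip with
              | app g x => match x.strip, lower 1 g with
                | var 0, some g' => g'
                | _, _ => lam A' b
              | _ => lam A' b
            | u => u) :: σ
          | none => σ
        | none => σ
    | _, _, _ =>
      match whApp Γ t with
      | app f' a' => mtch Γ c a a' (mtch Γ c f f' σ)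
      | _ => σ
  | Γ, c, lam A b, t, σ => match t.strip with
    | lam A' b' => mtch (A' :: Γ) (c + 1) b b' (mtch Γ c A A' σ)
    | _ => σ
  | Γ, c, pair _ _ a b, t, σ => match t.strip with
    | pair _ _ a' b' => mtch Γ c b b' (mtch Γ c a a' σ)
    | _ => σ
  | Γ, c, fst _ _ p, t, σ => match t.strip with
    | fst _ _ p' => mtch Γ c p p' σ
    | _ => σ
  | Γ, c, snd _ _ p, t, σ => match t.strip with
    | snd _ _ p' => mtch Γ c p p' σ
    | _ => σ
  | Γ, c, pathInd A a b _ g p, t, σ => match t.strip with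
    | pathInd A' a' b' _ g' p' =>
      mtch Γ c p p' (mtch Γ c g g' (mtch Γ c b b' (mtch Γ c a a' (mtch Γ c A A' σ))))
    | _ => σ
  | Γ, c, idp a, t, σ => match t.strip with
    | idp a' => mtch Γ c a a' σ
    | _ => σ
  | Γ, c, tr a, t, σ => match t.strip with
    | tr a' => mtch Γ c a a' σ
    | _ => σ
  | _, _, _, _, σ => σ

/-- The term `t` of type `S`, as a term of type `T`.  The annotation goes under a `λ` if possible,
so that a `β`-redex is not hidden by it. -/
def coe (t S T : ATm) : ATm := bif eqv S T then t else match t with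
  | lam A b => match S.strip, T.strip with
    | pi _ B, pi A' B' => bif eqv A A' then lam A (coe b B B') else ann t T
    | _, _ => ann t T
  | t => ann t T

/-- The term `t`, as a term of type `T`. -/
def coeTy (Γ : ACtx) (t T : ATm) : ATm := match typeOf Γ t with
  | some S => coe t S T
  | none => t

end ATm

open ATm

/-- The head of an iterated application and its arguments, followed by `l`. -/
def unspine : Sf → List Sf → Sf × List Sf
  | .app f a, l => unspine f (a :: l)
  | s, l => (s, l)

/-- Whether the type of a surface term can be found without an expected type. -/
def Sf.inferable : Sf → Bool
  | lam _ => false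
  | pair _ _ => false
  | refl => false
  | split _ _ => false
  | ind _ _ => false
  | natInd _ _ _ => false
  | intInd _ _ _ _ => false
  | lett _ b => b.inferable
  | inv p => p.inferable
  | concat p q => p.inferable && q.inferable
  | _ => true

section elaboration

variable (inf : ℕ → ACtx → Sf → Option (ATm × ATm)) (chk : ℕ → ACtx → Sf → ATm → Option ATm)

/-- A surface term as a type, with its level. -/
def elabTy (d : ℕ) (Γ : ACtx) (A : Sf) : Option (ATm × Lv) :=
  (inf d Γ A).bind fun x => match x.2.asUniv with
    | some l => some (x.1, l)
    | none => match wh Γ x.2 with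
      | univ l => some (ann x.1 (univ l), l)
      | _ => none

/-- The arguments of a head: for each one its metavariable, its type, and the surface term if it is
explicit.  The result is reversed, with the type of the application, and the arguments that are
left. -/
def telescope (Γ : ACtx) : ℕ → ℕ → List Sf → ATm → List (ℕ × ATm × Option Sf) →
    List (ℕ × ATm × Option Sf) × ATm × List Sf
  | 0, _, args, F, acc => (acc, F, args)
  | f + 1, k, args, F, acc => match k, args with
    | 0, [] => (acc, F, args)
    | 0, a :: rest => match F.strip with
      | pi A B => telescope Γ f 0 rest (B.inst (mvar acc.length)) ((acc.length, A, some a) :: acc)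
      | _ => (acc, F, args)
    | k + 1, args => match F.strip with
      | pi A B => telescope Γ f k args (B.inst (mvar acc.length)) ((acc.length, A, none) :: acc)
      | _ => (acc, F, args)

/-- Elaboration of the explicit arguments; those whose types are not yet known are deferred. -/
def elabArgs (d : ℕ) (Γ : ACtx) : List (ℕ × ATm × Option Sf) →
    List (ℕ × ATm × Option Sf) → Sol → Option (List (ℕ × ATm × Option Sf) × Sol)
  | [], acc, σ => some (acc, σ)
  | (m, A, none) :: l, acc, σ =>
    let A' := zonk σ 0 A
    elabArgs d Γ l ((m, A, none) :: acc) (match lookupM σ m with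
      | some t => bif noMvar A' then (m, coeTy Γ t A') :: σ else σ
      | none => σ)
  | (m, A, some s) :: l, acc, σ =>
    match lookupM σ m with
    | some t =>
      let A' := zonk σ 0 A
      elabArgs d Γ l ((m, A, some s) :: acc)
        (bif noMvar A' then (m, coeTy Γ t A') :: σ else σ)
    | none =>
    let A' := zonk σ 0 A
    bif noMvar A' then
      (chk d Γ s A').bind fun t => elabArgs d Γ l ((m, A, none) :: acc) ((m, t) :: σ)
    else bif s.inferable then
      (inf d Γ s).bind fun x =>
        let σ' := mtch Γ 0 A' x.2 σ
        elabArgs d Γ l ((m, A, none) :: acc) ((m, coe x.1 x.2 (zonk σ' 0 A')) :: σ')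
    else elabArgs d Γ l ((m, A, some s) :: acc) σ

/-- The application of `t` to the elaborated arguments. -/
def applyArgs (Γ : ACtx) (σ : Sol) : List (ℕ × ATm × Option Sf) → ATm → ATm → Option (ATm × ATm)
  | [], t, F => some (t, F)
  | (m, _, _) :: l, t, F => match F.strip with
    | pi A₀ B => match lookupM σ m with
      | some a =>
        let a' := coeTy Γ a A₀
        applyArgs Γ σ l (app t a') (B.inst a')
      | none => none
    | _ => none

/-- Application to explicit arguments, one by one. -/
def elabApps (d : ℕ) (Γ : ACtx) : List Sf → ATm → ATm → Option (ATm × ATm)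
  | [], t, F => some (t, F)
  | s :: l, t, F => match F.strip with
    | pi A B => (chk d Γ s A).bind fun a => elabApps d Γ l (app t a) (B.inst a)
    | _ => match wh Γ F with
      | pi A B => (chk d Γ s A).bind fun a =>
        elabApps d Γ l (app (ann t (pi A B)) a) (B.inst a)
      | _ => none

/-- Elaboration of an application, possibly with an expected type. -/
def elabSpine (d : ℕ) (Γ : ACtx) (s : Sf) (T : Option ATm) : Option (ATm × ATm) :=
  match unspine s [] with
  | (.lv n (k + 1), args) =>
    let h := var (d - 1 - n)
    match typeOf Γ h with
    | none => none
    | some F =>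
      match telescope Γ 1000 (k + 1) args F [] with
      | (tele, R, rest) =>
        let σ₀ := match T, rest with
          | some T, [] => mtch Γ 0 R T []
          | _, _ => []
        (elabArgs inf chk d Γ tele.reverse [] σ₀).bind fun x =>
        (elabArgs inf chk d Γ x.1.reverse [] x.2).bind fun x =>
        (elabArgs inf chk d Γ x.1.reverse [] x.2).bind fun x =>
        (applyArgs Γ x.2 x.1.reverse h F).bind fun y => elabApps chk d Γ rest y.1 y.2
  | (h, args) => (inf d Γ h).bind fun x => elabApps chk d Γ args x.1 x.2

/-- The type of a path, as an identity type. -/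
def elabPath (d : ℕ) (Γ : ACtx) (p : Sf) : Option (ATm × ATm × ATm × ATm) :=
  (inf d Γ p).bind fun x => match x.2.asIdt with
    | some y => some (x.1, y)
    | none => match wh Γ x.2 with
      | idt A a b => some (ann x.1 (idt A a b), A, a, b)
      | _ => none

/-- Path induction at `p : a =_A b`, with the motive `M` (under two binders). -/
def mkJ (Γ : ACtx) (A a b M p c : ATm) : ATm :=
  pathInd A a b M (coeTy Γ c (M.inst₂ a (coeTy Γ (idp a) (idt A a a)))) p

/-- The inverse of `p : a =_A b`, and its type. -/
def mkInv (Γ : ACtx) (p A a b : ATm) : ATm × ATm :=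
  (mkJ Γ A a b (idt (A.shift 2 0) (var 1) (a.shift 2 0)) p (idp a), idt A b a)

/-- The concatenation of `p : a =_A b` and `q : b =_A c`, and its type. -/
def mkConcat (Γ : ACtx) (p A a b q c : ATm) : ATm × ATm :=
  (mkJ Γ A b c (idt (A.shift 2 0) (a.shift 2 0) (var 1)) q p, idt A a c)

/-- Elaboration of a term whose type is to be found. -/
def infStep (d : ℕ) (Γ : ACtx) (s : Sf) : Option (ATm × ATm) := match s with
  | .lv n 0 => let t := var (d - 1 - n)
    (typeOf Γ t).bind fun T => some (t, T)
  | .lv n (k + 1) => elabSpine inf chk d Γ (.lv n (k + 1)) none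
  | .univ l => some (univ l, univ l.succ)
  | .pi A B => (elabTy inf d Γ A).bind fun x => (elabTy inf (d + 1) (x.1 :: Γ) B).bind fun y =>
      some (pi x.1 y.1, univ (x.2.sup y.2))
  | .sigma A B => (elabTy inf d Γ A).bind fun x =>
      (elabTy inf (d + 1) (x.1 :: Γ) B).bind fun y =>
      some (sigma x.1 y.1, univ (x.2.sup y.2))
  | .lamT A b => (elabTy inf d Γ A).bind fun x => (inf (d + 1) (x.1 :: Γ) b).bind fun y =>
      some (lam x.1 y.1, pi x.1 y.2)
  | .app f a => elabSpine inf chk d Γ (.app f a) none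
  | .pr1 p => (inf d Γ p).bind fun x => match wh Γ x.2 with
    | sigma A B => some (fst A B (coe x.1 x.2 (sigma A B)), A)
    | _ => none
  | .pr2 p => (inf d Γ p).bind fun x => match wh Γ x.2 with
    | sigma A B =>
      let p := coe x.1 x.2 (sigma A B)
      some (snd A B p, B.inst (fst A B p))
    | _ => none
  | .eq a b => bif a.inferable then
        (inf d Γ a).bind fun x => (elabTyOf x.2).bind fun l =>
        (chk d Γ b x.2).bind fun y => some (idt x.2 x.1 y, univ l)
      else (inf d Γ b).bind fun x => (elabTyOf x.2).bind fun l =>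
        (chk d Γ a x.2).bind fun y => some (idt x.2 y x.1, univ l)
  | .idt A a b => (elabTy inf d Γ A).bind fun x => (chk d Γ a x.1).bind fun y =>
      (chk d Γ b x.1).bind fun z => some (idt x.1 y z, univ x.2)
  | .idp a => (inf d Γ a).bind fun x => some (idp x.1, idt x.2 x.1 x.1)
  | .J M c p => (elabPath inf d Γ p).bind fun x =>
      let A := x.2.1
      let a := x.2.2.1
      (elabTy inf (d + 2) (idt A.wk a.wk (var 0) :: A :: Γ) M).bind fun M =>
      (chk d Γ c (inst₂ M.1 a (coeTy Γ (idp a) (idt A a a)))).bind fun c =>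
      some (mkJ Γ A a x.2.2.2 M.1 x.1 c, M.1.inst₂ x.2.2.2 x.1)
  | .inv p => (elabPath inf d Γ p).bind fun x => some (mkInv Γ x.1 x.2.1 x.2.2.1 x.2.2.2)
  | .concat p q => (elabPath inf d Γ p).bind fun x =>
      bif q.inferable then
        (elabPath inf d Γ q).bind fun y =>
        let c := coeTy Γ y.2.2.2 x.2.1
        let T := idt x.2.1 x.2.2.2 c
        let q := coe y.1 (idt y.2.1 y.2.2.1 y.2.2.2) T
        some (mkConcat Γ x.1 x.2.1 x.2.2.1 x.2.2.2 q c)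
      else none
  | .ap f p => (elabPath inf d Γ p).bind fun x =>
      let A := x.2.1
      (inf (d + 1) (A :: Γ) f).bind fun y => match lower 1 y.2 with
      | some B =>
        let fa := y.1.inst x.2.2.1
        let M := idt (B.shift 2 0) (fa.shift 2 0) (y.1.shift 1 0)
        some (mkJ Γ A x.2.2.1 x.2.2.2 M x.1 (idp fa), idt B fa (y.1.inst x.2.2.2))
      | none => none
  | .tp B p b => (elabPath inf d Γ p).bind fun x =>
      (elabTy inf (d + 1) (x.2.1 :: Γ) B).bind fun y =>
      (chk d Γ b (y.1.inst x.2.2.1)).bind fun b =>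
      some (mkJ Γ x.2.1 x.2.2.1 x.2.2.2 (y.1.shift 1 0) x.1 b, y.1.inst x.2.2.2)
  | .zero => some (zero, nat)
  | .succ n => (chk d Γ n nat).bind fun n => some (succ n, nat)
  | .int => some (int, univ (.n 0))
  | .izero => some (izero, int)
  | .ipos n => (chk d Γ n nat).bind fun n => some (ipos n, int)
  | .ineg n => (chk d Γ n nat).bind fun n => some (ineg n, int)
  | .trunc A => (elabTy inf d Γ A).bind fun x => some (trunc x.1, univ x.2)
  | .tr a => (inf d Γ a).bind fun x => some (tr x.1, trunc x.2)
  | .ann t T => (elabTy inf d Γ T).bind fun x => (chk d Γ t x.1).bind fun t => some (t, x.1)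
  | .lett a b => (inf d Γ a).bind fun x => (inf (d + 1) (x.2 :: Γ) b).bind fun y =>
      some (app (lam x.2 y.1) x.1, y.2.inst x.1)
  | _ => none
where
  /-- The level of a type. -/
  elabTyOf (T : ATm) : Option Lv := match typeOf Γ T with
    | some U => match U.asUniv with
      | some l => some l
      | none => none
    | none => none

/-- The goal `T` as a family over the variable `p`, if `p` is a variable. -/
def motive (p T : ATm) : ATm := match p.strip with
  | var k => (T.shift 1 0).replVar (k + 1) 0 0
  | _ => T.shift 1 0

/-- Elaboration of a term with an expected type. -/
def chkStep (d : ℕ) (Γ : ACtx) (s : Sf) (T : ATm) : Option ATm := match s with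
  | .lam b => match wh Γ T with
    | pi A B => (chk (d + 1) (A :: Γ) b B).bind fun b => some (coe (lam A b) (pi A B) T)
    | _ => none
  | .pair a b => match wh Γ T with
    | sigma A B => (chk d Γ a A).bind fun a => (chk d Γ b (B.inst a)).bind fun b =>
        some (coe (pair A B a b) (sigma A B) T)
    | _ => none
  | .refl => match wh Γ T with
    | idt A a _ => some (coe (coeTy Γ (idp a) (idt A a a)) (idt A a a) T)
    | _ => none
  | .ind p c => (elabPath inf d Γ p).bind fun x => match x.1.strip, x.2.2.2.strip with
    | var k, var l =>
      let M := ((T.shift 2 0).replVar (l + 2) 1 0).replVar (k + 2) 0 0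
      (chk d Γ c (inst₂ M x.2.2.1
        (coeTy Γ (idp x.2.2.1) (idt x.2.1 x.2.2.1 x.2.2.1)))).bind fun c =>
      some (coe (mkJ Γ x.2.1 x.2.2.1 x.2.2.2 M x.1 c) (inst₂ M x.2.2.2 x.1) T)
    | _, _ => none
  | .split p c => (inf d Γ p).bind fun x => match wh Γ x.2 with
    | sigma A B =>
      let p := coe x.1 x.2 (sigma A B)
      let M := motive p T
      (chk (d + 2) (B :: A :: Γ) c (inst (M.shift 2 1)
        (pair (A.shift 2 0) (B.shift 2 1) (var 1) (var 0)))).bind fun c =>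
      some (coe (split A B M c p) (M.inst p) T)
    | _ => none
  | .natInd n z s => (chk d Γ n nat).bind fun n =>
      let M := motive n T
      (chk d Γ z (M.inst zero)).bind fun z =>
      (chk (d + 2) (M :: nat :: Γ) s (inst (M.shift 2 1) (succ (var 1)))).bind fun s =>
      some (coe (natInd M z s n) (M.inst n) T)
  | .intInd k z p m => (chk d Γ k int).bind fun k =>
      let M := motive k T
      (chk d Γ z (M.inst izero)).bind fun z =>
      (chk (d + 1) (nat :: Γ) p (inst (M.shift 1 1) (ipos (var 0)))).bind fun p =>
      (chk (d + 1) (nat :: Γ) m (inst (M.shift 1 1) (ineg (var 0)))).bind fun m =>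
      some (coe (intInd M z p m k) (M.inst k) T)
  | .inv p => match wh Γ T with
    | idt A a b => (chk d Γ p (idt A b a)).bind fun p =>
        some (coe (mkInv Γ p A b a).1 (idt A a b) T)
    | _ => none
  | .concat p q => match wh Γ T with
    | idt A a c => bif p.inferable then
          (elabPath inf d Γ p).bind fun x =>
          let b := coeTy Γ x.2.2.2 A
          (chk d Γ q (idt A b c)).bind fun q =>
          let p := coe x.1 (idt x.2.1 x.2.2.1 x.2.2.2) (idt A a b)
          some (coe (mkConcat Γ p A a b q c).1 (idt A a c) T)
        else
          (elabPath inf d Γ q).bind fun y =>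
          let b := coeTy Γ y.2.2.1 A
          (chk d Γ p (idt A a b)).bind fun p =>
          let q := coe y.1 (idt y.2.1 y.2.2.1 y.2.2.2) (idt A b c)
          some (coe (mkConcat Γ p A a b q c).1 (idt A a c) T)
    | _ => none
  | .lett a b => (inf d Γ a).bind fun x => (chk (d + 1) (x.2 :: Γ) b T.wk).bind fun b =>
      some (coe (app (lam x.2 b) x.1) (T.wk.inst x.1) T)
  | .tr a => match wh Γ T with
    | trunc A => (chk d Γ a A).bind fun a => some (coe (tr a) (trunc A) T)
    | _ => none
  | .app f a => (elabSpine inf chk d Γ (.app f a) (some T)).bind fun x => some (coe x.1 x.2 T)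
  | .lv n (k + 1) => (elabSpine inf chk d Γ (.lv n (k + 1)) (some T)).bind fun x =>
      some (coe x.1 x.2 T)
  | s => (inf d Γ s).bind fun x => some (coe x.1 x.2 T)

end elaboration

/-- Elaboration without and with an expected type, with recursion depth at most `n`. -/
def elabRec : ℕ → (ℕ → ACtx → Sf → Option (ATm × ATm)) × (ℕ → ACtx → Sf → ATm → Option ATm)
  | 0 => (fun _ _ _ => none, fun _ _ _ _ => none)
  | n + 1 => (infStep (elabRec n).1 (elabRec n).2, chkStep (elabRec n).1 (elabRec n).2)

end HoTT

namespace HoTT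

/-! ### Notation for surface terms -/

/-- Surface terms in higher-order abstract syntax: a function of the number of variables in scope,
so that binders of the object language are Lean binders. -/
structure Tr : Type where
  run : ℕ → Sf

namespace Tr

/-- Application is written as in Lean. -/
instance : CoeFun Tr fun _ => Tr → Tr := ⟨fun f a => ⟨fun d => .app (f.run d) (a.run d)⟩⟩

/-- The variable of level `n`, with `k` implicit arguments. -/
def v (n k : ℕ) : Tr := ⟨fun _ => .lv n k⟩

/-- The body of a binder, applied to the new variable. -/
def bd (b : Tr → Tr) (d : ℕ) : Sf := (b (v d 0)).run (d + 1)

/-- The body of two binders, applied to the new variables. -/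
def bd₂ (b : Tr → Tr → Tr) (d : ℕ) : Sf := (b (v d 0) (v (d + 1) 0)).run (d + 2)

/-- A surface term without variables. -/
def cst (s : Sf) : Tr := ⟨fun _ => s⟩

/-- The universe of level `l`. -/
def U (l : Lv) : Tr := cst (.univ l)
/-- `∏ (x : A), B x` -/
def Pi (A : Tr) (B : Tr → Tr) : Tr := ⟨fun d => .pi (A.run d) (bd B d)⟩
/-- `A → B` -/
def arr (A B : Tr) : Tr := Pi A fun _ => B
/-- `λ x, b x`, where the type of `x` is determined by the expected type. -/
def Lam (b : Tr → Tr) : Tr := ⟨fun d => .lam (bd b d)⟩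
/-- `λ (x : A), b x` -/
def LamT (A : Tr) (b : Tr → Tr) : Tr := ⟨fun d => .lamT (A.run d) (bd b d)⟩
/-- `∑ (x : A), B x` -/
def Sig (A : Tr) (B : Tr → Tr) : Tr := ⟨fun d => .sigma (A.run d) (bd B d)⟩
/-- `(a, b)` -/
def pr (a b : Tr) : Tr := ⟨fun d => .pair (a.run d) (b.run d)⟩
/-- The first projection. -/
def fst (a : Tr) : Tr := ⟨fun d => .pr1 (a.run d)⟩
/-- The second projection. -/
def snd (a : Tr) : Tr := ⟨fun d => .pr2 (a.run d)⟩
/-- `∑`-induction with the goal as the motive. -/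
def Split (p : Tr) (c : Tr → Tr → Tr) : Tr := ⟨fun d => .split (p.run d) (bd₂ c d)⟩
/-- `a = b`, in the type of `a`. -/
def Path (a b : Tr) : Tr := ⟨fun d => .eq (a.run d) (b.run d)⟩
/-- `a = b`, in `A`. -/
def Idt (A a b : Tr) : Tr := ⟨fun d => .idt (A.run d) (a.run d) (b.run d)⟩
/-- Reflexivity, where the end points are determined by the expected type. -/
def rf : Tr := cst .refl
/-- Reflexivity at `a`. -/
def idp (a : Tr) : Tr := ⟨fun d => .idp (a.run d)⟩
/-- Path induction on a variable `p` whose end point is a variable, with the goal as the motive. -/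
def Ind (p c : Tr) : Tr := ⟨fun d => .ind (p.run d) (c.run d)⟩
/-- Path induction with the motive `M`. -/
def J (M : Tr → Tr → Tr) (c p : Tr) : Tr := ⟨fun d => .J (bd₂ M d) (c.run d) (p.run d)⟩
/-- The inverse of a path. -/
def Sym (p : Tr) : Tr := ⟨fun d => .inv (p.run d)⟩
/-- The concatenation of two paths, defined by induction on the second one. -/
def cat (p q : Tr) : Tr := ⟨fun d => .concat (p.run d) (q.run d)⟩
/-- The action of the function `f` on the path `p`. -/
def Ap (f : Tr → Tr) (p : Tr) : Tr := ⟨fun d => .ap (bd f d) (p.run d)⟩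
/-- The transport of `b` along `p` in the family `B`. -/
def Tp (B : Tr → Tr) (p b : Tr) : Tr := ⟨fun d => .tp (bd B d) (p.run d) (b.run d)⟩
/-- `0 : ℕ` -/
def Z0 : Tr := cst .zero
/-- The successor of a natural number. -/
def Sc (n : Tr) : Tr := ⟨fun d => .succ (n.run d)⟩
/-- Induction for natural numbers, with the goal as the motive. -/
def NatInd (n z : Tr) (s : Tr → Tr → Tr) : Tr := ⟨fun d => .natInd (n.run d) (z.run d) (bd₂ s d)⟩
/-- The type of integers. -/
def Zt : Tr := cst .int
/-- `0 : ℤ` -/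
def i0 : Tr := cst .izero
/-- The integer `n + 1`. -/
def ps (n : Tr) : Tr := ⟨fun d => .ipos (n.run d)⟩
/-- The integer `-(n + 1)`. -/
def ng (n : Tr) : Tr := ⟨fun d => .ineg (n.run d)⟩
/-- Case distinction for integers, with the goal as the motive. -/
def IntInd (k z : Tr) (p m : Tr → Tr) : Tr :=
  ⟨fun d => .intInd (k.run d) (z.run d) (bd p d) (bd m d)⟩
/-- `‖A‖` -/
def Trunc (A : Tr) : Tr := ⟨fun d => .trunc (A.run d)⟩
/-- `|a|` -/
def tt (a : Tr) : Tr := ⟨fun d => .tr (a.run d)⟩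
/-- The term `t`, with the expected type `T`. -/
def As (t T : Tr) : Tr := ⟨fun d => .ann (t.run d) (T.run d)⟩
/-- The term `b a`, in which `a` is bound to a variable. -/
def Let (a : Tr) (b : Tr → Tr) : Tr := ⟨fun d => .lett (a.run d) (bd b d)⟩

infixr:25 " ⇒ " => arr
infix:50 " ≐ " => Path
infixl:65 " ⬝ " => cat

end Tr

/-- The annotated term for the surface type `A`; it is a dummy if elaboration fails. -/
def typeFrom (Γ : ACtx) (A : Tr) : ATm :=
  match (elabRec 1000).1 Γ.length Γ (A.run Γ.length) with
  | some x => x.1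
  | none => .nat

/-- The annotated term for the surface term `t`, with the expected type `A`; it is a dummy if
elaboration fails. -/
def termFrom (Γ : ACtx) (t : Tr) (A : ATm) : ATm :=
  match (elabRec 1000).2 Γ.length Γ (t.run Γ.length) A with
  | some x => x
  | none => .nat

/-- The annotated terms `t` and `A` are such that `A` is a type and `t` has type `A`. -/
def checkAt (Γ : ACtx) (t : ATm) (A : ATm) : Bool :=
  match A.infer Γ with
  | some S => match S.asUniv with
    | some _ => match t.infer Γ with
      | some A' => ATm.eqv A' A
      | none => false
    | none => false
  | none => false

/-- The surface term `t` elaborates to a term of type `A`. -/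
def check (Γ : ACtx) (A : ATm) (t : Tr) : Bool := checkAt Γ (termFrom Γ t A) A

end HoTT

namespace HoTT

open Tm

/-! ### Comparison with raw terms -/

namespace Tm

/-- The change of the universes of a term by a function of their levels. -/
def relabel (f : ℕ → ℕ) : Tm → Tm
  | var n => var n
  | univ i => univ (f i)
  | pi A B => pi (A.relabel f) (B.relabel f)
  | lam A b => lam (A.relabel f) (b.relabel f)
  | app g a => app (g.relabel f) (a.relabel f)
  | sigma A B => sigma (A.relabel f) (B.relabel f)
  | pair a b => pair (a.relabel f) (b.relabel f)
  | sigmaElim C g p => sigmaElim (C.relabel f) (g.relabel f) (p.relabel f)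
  | idt A a b => idt (A.relabel f) (a.relabel f) (b.relabel f)
  | idp a => idp (a.relabel f)
  | pathElim C c p => pathElim (C.relabel f) (c.relabel f) (p.relabel f)
  | nat => nat
  | zero => zero
  | succ n => succ (n.relabel f)
  | natElim C z s n => natElim (C.relabel f) (z.relabel f) (s.relabel f) (n.relabel f)
  | int => int
  | izero => izero
  | ipos n => ipos (n.relabel f)
  | ineg n => ineg (n.relabel f)
  | intElim C z p m k =>
    intElim (C.relabel f) (z.relabel f) (p.relabel f) (m.relabel f) (k.relabel f)
  | trunc A => trunc (A.relabel f)
  | tr a => tr (a.relabel f)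
  | squash x y => squash (x.relabel f) (y.relabel f)
  | truncRec P h g t => truncRec (P.relabel f) (h.relabel f) (g.relabel f) (t.relabel f)
  | ua i => ua (f i)

theorem relabel_ren (f : ℕ → ℕ) (t : Tm) (ρ : ℕ → ℕ) :
    (t.ren ρ).relabel f = (t.relabel f).ren ρ := by
  induction t generalizing ρ <;> simp_all [relabel, ren]

theorem relabel_wk (f : ℕ → ℕ) (t : Tm) : t.wk.relabel f = (t.relabel f).wk := relabel_ren f t _

theorem relabel_sub (f : ℕ → ℕ) (t : Tm) {σ τ : ℕ → Tm} (h : ∀ n, (σ n).relabel f = τ n) :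
    (t.sub σ).relabel f = (t.relabel f).sub τ := by
  have hl {σ τ : ℕ → Tm} (h : ∀ n, (σ n).relabel f = τ n) (n : ℕ) :
      (liftSub σ n).relabel f = liftSub τ n := by
    cases n with
    | zero => rfl
    | succ n => rw [liftSub, liftSub, relabel_wk, h]
  induction t generalizing σ τ with
  | var n => exact h n
  | pi _ _ ih₁ ih₂ | lam _ _ ih₁ ih₂ | sigma _ _ ih₁ ih₂ =>
    simp only [sub, relabel, ih₁ h, ih₂ (hl h)]
  | _ => simp_all only [sub, relabel]

theorem relabel_inst (f : ℕ → ℕ) (B a : Tm) :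
    (B.inst a).relabel f = (B.relabel f).inst (a.relabel f) := by
  rw [inst_eq, inst_eq]
  exact relabel_sub f B fun n => by cases n <;> rfl

theorem relabel_fst (f : ℕ → ℕ) (A B p : Tm) :
    (fst A B p).relabel f = fst (A.relabel f) (B.relabel f) (p.relabel f) := by
  simp only [fst, relabel, relabel_wk]

theorem relabel_snd (f : ℕ → ℕ) (A B p : Tm) :
    (snd A B p).relabel f = snd (A.relabel f) (B.relabel f) (p.relabel f) := by
  simp only [snd, relabel, relabel_inst, relabel_fst, relabel_wk, relabel_ren]

/-- A test for equality of raw terms. -/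
def beq : Tm → Tm → Bool
  | var n, u => match u with
    | var n' => Nat.beq n n'
    | _ => false
  | univ i, u => match u with
    | univ i' => Nat.beq i i'
    | _ => false
  | pi A B, u => match u with
    | pi A' B' => beq A A' && beq B B'
    | _ => false
  | lam A b, u => match u with
    | lam A' b' => beq A A' && beq b b'
    | _ => false
  | app f a, u => match u with
    | app f' a' => beq f f' && beq a a'
    | _ => false
  | sigma A B, u => match u with
    | sigma A' B' => beq A A' && beq B B'
    | _ => false
  | pair a b, u => match u with
    | pair a' b' => beq a a' && beq b b'
    | _ => false
  | sigmaElim C g p, u => match u with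
    | sigmaElim C' g' p' => beq C C' && (beq g g' && beq p p')
    | _ => false
  | idt A a b, u => match u with
    | idt A' a' b' => beq A A' && (beq a a' && beq b b')
    | _ => false
  | idp a, u => match u with
    | idp a' => beq a a'
    | _ => false
  | pathElim C c p, u => match u with
    | pathElim C' c' p' => beq C C' && (beq c c' && beq p p')
    | _ => false
  | nat, u => match u with
    | nat => true
    | _ => false
  | zero, u => match u with
    | zero => true
    | _ => false
  | succ n, u => match u with
    | succ n' => beq n n'
    | _ => false
  | natElim C z s n, u => match u with
    | natElim C' z' s' n' => beq C C' && (beq z z' && (beq s s' && beq n n'))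
    | _ => false
  | int, u => match u with
    | int => true
    | _ => false
  | izero, u => match u with
    | izero => true
    | _ => false
  | ipos n, u => match u with
    | ipos n' => beq n n'
    | _ => false
  | ineg n, u => match u with
    | ineg n' => beq n n'
    | _ => false
  | intElim C z p m k, u => match u with
    | intElim C' z' p' m' k' =>
      beq C C' && (beq z z' && (beq p p' && (beq m m' && beq k k')))
    | _ => false
  | trunc A, u => match u with
    | trunc A' => beq A A'
    | _ => false
  | tr a, u => match u with
    | tr a' => beq a a'
    | _ => false
  | squash x y, u => match u with
    | squash x' y' => beq x x' && beq y y'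
    | _ => false
  | truncRec P h g t, u => match u with
    | truncRec P' h' g' t' => beq P P' && (beq h h' && (beq g g' && beq t t'))
    | _ => false
  | ua i, u => match u with
    | ua i' => Nat.beq i i'
    | _ => false

theorem eq_of_beq {t u : Tm} (h : beq t u = true) : t = u := by
  induction t generalizing u with
  | var n | univ n | ua n =>
    unfold beq at h
    split at h
    · rw [Nat.beq_eq.mp h]
    · cases h
  | _ =>
    unfold beq at h
    split at h
    · grind
    · cases h

end Tm

/-- The values of the two levels under which the levels `i`, `j` and `m 0` are told apart from each
other and from small numbers. -/
def testLevels : ℕ × ℕ := (1000, 1001)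

/-- The levels for which those at `testLevels` stand. -/
def decodeLevel (v : ℕ × ℕ) (k : ℕ) : ℕ :=
  if k = 1000 then v.1 else if k = 1001 then v.2 else if k = 2002 then v.1 + v.2 + 1 else k

/-- The levels that are determined by their values at `testLevels`. -/
def Lv.isPlain : Lv → Bool
  | n k => Nat.ble k 999
  | i k => Nat.beq k 0
  | j k => Nat.beq k 0
  | m k => Nat.beq k 0
  | max _ _ => false

theorem Lv.eval_of_isPlain (v : ℕ × ℕ) {l : Lv} (h : l.isPlain = true) :
    l.eval v = decodeLevel v (l.eval testLevels) := by
  cases l with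
  | n k =>
    simp only [isPlain, Nat.ble_eq] at h
    rw [eval, eval, decodeLevel, if_neg (by omega), if_neg (by omega), if_neg (by omega)]
  | max => cases h
  | _ =>
    simp only [isPlain, Nat.beq_eq] at h
    subst h
    simp [eval, decodeLevel, testLevels]

namespace ATm

/-- All levels in the erasure of the term are plain. -/
def isPlain : ATm → Bool
  | univ l => l.isPlain
  | pi A B => A.isPlain && B.isPlain
  | lam A b => A.isPlain && b.isPlain
  | app f a => f.isPlain && a.isPlain
  | sigma A B => A.isPlain && B.isPlain
  | pair _ _ a b => a.isPlain && b.isPlain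
  | fst A B p => A.isPlain && B.isPlain && p.isPlain
  | snd A B p => A.isPlain && B.isPlain && p.isPlain
  | split A B M c p => A.isPlain && B.isPlain && M.isPlain && c.isPlain && p.isPlain
  | idt A a b => A.isPlain && a.isPlain && b.isPlain
  | idp a => a.isPlain
  | pathInd A a _ M c p => A.isPlain && a.isPlain && M.isPlain && c.isPlain && p.isPlain
  | succ n => n.isPlain
  | natInd M z s n => M.isPlain && z.isPlain && s.isPlain && n.isPlain
  | ipos n => n.isPlain
  | ineg n => n.isPlain
  | intInd M z p m k => M.isPlain && z.isPlain && p.isPlain && m.isPlain && k.isPlain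
  | trunc A => A.isPlain
  | tr a => a.isPlain
  | ann t _ => t.isPlain
  | _ => true

theorem erase_of_isPlain (v : ℕ × ℕ) {t : ATm} (h : t.isPlain = true) :
    t.erase v = (t.erase testLevels).relabel (decodeLevel v) := by
  induction t with
  | univ l => exact congrArg Tm.univ (Lv.eval_of_isPlain v h)
  | fst A B p ihA ihB ihp =>
    simp only [isPlain, Bool.and_eq_true] at h
    simp only [erase, relabel_fst, ← ihA h.1.1, ← ihB h.1.2, ← ihp h.2]
  | snd A B p ihA ihB ihp =>
    simp only [isPlain, Bool.and_eq_true] at h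
    simp only [erase, relabel_snd, ← ihA h.1.1, ← ihB h.1.2, ← ihp h.2]
  | var | nat | zero | int | izero => rfl
  | _ =>
    simp only [isPlain, Bool.and_eq_true] at h
    simp only [erase, Tm.relabel, relabel_wk]
    grind

/-- The annotated term `t` stands for the raw term `X`, in which the levels are those at
`testLevels`. -/
def matchesRaw (t : ATm) (X : Tm) : Bool := t.isPlain && (t.erase testLevels).beq X

theorem erase_of_matchesRaw (v : ℕ × ℕ) {t : ATm} {X : Tm} (h : t.matchesRaw X = true) :
    t.erase v = X.relabel (decodeLevel v) := by
  rw [matchesRaw, Bool.and_eq_true] at h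
  rw [erase_of_isPlain v h.1, eq_of_beq h.2]

end ATm

/-! ### Realization of contexts -/

open ATm

/-- The context `Γ` is well formed, and closed terms can be substituted for its variables. -/
def Realized (v : ℕ × ℕ) (Γ : ACtx) : Prop :=
  CxOK v Γ ∧ ∃ σ, SubOK σ (eraseCtx v Γ) []

/-- The extension of a substitution into the empty context by a closed term. -/
def consSub (a : Tm) (σ : ℕ → Tm) : ℕ → Tm
  | 0 => a
  | n + 1 => σ n

theorem wk_consSub (a t : Tm) (σ : ℕ → Tm) : t.wk.sub (consSub a σ) = t.sub σ := by
  rw [Tm.wk, sub_ren]; rfl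

theorem SubOK.cons {σ : ℕ → Tm} {Γ : Ctx} {A a : Tm} (h : SubOK σ Γ [])
    (ha : HasType a (A.sub σ)) : SubOK (consSub a σ) (A :: Γ) [] := by
  intro n B hB
  rcases hB.cons_cases with ⟨rfl, rfl⟩ | ⟨m, A', rfl, h', rfl⟩
  · rw [wk_consSub]; exact ha
  · rw [wk_consSub]; exact h m A' h'

variable {v : ℕ × ℕ} {Γ : ACtx}

theorem Realized.nil : Realized v [] := ⟨trivial, Tm.var, fun n A h => by
  obtain ⟨B, hB, -⟩ := h
  simp [eraseCtx] at hB⟩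

theorem Realized.cons {A : ATm} {k : ℕ} (h : Realized v Γ)
    (hA : W v (eraseCtx v Γ) A (.univ k))
    (ha : ∀ σ, SubOK σ (eraseCtx v Γ) [] → ∃ a, HasType a ((A.erase v).sub σ)) :
    Realized v (A :: Γ) := by
  obtain ⟨hΓ, σ, hσ⟩ := h
  obtain ⟨a, ha⟩ := ha σ hσ
  exact ⟨⟨hΓ, k, hA⟩, consSub a σ, hσ.cons ha⟩

theorem checkAt_sound (hΓ : CxOK v Γ) {t A : ATm} (h : checkAt Γ t A = true) :
    (∃ k, W v (eraseCtx v Γ) A (.univ k)) ∧ W v (eraseCtx v Γ) t (A.erase v) := by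
  unfold checkAt at h
  split at h
  · rename_i S hS
    split at h
    · rename_i l hl
      split at h
      · rename_i A' hA'
        have hA := infer_sound hΓ hS
        have ht := infer_sound hΓ hA'
        rw [asUniv_sound hl] at hA
        rw [eqv_sound h] at ht
        exact ⟨⟨_, hA⟩, ht⟩
      · cases h
    · cases h
  · cases h

theorem W.realize (hΓ : CxOK v Γ) {σ : ℕ → Tm} (hσ : SubOK σ (eraseCtx v Γ) []) {t : ATm}
    {A : Tm} (h : W v (eraseCtx v Γ) t A) : HasType ((t.erase v).sub σ) (A.sub σ) :=
  (h.sound hΓ.ctx).sub hσ .ctx_nil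

/-- A type that has an element in a realized context is realized. -/
theorem Realized.cons_of_check (h : Realized v Γ) {A : ATm} {t : Tr} (hc : check Γ A t = true) :
    Realized v (A :: Γ) := by
  obtain ⟨⟨k, hA⟩, ht⟩ := checkAt_sound h.1 hc
  exact h.cons hA fun σ hσ => ⟨_, W.realize h.1 hσ ht⟩

/-- Whether `A` is a type. -/
def isType (Γ : ACtx) (A : ATm) : Bool := match A.infer Γ with
  | some S => match S.asUniv with
    | some _ => true
    | none => false
  | none => false

theorem isType_sound (hΓ : CxOK v Γ) {A : ATm} (h : isType Γ A = true) :
    ∃ k, W v (eraseCtx v Γ) A (.univ k) := by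
  unfold isType at h
  split at h
  · rename_i S hS
    split at h
    · rename_i l hl
      have hA := infer_sound hΓ hS
      rw [asUniv_sound hl] at hA
      exact ⟨_, hA⟩
    · cases h
  · cases h

/-- A type is realized by any element of the raw closed type for which it stands. -/
theorem Realized.cons_of_raw (h : Realized v Γ) {A : ATm} {X Y a : Tm}
    (hc : (isType Γ A && A.matchesRaw X) = true) (hX : X.relabel (decodeLevel v) = Y)
    (hY : ∀ σ, Y.sub σ = Y) (ha : HasType a Y) : Realized v (A :: Γ) := by
  rw [Bool.and_eq_true] at hc
  obtain ⟨k, hA⟩ := isType_sound h.1 hc.1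
  exact h.cons hA fun σ _ => ⟨a, by rwa [erase_of_matchesRaw v hc.2, hX, hY]⟩

/-- Inference of a type that stands for a raw type. -/
def infersRaw (Γ : ACtx) (t : Tr) (X : Tm) : Bool :=
  match (elabRec 1000).1 Γ.length Γ (t.run Γ.length) with
  | some x => match infer Γ x.1 with
    | some A => A.matchesRaw X
    | none => false
  | none => false

theorem infersRaw_sound (hΓ : CxOK v Γ) {t : Tr} {X : Tm} (h : infersRaw Γ t X = true) :
    ∃ a, W v (eraseCtx v Γ) a (X.relabel (decodeLevel v)) := by
  unfold infersRaw at h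
  split at h
  · rename_i x _
    split at h
    · rename_i A hA
      exact ⟨x.1, by rw [← erase_of_matchesRaw v h]; exact infer_sound hΓ hA⟩
    · cases h
  · cases h

end HoTT

namespace HoTT

open Tm

namespace Tm

/-! ### Substitution and relabelling in the types of the theorem -/

section

variable (σ : ℕ → Tm)

theorem pr1_sub (A B p : Tm) :
    (pr1 A B p).sub σ = pr1 (A.sub σ) (B.sub (liftSub σ)) (p.sub σ) := fst_sub A B p σ

theorem transport_sub (A a B p b : Tm) : (transport A a B p b).sub σ =
    transport (A.sub σ) (a.sub σ) (B.sub σ) (p.sub σ) (b.sub σ) := by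
  simp only [transport, sub, wk_sub]; rfl

theorem pathOver_sub (A a a' B p b b' : Tm) : (pathOver A a a' B p b b').sub σ =
    pathOver (A.sub σ) (a.sub σ) (a'.sub σ) (B.sub σ) (p.sub σ) (b.sub σ) (b'.sub σ) := by
  simp only [pathOver, sub, transport_sub]

theorem apd_sub (A a B f p : Tm) : (apd A a B f p).sub σ =
    apd (A.sub σ) (a.sub σ) (B.sub σ) (f.sub σ) (p.sub σ) := by
  simp only [apd, sub, wk_sub, pathOver_sub]; rfl

theorem invOf_sub (A B f e b : Tm) : (invOf A B f e b).sub σ =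
    invOf (A.sub σ) (B.sub σ) (f.sub σ) (e.sub σ) (b.sub σ) := by
  simp only [invOf, pr1_sub, sub, wk_sub, fiber_sub]; rfl

theorem TorZ_sub (i : ℕ) : (TorZ i).sub σ = TorZ i := rfl

theorem evZero_sub (i : ℕ) : (evZero i).sub σ = evZero i := rfl

theorem loops_sub (i : ℕ) : (loops i).sub σ = loops i := rfl

theorem evZeroIsEquiv_sub (i : ℕ) : (evZeroIsEquiv i).sub σ = evZeroIsEquiv i := by
  simp only [evZeroIsEquiv, isEquiv_sub, evZero_sub, loops_sub]; rfl

theorem loop_sub (i : ℕ) (e : Tm) : (loop i e).sub σ = loop i (e.sub σ) := by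
  simp only [loop, invOf_sub, evZero_sub, loops_sub]; rfl

theorem circleInduction_sub (j : ℕ) (C c s : Tm) : (circleInduction j C c s).sub σ =
    circleInduction j (C.sub σ) (c.sub σ) (s.sub σ) := by
  simp only [circleInduction, algSect, loopsOver, sub, arrow_sub, pathOver_sub, apd_sub, wk_sub]
  rfl

theorem dependentUniversalProperty_sub (j : ℕ) (C c s : Tm) :
    (dependentUniversalProperty j C c s).sub σ =
      dependentUniversalProperty j (C.sub σ) (c.sub σ) (s.sub σ) := by
  simp only [dependentUniversalProperty, hasSection, sub, arrow_sub, pathOver_sub, apd_sub, wk_sub]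
  rfl

end

section

variable (f : ℕ → ℕ)

theorem relabel_arrow (A B : Tm) :
    (arrow A B).relabel f = arrow (A.relabel f) (B.relabel f) := by
  simp only [arrow, relabel, relabel_wk]

theorem relabel_isContr (A : Tm) : (isContr A).relabel f = isContr (A.relabel f) := by
  simp only [isContr, relabel, relabel_wk]

theorem relabel_fiber (A B g b : Tm) : (fiber A B g b).relabel f =
    fiber (A.relabel f) (B.relabel f) (g.relabel f) (b.relabel f) := by
  simp only [fiber, relabel, relabel_wk]

theorem relabel_isEquiv (A B g : Tm) : (isEquiv A B g).relabel f =
    isEquiv (A.relabel f) (B.relabel f) (g.relabel f) := by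
  simp only [isEquiv, relabel, relabel_wk, relabel_isContr, relabel_fiber]

theorem relabel_univalence (i : ℕ) : (univalence i).relabel f = univalence (f i) := rfl

theorem relabel_transport (A a B p b : Tm) : (transport A a B p b).relabel f =
    transport (A.relabel f) (a.relabel f) (B.relabel f) (p.relabel f) (b.relabel f) := by
  simp only [transport, relabel, relabel_wk]

theorem relabel_pathOver (A a a' B p b b' : Tm) : (pathOver A a a' B p b b').relabel f =
    pathOver (A.relabel f) (a.relabel f) (a'.relabel f) (B.relabel f) (p.relabel f) (b.relabel f)
      (b'.relabel f) := by
  simp only [pathOver, relabel, relabel_transport]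

theorem relabel_apd (A a B g p : Tm) : (apd A a B g p).relabel f =
    apd (A.relabel f) (a.relabel f) (B.relabel f) (g.relabel f) (p.relabel f) := by
  simp only [apd, relabel, relabel_wk, relabel_pathOver]

theorem relabel_invOf (A B g e b : Tm) : (invOf A B g e b).relabel f =
    invOf (A.relabel f) (B.relabel f) (g.relabel f) (e.relabel f) (b.relabel f) := by
  simp only [invOf, pr1, relabel, relabel_wk, relabel_fiber]

theorem relabel_TorZ (i : ℕ) : (TorZ i).relabel f = TorZ (f i) := rfl

theorem relabel_evZeroIsEquiv (i : ℕ) :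
    (evZeroIsEquiv i).relabel f = evZeroIsEquiv (f i) := by
  simp only [evZeroIsEquiv, relabel_isEquiv]; rfl

theorem relabel_loop (i : ℕ) (e : Tm) : (loop i e).relabel f = loop (f i) (e.relabel f) := by
  simp only [loop, relabel_invOf]; rfl

theorem relabel_circleInduction (j : ℕ) (C c s : Tm) : (circleInduction j C c s).relabel f =
    circleInduction (f j) (C.relabel f) (c.relabel f) (s.relabel f) := by
  simp only [circleInduction, algSect, loopsOver, relabel, relabel_arrow, relabel_pathOver,
    relabel_apd, relabel_wk]

theorem relabel_dependentUniversalProperty (j : ℕ) (C c s : Tm) :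
    (dependentUniversalProperty j C c s).relabel f =
      dependentUniversalProperty (f j) (C.relabel f) (c.relabel f) (s.relabel f) := by
  simp only [dependentUniversalProperty, hasSection, relabel, relabel_arrow, relabel_pathOver,
    relabel_apd, relabel_wk]

end

end Tm

/-! ### The assumptions of the development -/

/-- Any two elements of a truncation are equal. -/
def squashType (k : ℕ) : Tm :=
  pi (univ k) (pi (trunc (var 0)) (pi (trunc (var 1)) (idt (trunc (var 2)) (var 1) (var 0))))

/-- The maps from a type to a proposition factor through the truncation. -/
def truncRecType (k : ℕ) : Tm :=
  pi (univ k) (pi (univ k) (arrow (isProp (var 0)) (arrow (arrow (var 1) (var 0))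
    (arrow (trunc (var 1)) (var 0)))))

theorem hasType_squash (k : ℕ) : HasType (lam (univ k) (lam (trunc (var 0)) (lam (trunc (var 1))
    (.squash (var 1) (var 0))))) (squashType k) := by
  have h₁ : Derivable [univ k] .ctx := .ctx_cons (.univ .ctx_nil)
  have h₂ := h₁.var_zero (A := .univ k)
  have h₃ := Derivable.ctx_cons (Derivable.trunc h₂)
  have h₄ := Derivable.ctx_cons (Derivable.trunc (h₃.var_one (A := .univ k)))
  exact .lam (.univ .ctx_nil) (.lam (.trunc h₂) (.lam (.trunc (h₃.var_one (A := .univ k)))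
    (.squash h₄.var_one h₄.var_zero)))

theorem hasType_truncRec (k : ℕ) : HasType (lam (univ k) (lam (univ k) (lam (isProp (var 0))
    (lam (arrow (var 2) (var 1)) (lam (trunc (var 3))
      (.truncRec (var 3) (var 2) (var 1) (var 0))))))) (truncRecType k) := by
  have h₁ : Derivable [univ k] .ctx := .ctx_cons (.univ .ctx_nil)
  have h₂ : Derivable [univ k, univ k] .ctx := .ctx_cons (.univ h₁)
  have hP := h₂.var_zero (A := .univ k)
  have hP' := Derivable.ctx_cons hP
  have hP₁ := hP.weaken hP'
  have hP'' := Derivable.ctx_cons hP₁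
  have hi : Derivable [univ k, univ k] (.mem (isProp (var 0)) (univ k)) :=
    .pi hP (.pi hP₁ (.idt (hP₁.weaken hP'') hP''.var_one hP''.var_zero))
  have h₃ := Derivable.ctx_cons hi
  have hA : Derivable _ (.mem (var 2) (univ k)) :=
    h₃.varTy (.succ (.succ (.zero (A := univ k))))
  have hA' := Derivable.ctx_cons hA
  have ha : Derivable _ (.mem (arrow (var 2) (var 1)) (univ k)) :=
    .pi hA (hA'.varTy (.succ (.succ (.zero (A := univ k)))))
  have h₄ := Derivable.ctx_cons ha
  have ht : Derivable _ (.mem (trunc (var 3)) (univ k)) :=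
    .trunc (h₄.varTy (.succ (.succ (.succ (.zero (A := univ k))))))
  have h₅ := Derivable.ctx_cons ht
  refine .lam (.univ .ctx_nil) (.lam (.univ h₁) (.lam hi (.lam ha (.lam ht ?_))))
  refine .truncRec (A := var 4) (j := k) ?_ ?_ ?_ ?_
  · exact h₅.varTy (.succ (.succ (.succ (.zero (A := univ k)))))
  · exact h₅.varTy (.succ (.succ .zero))
  · exact h₅.varTy (.succ .zero)
  · exact h₅.varTy .zero

theorem hasType_ua (k : ℕ) : HasType (.ua k) (univalence k) := .ua .ctx_nil

section

variable {u : ℕ × ℕ} {Γ : ACtx} {A : ATm} {k : ℕ}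

theorem Realized.cons_squash (h : Realized u Γ)
    (hc : (isType Γ A && A.matchesRaw (squashType k)) = true) : Realized u (A :: Γ) :=
  h.cons_of_raw hc rfl (fun _ => rfl) (hasType_squash _)

theorem Realized.cons_truncRec (h : Realized u Γ)
    (hc : (isType Γ A && A.matchesRaw (truncRecType k)) = true) : Realized u (A :: Γ) :=
  h.cons_of_raw hc rfl (fun _ => rfl) (hasType_truncRec _)

theorem Realized.cons_univalence (h : Realized u Γ)
    (hc : (isType Γ A && A.matchesRaw (univalence k)) = true) : Realized u (A :: Γ) :=
  h.cons_of_raw hc (relabel_univalence _ k) (univalence_sub _) (hasType_ua _)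

end

end HoTT

set_option maxRecDepth 100000
set_option linter.unusedVariables false

namespace HoTT

open Tr Tm ATm

/-! ### Basic constructions as surface terms

The statement of a lemma `foo` is the surface type `fooT`, its proof the surface term `fooP`. For
later use, `foo` is the variable of that type, given by its de Bruijn level and the number of its
leading arguments that the elaborator finds; `fooC` is the context that ends with this variable. -/

/-- The universe in which everything takes place: it contains the types of `U i` and of `U j`, the
type of `ℤ`-torsors, and `U i` and `U j` themselves. -/
def UU : Tr := U (.m 0)

def isContr' (A : Tr) : Tr := Sig A fun x => Pi A fun y => Idt A x y

def isProp' (A : Tr) : Tr := Pi A fun x => Pi A fun y => Idt A x y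

/-- The fiber of `f : A → B` over `b`. -/
def fib (A B f b : Tr) : Tr := Sig A fun x => Idt B (f x) b

/-- `f : X → Y` is an equivalence. -/
def isEq (A B f : Tr) : Tr := Pi B fun b => isContr' (fib A B f b)

/-- The type of equivalences. -/
def eqv' (A B : Tr) : Tr := Sig (A ⇒ B) fun f => isEq A B f

def idf (A : Tr) : Tr := LamT A fun x => x

/-- The fibers of the identity map are contractible. -/
def idFibers (A : Tr) : Tr := Lam fun y => pr (pr y (idp y)) <| Lam fun w =>
  Split w fun x q => J (fun y' q' => Idt (fib A A (idf A) y') (pr y' (idp y')) (pr x q'))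
    (idp (As (pr x (idp x)) (fib A A (idf A) x)))
    (As q (Idt A x y))

def idEqv (A : Tr) : Tr := pr (idf A) (idFibers A)

/-- The map `(X = Y) → (X ≃ Y)` for `X` and `Y` in `U l`, applied to `p`. -/
def idToEqv (l : Lv) (X p : Tr) : Tr := J (fun y _ => eqv' X y) (idEqv X) p

/-- The univalence axiom for `U l`. -/
def uaT (l : Lv) : Tr := Pi (U l) fun X => Pi (U l) fun Y =>
  isEq (Idt (U l) X Y) (eqv' X Y) (LamT (Idt (U l) X Y) fun p => idToEqv l X p)

/-! ### Assumptions -/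

def squashT : Tr := Pi UU fun A => Pi (Trunc A) fun x => Pi (Trunc A) fun y => x ≐ y
def trRecT : Tr := Pi UU fun A => Pi UU fun P => isProp' P ⇒ (A ⇒ P) ⇒ Trunc A ⇒ P

def squash' : Tr := v 0 1
def trRec : Tr := v 1 2
def uaI : Tr := v 2 0
def uaM : Tr := v 3 0

def squashC : ACtx := [typeFrom [] squashT]
theorem realized_squash (u : ℕ × ℕ) : Realized u squashC :=
  Realized.nil.cons_squash (k := 2002) (by decide +kernel)

def trRecC : ACtx := typeFrom squashC trRecT :: squashC
theorem realized_trRec (u : ℕ × ℕ) : Realized u trRecC :=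
  (realized_squash u).cons_truncRec (k := 2002) (by decide +kernel)

def uaIC : ACtx := typeFrom trRecC (uaT (.i 0)) :: trRecC
theorem realized_uaI (u : ℕ × ℕ) : Realized u uaIC :=
  (realized_trRec u).cons_univalence (k := 1000) (by decide +kernel)

def uaMC : ACtx := typeFrom uaIC (uaT (.m 0)) :: uaIC
theorem realized_uaM (u : ℕ × ℕ) : Realized u uaMC :=
  (realized_uaI u).cons_univalence (k := 2002) (by decide +kernel)

/-! ### Function extensionality -/

/-- Any two elements of a contractible type are equal. -/
def contrPathT : Tr := Pi UU fun A => isContr' A ⇒ Pi A fun x => Pi A fun y => x ≐ y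
def contrPathP : Tr := Lam fun A => Lam fun c => Lam fun x => Lam fun y =>
  Sym (snd c x) ⬝ snd c y
def contrPath : Tr := v 4 1

def contrPathC : ACtx := typeFrom uaMC contrPathT :: uaMC
theorem realized_contrPath (u : ℕ × ℕ) : Realized u contrPathC :=
  (realized_uaM u).cons_of_check (t := contrPathP) (by decide +kernel)

/-- The identity map is an equivalence. -/
def idIsEqT : Tr := Pi UU fun A => isEq A A (idf A)
def idIsEqP : Tr := Lam fun A => idFibers A
def idIsEq : Tr := v 5 0

def idIsEqC : ACtx := typeFrom contrPathC idIsEqT :: contrPathC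
theorem realized_idIsEq (u : ℕ × ℕ) : Realized u idIsEqC :=
  (realized_contrPath u).cons_of_check (t := idIsEqP) (by decide +kernel)

/-- Induction on equivalences in `U l`: a property of maps that holds for all identity maps holds
for all equivalences. -/
def eqvIndT (l : Lv) : Tr :=
  Pi (Pi (U l) fun X => Pi (U l) fun Y => (X ⇒ Y) ⇒ U (.m 1)) fun P =>
  Pi (Pi (U l) fun X => P X X (idf X)) fun _ =>
  Pi (U l) fun X => Pi (U l) fun Y => Pi (X ⇒ Y) fun f => isEq X Y f ⇒ P X Y f
/-- The transport of `P X Y (idToEquiv p)`, which is obtained by path induction on `p`, along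
`idToEquiv p = (f, h)`, where `p` is given by univalence. -/
def eqvIndP (l : Lv) (ua : Tr) : Tr :=
  Lam fun P => Lam fun b => Lam fun X => Lam fun Y => Lam fun f => Lam fun h =>
  Let (fst (ua X Y (pr f h))) fun w =>
  Tp (fun e => P X Y (fst e)) (snd w) (J (fun Y' p => P X Y' (fst (idToEqv l X p))) (b X) (fst w))
def eqvIndI : Tr := v 6 0

def eqvIndIC : ACtx := typeFrom idIsEqC (eqvIndT (.i 0)) :: idIsEqC
theorem realized_eqvIndI (u : ℕ × ℕ) : Realized u eqvIndIC :=
  (realized_idIsEq u).cons_of_check (t := (eqvIndP (.i 0) uaI)) (by decide +kernel)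

def eqvIndM : Tr := v 7 0

def eqvIndMC : ACtx := typeFrom eqvIndIC (eqvIndT (.m 0)) :: eqvIndIC
theorem realized_eqvIndM (u : ℕ × ℕ) : Realized u eqvIndMC :=
  (realized_eqvIndI u).cons_of_check (t := (eqvIndP (.m 0) uaM)) (by decide +kernel)

/-- Composition with an equivalence is an equivalence. -/
def postcompT : Tr := Pi UU fun A => Pi UU fun X => Pi UU fun Y => Pi (X ⇒ Y) fun f =>
  isEq X Y f ⇒ isEq (A ⇒ X) (A ⇒ Y) (LamT (A ⇒ X) fun g => LamT A fun a => f (g a))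
def postcompP : Tr := Lam fun A => eqvIndM
  (Lam fun X => Lam fun Y => Lam fun f =>
    isEq (A ⇒ X) (A ⇒ Y) (LamT (A ⇒ X) fun g => LamT A fun a => f (g a)))
  (Lam fun X => idIsEq (A ⇒ X))
def postcomp : Tr := v 8 3

def postcompC : ACtx := typeFrom eqvIndMC postcompT :: eqvIndMC
theorem realized_postcomp (u : ℕ × ℕ) : Realized u postcompC :=
  (realized_eqvIndM u).cons_of_check (t := postcompP) (by decide +kernel)

/-- A retract of a contractible type is contractible. -/
def retractT : Tr := Pi UU fun X => Pi UU fun Y => Pi (X ⇒ Y) fun r => Pi (Y ⇒ X) fun s =>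
  Pi (Pi Y fun y => r (s y) ≐ y) fun _ => isContr' X ⇒ isContr' Y
def retractP : Tr := Lam fun X => Lam fun Y => Lam fun r => Lam fun s => Lam fun h => Lam fun c =>
  pr (r (fst c)) (Lam fun y => Ap (fun x => r x) (snd c (s y)) ⬝ h y)
def retract : Tr := v 9 0

def retractC : ACtx := typeFrom postcompC retractT :: postcompC
theorem realized_retract (u : ℕ × ℕ) : Realized u retractC :=
  (realized_postcomp u).cons_of_check (t := retractP) (by decide +kernel)

/-- The first projection of a family of contractible types is an equivalence. -/
def pr1EqT : Tr := Pi UU fun A => Pi (A ⇒ UU) fun P => Pi (Pi A fun a => isContr' (P a)) fun _ =>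
  isEq (Sig A P) A (LamT (Sig A P) fun u => fst u)
def pr1EqP : Tr := Lam fun A => Lam fun P => Lam fun c =>
  let F := fib (Sig A P) A (LamT (Sig A P) fun u => fst u)
  Let (As (Lam fun u => Split u fun x y => Lam fun a => Lam fun q => Ind q <|
      Ap (fun y' => As (pr (pr x y') rf) (F x)) (snd (c x) y))
    (Pi (Sig A P) fun u => Pi A fun a => Pi (fst u ≐ a) fun q =>
      Idt (F a) (pr (pr a (fst (c a))) rf) (pr u q))) fun K =>
  Lam fun a => pr (pr (pr a (fst (c a))) rf) (Lam fun w => Split w fun u q => K u a q)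
def pr1Eq : Tr := v 10 0

def pr1EqC : ACtx := typeFrom retractC pr1EqT :: retractC
theorem realized_pr1Eq (u : ℕ × ℕ) : Realized u pr1EqC :=
  (realized_retract u).cons_of_check (t := pr1EqP) (by decide +kernel)

/-- A product of contractible types is contractible. -/
def weakFunextT : Tr := Pi UU fun A => Pi (A ⇒ UU) fun P =>
  Pi (Pi A fun a => isContr' (P a)) fun _ => isContr' (Pi A P)
/-- The product is a retract of the fiber over the identity map of the composition with the first
projection `∑ (a : A), P a → A`, which is an equivalence. -/
def weakFunextP : Tr := Lam fun A => Lam fun P => Lam fun c =>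
  let S := Sig A P
  let f := LamT (A ⇒ S) fun g => LamT A fun a => fst (g a)
  retract (fib (A ⇒ S) (A ⇒ A) f (idf A)) (Pi A P)
    (Lam fun w => Lam fun a =>
      Tp (fun x => P x) (As (Ap (fun k => k a) (snd w)) (fst (fst w a) ≐ a)) (snd (fst w a)))
    (Lam fun k => pr (Lam fun a => pr a (k a)) rf)
    (Lam fun k => rf)
    (postcomp (LamT S fun u => fst u) (pr1Eq A P c) (idf A))
def weakFunext : Tr := v 11 0

def weakFunextC : ACtx := typeFrom pr1EqC weakFunextT :: pr1EqC
theorem realized_weakFunext (u : ℕ × ℕ) : Realized u weakFunextC :=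
  (realized_pr1Eq u).cons_of_check (t := weakFunextP) (by decide +kernel)

/-- The paths from a fixed point form a contractible type. -/
def singContrT : Tr := Pi UU fun A => Pi A fun a => isContr' (Sig A fun y => a ≐ y)
def singContrP : Tr := Lam fun A => Lam fun a => pr (pr a rf) <| Lam fun w => Split w fun y q =>
  Ind q rf
def singContr : Tr := v 12 0

def singContrC : ACtx := typeFrom weakFunextC singContrT :: weakFunextC
theorem realized_singContr (u : ℕ × ℕ) : Realized u singContrC :=
  (realized_weakFunext u).cons_of_check (t := singContrP) (by decide +kernel)

/-- The homotopies from a fixed function form a contractible type. -/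
def homContrT : Tr := Pi UU fun A => Pi (A ⇒ UU) fun P => Pi (Pi A P) fun f =>
  isContr' (Sig (Pi A P) fun g => Pi A fun x => f x ≐ g x)
def homContrP : Tr := Lam fun A => Lam fun P => Lam fun f =>
  retract (Pi A fun x => Sig (P x) fun y => f x ≐ y) (Sig (Pi A P) fun g => Pi A fun x => f x ≐ g x)
    (Lam fun h => pr (Lam fun x => fst (h x)) (Lam fun x => snd (h x)))
    (Lam fun w => Lam fun x => pr (fst w x) (snd w x))
    (Lam fun w => Split w fun g H => rf)
    (weakFunext A (Lam fun x => Sig (P x) fun y => f x ≐ y) (Lam fun x => singContr (P x) (f x)))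
def homContr : Tr := v 13 0

def homContrC : ACtx := typeFrom singContrC homContrT :: singContrC
theorem realized_homContr (u : ℕ × ℕ) : Realized u homContrC :=
  (realized_singContr u).cons_of_check (t := homContrP) (by decide +kernel)

/-- Function extensionality. -/
def funextT : Tr := Pi UU fun A => Pi (A ⇒ UU) fun P => Pi (Pi A P) fun f => Pi (Pi A P) fun g =>
  (Pi A fun x => f x ≐ g x) ⇒ f ≐ g
def funextP : Tr := Lam fun A => Lam fun P => Lam fun f => Lam fun g => Lam fun H =>
  Ap (fun w => fst w) (contrPath (homContr A P f) (pr f (Lam fun x => rf)) (pr g H))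
def funext' : Tr := v 14 4

def funextC : ACtx := typeFrom homContrC funextT :: homContrC
theorem realized_funext (u : ℕ × ℕ) : Realized u funextC :=
  (realized_homContr u).cons_of_check (t := funextP) (by decide +kernel)

/-- Induction on homotopies from a fixed function. -/
def homIndT : Tr := Pi UU fun A => Pi (A ⇒ UU) fun P => Pi (Pi A P) fun f =>
  Pi (Pi (Pi A P) fun g => (Pi A fun x => f x ≐ g x) ⇒ UU) fun C =>
  C f (Lam fun x => rf) ⇒ Pi (Pi A P) fun g => Pi (Pi A fun x => f x ≐ g x) fun H => C g H
def homIndP : Tr := Lam fun A => Lam fun P => Lam fun f => Lam fun C => Lam fun c =>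
  Lam fun g => Lam fun H =>
  Tp (fun w => C (fst w) (snd w))
    (contrPath (homContr A P f) (pr f (Lam fun x => rf)) (pr g H)) c
def homInd : Tr := v 15 0

def homIndC : ACtx := typeFrom funextC homIndT :: funextC
theorem realized_homInd (u : ℕ × ℕ) : Realized u homIndC :=
  (realized_funext u).cons_of_check (t := homIndP) (by decide +kernel)

/-! ### Propositions and contractible types -/

/-- A product of propositions is a proposition. -/
def propPiT : Tr := Pi UU fun A => Pi (A ⇒ UU) fun P => (Pi A fun a => isProp' (P a)) ⇒
  isProp' (Pi A P)
def propPiP : Tr := Lam fun A => Lam fun P => Lam fun h => Lam fun f => Lam fun g =>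
  funext' (Lam fun a => h a (f a) (g a))
def propPi : Tr := v 16 0

def propPiC : ACtx := typeFrom homIndC propPiT :: homIndC
theorem realized_propPi (u : ℕ × ℕ) : Realized u propPiC :=
  (realized_homInd u).cons_of_check (t := propPiP) (by decide +kernel)

/-- The identity types of a proposition are propositions. -/
def propSetT : Tr := Pi UU fun A => isProp' A ⇒ Pi A fun x => Pi A fun y => isProp' (x ≐ y)
def propSetP : Tr := Lam fun A => Lam fun h => Lam fun x => Lam fun y =>
  Let (As (Lam fun y => Lam fun r => Ind r rf)
    (Pi A fun y => Pi (x ≐ y) fun r => rf ≐ Sym r ⬝ r)) fun c =>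
  Let (As (Lam fun y => Lam fun p => Ind p (c x (h x x)))
    (Pi A fun y => Pi (x ≐ y) fun p => p ≐ Sym (h x x) ⬝ h x y)) fun K =>
  Lam fun p => Lam fun q => K y p ⬝ Sym (K y q)
def propSet : Tr := v 17 0

def propSetC : ACtx := typeFrom propPiC propSetT :: propPiC
theorem realized_propSet (u : ℕ × ℕ) : Realized u propSetC :=
  (realized_propPi u).cons_of_check (t := propSetP) (by decide +kernel)

/-- Elements of a sum of propositions are equal if their first components are. -/
def sigPropT : Tr := Pi UU fun A => Pi (A ⇒ UU) fun P => (Pi A fun a => isProp' (P a)) ⇒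
  Pi (Sig A P) fun u => Pi (Sig A P) fun w => fst u ≐ fst w ⇒ u ≐ w
def sigPropP : Tr := Lam fun A => Lam fun P => Lam fun h =>
  Let (As (Lam fun x => Lam fun y => Lam fun x' => Lam fun q => Ind q <|
      Lam fun y' => Ap (fun z => As (pr x z) (Sig A P)) (h x y y'))
    (Pi A fun x => Pi (P x) fun y => Pi A fun x' => Pi (x ≐ x') fun q => Pi (P x') fun y' =>
      Idt (Sig A P) (pr x y) (pr x' y'))) fun K =>
  Lam fun u => Lam fun w => Split u fun x y => Split w fun x' y' => Lam fun q => K x y x' q y'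
def sigProp : Tr := v 18 0

def sigPropC : ACtx := typeFrom propSetC sigPropT :: propSetC
theorem realized_sigProp (u : ℕ × ℕ) : Realized u sigPropC :=
  (realized_propSet u).cons_of_check (t := sigPropP) (by decide +kernel)

/-- To be contractible is a proposition. -/
def propContrT : Tr := Pi UU fun A => isProp' (isContr' A)
def propContrP : Tr := Lam fun A => Lam fun c => Lam fun c' =>
  sigProp A (Lam fun x => Pi A fun y => x ≐ y)
    (Lam fun x => propPi A (Lam fun y => x ≐ y)
      (Lam fun y => propSet A (Lam fun x => Lam fun y => contrPath c x y) x y))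
    c c' (snd c (fst c'))
def propContr : Tr := v 19 0

def propContrC : ACtx := typeFrom sigPropC propContrT :: sigPropC
theorem realized_propContr (u : ℕ × ℕ) : Realized u propContrC :=
  (realized_sigProp u).cons_of_check (t := propContrP) (by decide +kernel)

/-- To be an equivalence is a proposition. -/
def propIsEqT : Tr := Pi UU fun X => Pi UU fun Y => Pi (X ⇒ Y) fun f => isProp' (isEq X Y f)
def propIsEqP : Tr := Lam fun X => Lam fun Y => Lam fun f =>
  propPi Y (Lam fun y => isContr' (fib X Y f y)) (Lam fun y => propContr (fib X Y f y))
def propIsEq : Tr := v 20 0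

def propIsEqC : ACtx := typeFrom propContrC propIsEqT :: propContrC
theorem realized_propIsEq (u : ℕ × ℕ) : Realized u propIsEqC :=
  (realized_propContr u).cons_of_check (t := propIsEqP) (by decide +kernel)

/-- The identity types of a contractible type are contractible. -/
def contrIdT : Tr := Pi UU fun A => isContr' A ⇒ Pi A fun x => Pi A fun y => isContr' (x ≐ y)
def contrIdP : Tr := Lam fun A => Lam fun c => Lam fun x => Lam fun y =>
  pr (contrPath c x y) (propSet A (Lam fun x => Lam fun y => contrPath c x y) x y (contrPath c x y))
def contrId : Tr := v 21 1

def contrIdC : ACtx := typeFrom propIsEqC contrIdT :: propIsEqC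
theorem realized_contrId (u : ℕ × ℕ) : Realized u contrIdC :=
  (realized_propIsEq u).cons_of_check (t := contrIdP) (by decide +kernel)

/-- A sum of contractible types over a contractible type is contractible. -/
def contrSigT : Tr := Pi UU fun A => Pi (A ⇒ UU) fun P => isContr' A ⇒
  (Pi A fun a => isContr' (P a)) ⇒ isContr' (Sig A P)
def contrSigP : Tr := Lam fun A => Lam fun P => Lam fun c => Lam fun h =>
  pr (pr (fst c) (fst (h (fst c)))) <| Lam fun w =>
  sigProp A P (Lam fun a => Lam fun y => Lam fun y' => contrPath (h a) y y')
    (pr (fst c) (fst (h (fst c)))) w (snd c (fst w))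
def contrSig : Tr := v 22 0

def contrSigC : ACtx := typeFrom contrIdC contrSigT :: contrIdC
theorem realized_contrSig (u : ℕ × ℕ) : Realized u contrSigC :=
  (realized_contrId u).cons_of_check (t := contrSigP) (by decide +kernel)

/-- The fundamental theorem of identity types: if the total space of `B` is contractible, then all
fiberwise maps from `a = x` to `B x` are equivalences. -/
def fibIdT : Tr := Pi UU fun A => Pi A fun a => Pi (A ⇒ UU) fun B =>
  Pi (Pi A fun x => a ≐ x ⇒ B x) fun f => isContr' (Sig A B) ⇒
  Pi A fun x => isEq (a ≐ x) (B x) (f x)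
/-- The fiber of `f x` over `b` is a retract of the type of pairs of an element `(y, q)` of `∑ (y :
A), a = y` and a path from `(y, f y q)` to `(x, b)`, which is contractible. -/
def fibIdP : Tr := Lam fun A => Lam fun a => Lam fun B => Lam fun f => Lam fun c => Lam fun x =>
  Lam fun b =>
  let S := Sig A fun x => a ≐ x
  let P := LamT S fun w => Idt (Sig A B) (pr (fst w) (f (fst w) (snd w))) (pr x b)
  retract (Sig S P) (fib (a ≐ x) (B x) (f x) b)
    (Lam fun w => J (fun u _ => fib (a ≐ fst u) (B (fst u)) (f (fst u)) (snd u))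
      (pr (snd (fst w)) rf) (As (snd w) (Idt (Sig A B)
        (pr (fst (fst w)) (f (fst (fst w)) (snd (fst w)))) (pr x b))))
    (Lam fun u => pr (pr x (fst u)) (Ap (fun z => As (pr x z) (Sig A B)) (snd u)))
    (Lam fun u => Split u fun q k => Ind k rf)
    (contrSig S P (singContr A a) (Lam fun w => contrId c
      (pr (fst w) (f (fst w) (snd w))) (pr x b)))
def fibId : Tr := v 23 0

def fibIdC : ACtx := typeFrom contrSigC fibIdT :: contrSigC
theorem realized_fibId (u : ℕ × ℕ) : Realized u fibIdC :=
  (realized_contrSig u).cons_of_check (t := fibIdP) (by decide +kernel)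

end HoTT

namespace HoTT

open Tr Tm ATm

/-! ### The integers -/

/-- Negation of integers. -/
def negate' (k : Tr) : Tr := As (IntInd k i0 (fun n => ng n) (fun n => ps n)) Zt

/-- The embedding `ℕ → ℤ`. -/
def embed' (n : Tr) : Tr := As (NatInd n i0 (fun m _ => ps m)) Zt

/-- The successor function of the integers. -/
def sZ : Tr := LamT Zt fun x =>
  As (IntInd x (ps Z0) (fun n => ps (Sc n)) (fun n => negate' (embed' n))) Zt

/-- The successor function of the integers is an equivalence. -/
def succEqT : Tr := isEq Zt Zt sZ
def succEqP : Tr :=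
  let c := As (Lam fun b => IntInd b (pr (ng Z0) rf)
      (fun n => NatInd n (pr i0 rf) (fun m _ => pr (ps m) rf)) (fun n => pr (ng (Sc n)) rf))
    (Pi Zt fun b => fib Zt Zt sZ b)
  Let (As (Lam fun k => IntInd k rf (fun _ => rf) (fun n => NatInd n rf (fun _ _ => rf)))
    (Pi Zt fun k => Idt (fib Zt Zt sZ (sZ k)) (c (sZ k)) (pr k rf))) fun H =>
  Lam fun b => pr (c b) (Lam fun w => Split w fun k q => Ind q (H k))
def succEq : Tr := v 24 0

def succEqC : ACtx := typeFrom fibIdC succEqT :: fibIdC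
theorem realized_succEq (u : ℕ × ℕ) : Realized u succEqC :=
  (realized_fibId u).cons_of_check (t := succEqP) (by decide +kernel)

/-- Induction for integers in both directions. -/
def zIndT : Tr := Pi (Zt ⇒ UU) fun K => K i0 ⇒ (Pi Zt fun n => K n ⇒ K (sZ n)) ⇒
  (Pi Zt fun n => K (sZ n) ⇒ K n) ⇒ Pi Zt fun n => K n
def zIndP : Tr := Lam fun K => Lam fun z => Lam fun u => Lam fun d => Lam fun k =>
  IntInd k z (fun n => NatInd n (u i0 z) (fun m h => u (ps m) h))
    (fun n => NatInd n (d (ng Z0) z) (fun m h => d (ng (Sc m)) h))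
def zInd : Tr := v 25 0

def zIndC : ACtx := typeFrom succEqC zIndT :: succEqC
theorem realized_zInd (u : ℕ × ℕ) : Realized u zIndC :=
  (realized_succEq u).cons_of_check (t := zIndP) (by decide +kernel)

/-- Recursion for `(Z, s, z)`: for a family `K` over `Z` with operations `K n → K (s n)` that have
sections, each element of `K z` extends to a section of `K` that is compatible with them. -/
def recT (Z s z : Tr) : Tr := Pi (Z ⇒ UU) fun K => Pi (Pi Z fun n => K n ⇒ K (s n)) fun e =>
  Pi (Pi Z fun n => Sig (K (s n) ⇒ K n) fun r => Pi (K (s n)) fun y => e n (r y) ≐ y) fun _ =>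
  Pi (K z) fun x => Sig (Pi Z fun n => K n) fun k =>
  Sig (Pi Z fun n => k (s n) ≐ e n (k n)) fun _ => k z ≐ x

/-- The recursion principle of the integers. -/
def zRecT : Tr := recT Zt sZ i0
def zRecP : Tr := Lam fun K => Lam fun e => Lam fun r => Lam fun x =>
  let k := As (Lam fun n => IntInd n x (fun n => NatInd n (e i0 x) (fun m h => e (ps m) h))
      (fun n => NatInd n (fst (r (ng Z0)) x) (fun m h => fst (r (ng (Sc m))) h)))
    (Pi Zt fun n => K n)
  pr k (pr (Lam fun n => IntInd n rf (fun _ => rf)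
    (fun n => NatInd n (Sym (snd (r (ng Z0)) x))
      (fun m _ => Sym (snd (r (ng (Sc m))) (k (ng m)))))) rf)
def zRec : Tr := v 26 0

def zRecC : ACtx := typeFrom zIndC zRecT :: zIndC
theorem realized_zRec (u : ℕ × ℕ) : Realized u zRecC :=
  (realized_zInd u).cons_of_check (t := zRecP) (by decide +kernel)

/-- The action on paths of an equivalence has a section. -/
def apSecT : Tr := Pi UU fun X => Pi UU fun Y => Pi (X ⇒ Y) fun f => isEq X Y f ⇒
  Pi X fun x => Pi X fun x' => Pi (f x ≐ f x') fun r =>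
    Sig (x ≐ x') fun p => Ap (fun y => f y) p ≐ r
def apSecP : Tr := eqvIndM
  (Lam fun X => Lam fun Y => Lam fun f =>
    Pi X fun x => Pi X fun x' => Pi (f x ≐ f x') fun r =>
      Sig (x ≐ x') fun p => Ap (fun y => f y) p ≐ r)
  (Lam fun X => Let (As (Lam fun x => Lam fun x' => Lam fun r => Ind r rf)
      (Pi X fun x => Pi X fun x' => Pi (x ≐ x') fun r => Ap (fun y => y) r ≐ r)) fun H =>
    Lam fun x => Lam fun x' => Lam fun r => pr r (H x x' r))
def apSec : Tr := v 27 3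

def apSecC : ACtx := typeFrom zRecC apSecT :: zRecC
theorem realized_apSec (u : ℕ × ℕ) : Realized u apSecC :=
  (realized_zRec u).cons_of_check (t := apSecP) (by decide +kernel)

/-- The composition of two equivalences is an equivalence. -/
def compEqT : Tr := Pi UU fun X => Pi UU fun Y => Pi UU fun Z => Pi (Y ⇒ Z) fun g =>
  isEq Y Z g ⇒ Pi (X ⇒ Y) fun f => isEq X Y f ⇒ isEq X Z (LamT X fun x => g (f x))
def compEqP : Tr := Lam fun X => eqvIndM
  (Lam fun Y => Lam fun Z => Lam fun g => Pi (X ⇒ Y) fun f =>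
    isEq X Y f ⇒ isEq X Z (LamT X fun x => g (f x)))
  (Lam fun _ => Lam fun _ => Lam fun h => h)
def compEq : Tr := v 28 3

def compEqC : ACtx := typeFrom apSecC compEqT :: apSecC
theorem realized_compEq (u : ℕ × ℕ) : Realized u compEqC :=
  (realized_apSec u).cons_of_check (t := compEqP) (by decide +kernel)

/-- If `g` and `g ∘ f` are equivalences, then so is `f`. -/
def cancelEqT : Tr := Pi UU fun X => Pi UU fun Y => Pi UU fun Z => Pi (Y ⇒ Z) fun g =>
  isEq Y Z g ⇒ Pi (X ⇒ Y) fun f => isEq X Z (LamT X fun x => g (f x)) ⇒ isEq X Y f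
def cancelEqP : Tr := Lam fun X => eqvIndM
  (Lam fun Y => Lam fun Z => Lam fun g => Pi (X ⇒ Y) fun f =>
    isEq X Z (LamT X fun x => g (f x)) ⇒ isEq X Y f)
  (Lam fun _ => Lam fun _ => Lam fun h => h)
def cancelEq : Tr := v 29 3

def cancelEqC : ACtx := typeFrom compEqC cancelEqT :: compEqC
theorem realized_cancelEq (u : ℕ × ℕ) : Realized u cancelEqC :=
  (realized_compEq u).cons_of_check (t := cancelEqP) (by decide +kernel)

def conjT : Tr := Pi UU fun A => Pi A fun x => Pi A fun u => Pi (x ≐ u) fun a =>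
  Pi A fun w => Pi (x ≐ w) fun b => Pi A fun y => Pi (w ≐ y) fun c =>
  a ⬝ (Sym a ⬝ b ⬝ c) ⬝ Sym c ≐ b
def conjP : Tr := Lam fun A => Lam fun x => Lam fun u => Lam fun a => Lam fun w => Lam fun b =>
  Lam fun y => Lam fun c => Ind c (Ind b (Ind a rf))
def conj : Tr := v 30 0

def conjC : ACtx := typeFrom cancelEqC conjT :: cancelEqC
theorem realized_conj (u : ℕ × ℕ) : Realized u conjC :=
  (realized_cancelEq u).cons_of_check (t := conjP) (by decide +kernel)

def eqOfConjT : Tr := Pi UU fun A => Pi A fun x => Pi A fun y => Pi (x ≐ y) fun q =>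
  Pi (x ≐ y) fun p => rf ≐ p ⬝ Sym q ⇒ p ≐ q
def eqOfConjP : Tr := Lam fun A => Lam fun x => Lam fun y => Lam fun q =>
  Ind q (Lam fun p => Lam fun h => Sym h)
def eqOfConj : Tr := v 31 3

def eqOfConjC : ACtx := typeFrom conjC eqOfConjT :: conjC
theorem realized_eqOfConj (u : ℕ × ℕ) : Realized u eqOfConjC :=
  (realized_conj u).cons_of_check (t := eqOfConjP) (by decide +kernel)

/-- The sections `k` of the family `K` over `Z` with `k (s n) = e n (k n)`. -/
def secs (Z s K e : Tr) : Tr := Sig (Pi Z fun n => K n) fun k => Pi Z fun n => k (s n) ≐ e n (k n)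

/-- If the operations of `K` are equivalences, then compatible sections of `K` that agree at `z` are
equal. -/
def secUniqT : Tr := Pi UU fun Z => Pi (Z ⇒ Z) fun s => Pi Z fun z => recT Z s z ⇒
  Pi (Z ⇒ UU) fun K => Pi (Pi Z fun n => K n ⇒ K (s n)) fun e =>
  (Pi Z fun n => isEq (K n) (K (s n)) (e n)) ⇒
  Pi (secs Z s K e) fun g => Pi (secs Z s K e) fun h => fst g z ≐ fst h z ⇒ g ≐ h
/-- The paths `k n = k' n` form a family with operations that have sections; the recursion principle
gives a compatible section of it, that is, a homotopy from `k` to `k'` with the coherence that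
homotopy induction needs. -/
def secUniqP : Tr := Lam fun Z => Lam fun s => Lam fun z => Lam fun R =>
  Lam fun K => Lam fun e => Lam fun h =>
  Let (As (Lam fun k => Lam fun a => Lam fun k' => Lam fun H =>
      homInd Z K k (Lam fun k' => Lam fun H =>
        Pi (Pi Z fun n => k' (s n) ≐ e n (k' n)) fun a' =>
        (Pi Z fun n => H (s n) ≐ a n ⬝ Ap (fun y => e n y) (H n) ⬝ Sym (a' n)) ⇒
          Idt (secs Z s K e) (pr k a) (pr k' a'))
      (Lam fun a' => Lam fun c => Ap (fun b => As (pr k b) (secs Z s K e))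
        (As (funext' (Lam fun n => eqOfConj (a' n) (a n) (c n))) (a ≐ a'))) k' H)
    (Pi (Pi Z fun n => K n) fun k => Pi (Pi Z fun n => k (s n) ≐ e n (k n)) fun a =>
      Pi (Pi Z fun n => K n) fun k' => Pi (Pi Z fun n => k n ≐ k' n) fun H =>
      Pi (Pi Z fun n => k' (s n) ≐ e n (k' n)) fun a' =>
        (Pi Z fun n => H (s n) ≐ a n ⬝ Ap (fun y => e n y) (H n) ⬝ Sym (a' n)) ⇒
          Idt (secs Z s K e) (pr k a) (pr k' a'))) fun M =>
  Lam fun g => Lam fun g' => Split g fun k a => Split g' fun k' a' => Lam fun q =>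
  Let (R (Lam fun n => k n ≐ k' n)
    (Lam fun n => Lam fun p => a n ⬝ Ap (fun y => e n y) p ⬝ Sym (a' n))
    (Lam fun n => pr (Lam fun y => fst (apSec (h n) (k n) (k' n) (Sym (a n) ⬝ y ⬝ a' n)))
      (Lam fun y => Ap (fun r => a n ⬝ r ⬝ Sym (a' n))
          (snd (apSec (h n) (k n) (k' n) (Sym (a n) ⬝ y ⬝ a' n)))
        ⬝ conj (K (s n)) (k (s n)) (e n (k n)) (a n) (k' (s n)) y (e n (k' n)) (a' n))) q) fun R =>
  M k a k' (fst R) a' (fst (snd R))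
def secUniq : Tr := v 32 0

def secUniqC : ACtx := typeFrom eqOfConjC secUniqT :: eqOfConjC
theorem realized_secUniq (u : ℕ × ℕ) : Realized u secUniqC :=
  (realized_eqOfConj u).cons_of_check (t := secUniqP) (by decide +kernel)

/-- Maps from `Z` to `Y` that turn `s` into the equivalence `f` and agree at `z` are equal. -/
def homUniqT : Tr := Pi UU fun Z => Pi (Z ⇒ Z) fun s => Pi Z fun z => recT Z s z ⇒
  Pi UU fun Y => Pi (Y ⇒ Y) fun f => isEq Y Y f ⇒
  Pi (Z ⇒ Y) fun k => Pi (Pi Z fun n => k (s n) ≐ f (k n)) fun _ =>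
  Pi (Z ⇒ Y) fun k' => Pi (Pi Z fun n => k' (s n) ≐ f (k' n)) fun _ =>
  k z ≐ k' z ⇒ k ≐ k'
def homUniqP : Tr := Lam fun Z => Lam fun s => Lam fun z => Lam fun R =>
  Lam fun Y => Lam fun f => Lam fun h => Lam fun k => Lam fun a => Lam fun k' =>
  Lam fun a' => Lam fun q =>
  Ap (fun g => fst g) (secUniq Z s z R (Lam fun _ => Y) (Lam fun _ => f) (Lam fun _ => h)
    (pr k a) (pr k' a') q)
def homUniq : Tr := v 33 0

def homUniqC : ACtx := typeFrom secUniqC homUniqT :: secUniqC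
theorem realized_homUniq (u : ℕ × ℕ) : Realized u homUniqC :=
  (realized_secUniq u).cons_of_check (t := homUniqP) (by decide +kernel)

end HoTT

namespace HoTT

open Tr Tm ATm

/-! ### The type of `ℤ`-torsors -/

/-- The type of types in `U i` with an endomap. -/
def endo : Tr := Sig (U (.i 0)) fun X => X ⇒ X
def intEndo' : Tr := As (pr Zt sZ) endo
/-- `w` is merely equal to `(ℤ, s)`. -/
def mereId' (w : Tr) : Tr := Trunc (Idt endo intEndo' w)
/-- The type of `ℤ`-torsors. -/
def tor : Tr := Sig endo fun w => mereId' w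
/-- The base point of the type of `ℤ`-torsors. -/
def pt' : Tr := As (pr intEndo' (tt (idp intEndo'))) tor
/-- The underlying type of a `ℤ`-torsor. -/
def car : Tr := LamT tor fun z => fst (fst z)
/-- The type of loops at the base point. -/
def lps : Tr := Idt tor pt' pt'

/-- The type of pointed types with an endomap. -/
def endoP : Tr := Sig endo fun e => fst e

/-- Equivalences that respect the endomaps and the base points induce paths in `endoP`. -/
def sipT : Tr := Pi (U (.i 0)) fun X => Pi (U (.i 0)) fun Y => Pi (X ⇒ Y) fun k => isEq X Y k ⇒
  Pi (X ⇒ X) fun f => Pi X fun x => Pi (Y ⇒ Y) fun g => Pi Y fun y =>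
  (Pi X fun n => k (f n) ≐ g (k n)) ⇒ k x ≐ y ⇒ Idt endoP (pr (pr X f) x) (pr (pr Y g) y)
def sipP : Tr := eqvIndI
  (Lam fun X => Lam fun Y => Lam fun k => Pi (X ⇒ X) fun f => Pi X fun x => Pi (Y ⇒ Y) fun g =>
    Pi Y fun y => (Pi X fun n => k (f n) ≐ g (k n)) ⇒ k x ≐ y ⇒
      Idt endoP (pr (pr X f) x) (pr (pr Y g) y))
  (Lam fun X => Lam fun f => Lam fun x => Lam fun g => Lam fun y => Lam fun H =>
    Let (As (funext' (Lam fun n => H n)) (f ≐ g)) fun h => Ind h (Lam fun q => Ind q rf))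
def sip : Tr := v 34 2

def sipC : ACtx := typeFrom homUniqC sipT :: homUniqC
theorem realized_sip (u : ℕ × ℕ) : Realized u sipC :=
  (realized_homUniq u).cons_of_check (t := sipP) (by decide +kernel)

/-- For every point `x` of a type with an invertible endomap `f` there is a map `k` from the
integers that turns the successor function into `f`, with `k 0 = x`. -/
def orbitT : Tr := Pi UU fun X => Pi (X ⇒ X) fun f => isEq X X f ⇒ Pi X fun x =>
  Sig (Zt ⇒ X) fun k => Sig (Pi Zt fun n => k (sZ n) ≐ f (k n)) fun _ => k i0 ≐ x
def orbitP : Tr := Lam fun X => Lam fun f => Lam fun h => zRec (Lam fun _ => X) (Lam fun _ => f)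
  (Lam fun _ => pr (Lam fun y => fst (fst (h y))) (Lam fun y => snd (fst (h y))))
def orbit : Tr := v 35 1

def orbitC : ACtx := typeFrom sipC orbitT :: sipC
theorem realized_orbit (u : ℕ × ℕ) : Realized u orbitC :=
  (realized_sip u).cons_of_check (t := orbitP) (by decide +kernel)

/-- All maps from the integers to themselves that commute with the successor function are
equivalences. -/
def zEndoEqT : Tr := Pi Zt fun x => Pi (Zt ⇒ Zt) fun k => (Pi Zt fun n => k (sZ n) ≐ sZ (k n)) ⇒
  k i0 ≐ x ⇒ isEq Zt Zt k
/-- By induction on the value `x` at `0`: for `x = 0` the map is the identity, and composition with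
the successor function changes `x` by one. -/
def zEndoEqP : Tr := zInd
  (Lam fun x => Pi (Zt ⇒ Zt) fun k => (Pi Zt fun n => k (sZ n) ≐ sZ (k n)) ⇒
    k i0 ≐ x ⇒ isEq Zt Zt k)
  (Lam fun k => Lam fun a => Lam fun q => Tp (fun k => isEq Zt Zt k)
    (homUniq Zt sZ i0 zRec Zt sZ succEq (idf Zt) (Lam fun _ => rf) k a (Sym q)) (idIsEq Zt))
  (Lam fun x => Lam fun I => Lam fun k => Lam fun a => Lam fun q =>
    Let (orbit sZ succEq x) fun w =>
    Tp (fun k => isEq Zt Zt k)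
      (homUniq Zt sZ i0 zRec Zt sZ succEq (LamT Zt fun n => sZ (fst w n))
        (Lam fun n => Ap (fun m => sZ m) (fst (snd w) n)) k a
        (Ap (fun m => sZ m) (snd (snd w)) ⬝ Sym q))
      (compEq sZ succEq (fst w) (I (fst w) (fst (snd w)) (snd (snd w)))))
  (Lam fun x => Lam fun I => Lam fun k => Lam fun a => Lam fun q =>
    cancelEq sZ succEq k (I (LamT Zt fun n => sZ (k n)) (Lam fun n => Ap (fun m => sZ m) (a n))
      (Ap (fun m => sZ m) q)))
def zEndoEq : Tr := v 36 0

def zEndoEqC : ACtx := typeFrom orbitC zEndoEqT :: orbitC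
theorem realized_zEndoEq (u : ℕ × ℕ) : Realized u zEndoEqC :=
  (realized_orbit u).cons_of_check (t := zEndoEqP) (by decide +kernel)

/-- The endomap of a torsor is an equivalence. -/
def torEqT : Tr := Pi endo fun w => mereId' w ⇒ isEq (fst w) (fst w) (snd w)
def torEqP : Tr := Lam fun w => trRec (propIsEq (fst w) (fst w) (snd w)) (Lam fun p => Ind p succEq)
def torEq : Tr := v 37 0

def torEqC : ACtx := typeFrom zEndoEqC torEqT :: zEndoEqC
theorem realized_torEq (u : ℕ × ℕ) : Realized u torEqC :=
  (realized_zEndoEq u).cons_of_check (t := torEqP) (by decide +kernel)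

/-- All maps from the integers to a torsor that respect the endomaps are equivalences. -/
def torHomEqT : Tr := Pi endo fun w => mereId' w ⇒ Pi (Zt ⇒ fst w) fun k =>
  (Pi Zt fun n => k (sZ n) ≐ snd w (k n)) ⇒ isEq Zt (fst w) k
def torHomEqP : Tr := Lam fun w => trRec
  (propPi (Zt ⇒ fst w) (Lam fun k => (Pi Zt fun n => k (sZ n) ≐ snd w (k n)) ⇒ isEq Zt (fst w) k)
    (Lam fun k => propPi (Pi Zt fun n => k (sZ n) ≐ snd w (k n)) (Lam fun _ => isEq Zt (fst w) k)
      (Lam fun _ => propIsEq Zt (fst w) k)))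
  (Lam fun p => Ind p (Lam fun k => Lam fun a => zEndoEq (k i0) k a rf))
def torHomEq : Tr := v 38 0

def torHomEqC : ACtx := typeFrom torEqC torHomEqT :: torEqC
theorem realized_torHomEq (u : ℕ × ℕ) : Realized u torHomEqC :=
  (realized_torEq u).cons_of_check (t := torHomEqP) (by decide +kernel)

/-- The type of torsors with a point is contractible. -/
def torContrT : Tr := isContr' (Sig tor fun z => fst (fst z))
/-- The center is `(pt, 0)`. A torsor with a point `x` is identified with it by the orbit of `x`. -/
def torContrP : Tr :=
  let S := Sig tor fun z => fst (fst z)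
  Let (As (Lam fun u => Lam fun p => J (fun u _ => Pi (mereId' (fst u)) fun t =>
        Idt S (pr pt' i0) (pr (pr (fst u) t) (snd u)))
      (Lam fun t => Ap (fun t => As (pr (pr intEndo' t) i0) S)
        (squash' (As (tt (idp intEndo')) (mereId' intEndo')) t)) p)
    (Pi endoP fun u => Pi (Idt endoP (pr intEndo' i0) u) fun p => Pi (mereId' (fst u)) fun t =>
      Idt S (pr pt' i0) (pr (pr (fst u) t) (snd u)))) fun K =>
  Let (As (Lam fun e => Split e fun X f => Lam fun t => Lam fun x =>
      Let (orbit f (torEq (pr X f) t) x) fun k =>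
      K (pr (pr X f) x) (sip (fst k) (torHomEq (pr X f) t (fst k) (fst (snd k)))
        sZ i0 f x (fst (snd k)) (snd (snd k))) t)
    (Pi endo fun e => Pi (mereId' e) fun t => Pi (fst e) fun x =>
      Idt S (pr pt' i0) (pr (pr e t) x))) fun L =>
  Let (As (Lam fun z => Split z fun e t => Lam fun x => L e t x)
    (Pi tor fun z => Pi (fst (fst z)) fun x => Idt S (pr pt' i0) (pr z x))) fun L =>
  pr (pr pt' i0) <| Lam fun w => Split w fun z x => L z x
def torContr : Tr := v 39 0

def torContrC : ACtx := typeFrom torHomEqC torContrT :: torHomEqC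
theorem realized_torContr (u : ℕ × ℕ) : Realized u torContrC :=
  (realized_torHomEq u).cons_of_check (t := torContrP) (by decide +kernel)

/-- The transport of `x : X c` along the path `X c = X z` induced by `q : c = z`. -/
def evAt (X c x z q : Tr) : Tr := J (fun Y _ => (LamT (U (.i 0)) fun Y => Y) Y) x
  (As (J (fun y _ => Idt (U (.i 0)) (X c) (X y)) (idp (X c)) q) (Idt (U (.i 0)) (X c) (X z)))

/-- The map `ev₀`, with values in the underlying type of the torsor `z`. -/
def ev (z q : Tr) : Tr := evAt car pt' i0 z q

/-- The map `ev₀` is an equivalence. -/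
def evT : Tr := isEq lps Zt (LamT lps fun q => ev pt' q)
/-- The total space of the underlying types is contractible, so the fundamental theorem of identity
types applies to the maps `pt = z → X`, for `z = ((X, f), t)`. -/
def evP : Tr := fibId tor pt' (Lam fun z => car z) (Lam fun z => Lam fun q => ev z q) torContr pt'

end HoTT

namespace HoTT

open Tr Tm ATm

/-! ### Connectedness, and compatible sections -/

/-- The type of `ℤ`-torsors is connected. -/
def connT : Tr := Pi tor fun z => Trunc (pt' ≐ z)
def connP : Tr :=
  Let (As (Lam fun e => Lam fun p => Ind p (Lam fun t =>
      Ap (fun t => As (pr intEndo' t) tor) (squash' (As (tt (idp intEndo')) (mereId' intEndo')) t)))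
    (Pi endo fun e => Pi (Idt endo intEndo' e) fun p => Pi (mereId' e) fun t =>
      Idt tor pt' (pr e t))) fun K =>
  Lam fun z => Split z fun e t =>
    trRec (Lam fun x => Lam fun y => squash' x y) (Lam fun p => tt (K e p t)) t
def conn : Tr := v 40 0

def connC : ACtx := typeFrom torContrC connT :: torContrC
theorem realized_conn (u : ℕ × ℕ) : Realized u connC :=
  (realized_torContr u).cons_of_check (t := connP) (by decide +kernel)

/-- Reflexivity is a left unit of concatenation. -/
def catIdT : Tr := Pi UU fun X => Pi X fun x => Pi X fun y => Pi (x ≐ y) fun d => rf ⬝ d ≐ d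
def catIdP : Tr := Lam fun X => Lam fun x => Lam fun y => Lam fun d => Ind d rf
def catId : Tr := v 41 3

def catIdC : ACtx := typeFrom connC catIdT :: connC
theorem realized_catId (u : ℕ × ℕ) : Realized u catIdC :=
  (realized_conn u).cons_of_check (t := catIdP) (by decide +kernel)

/-- Concatenation with a fixed path is an equivalence. -/
def catEqT : Tr := Pi UU fun X => Pi X fun x => Pi X fun y => Pi (x ≐ y) fun q => Pi X fun z =>
  isEq (y ≐ z) (x ≐ z) (LamT (y ≐ z) fun r => q ⬝ r)
def catEqP : Tr := Lam fun X => Lam fun x => Lam fun y => Lam fun q => Ind q <| Lam fun z =>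
  Tp (fun k => isEq (x ≐ z) (x ≐ z) k)
    (As (funext' (Lam fun r => Sym (catId r)))
      (Idt (x ≐ z ⇒ x ≐ z) (idf (x ≐ z)) (LamT (x ≐ z) fun r => As (rf ⬝ r) (x ≐ z))))
    (idIsEq (x ≐ z))
def catEq : Tr := v 42 3

def catEqC : ACtx := typeFrom catIdC catEqT :: catIdC
theorem realized_catEq (u : ℕ × ℕ) : Realized u catEqC :=
  (realized_catId u).cons_of_check (t := catEqP) (by decide +kernel)

/-- The universal property of `(X, f, x)`: a family `K` over `X` with equivalences `K n ≃ K (f n)`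
has sections compatible with them through each element of `K x`, and only those. -/
def up (X f x : Tr) : Tr := Pi (X ⇒ UU) fun K => Pi (Pi X fun n => K n ⇒ K (f n)) fun e =>
  (Pi X fun n => isEq (K n) (K (f n)) (e n)) ⇒ Sig (K x ⇒ secs X f K e) fun mk =>
  Pi (secs X f K e) fun g => mk (fst g x) ≐ g

/-- The universal property is preserved by equivalences that respect the endomaps and base points.
-/
def upTransferT : Tr := Pi UU fun X => Pi UU fun Y => Pi (X ⇒ Y) fun k => isEq X Y k ⇒
  Pi (X ⇒ X) fun f => Pi X fun x => Pi (Y ⇒ Y) fun g => Pi Y fun y =>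
  (Pi X fun n => k (f n) ≐ g (k n)) ⇒ k x ≐ y ⇒ up Y g y ⇒ up X f x
def upTransferP : Tr := eqvIndM
  (Lam fun X => Lam fun Y => Lam fun k => Pi (X ⇒ X) fun f => Pi X fun x => Pi (Y ⇒ Y) fun g =>
    Pi Y fun y => (Pi X fun n => k (f n) ≐ g (k n)) ⇒ k x ≐ y ⇒ up Y g y ⇒ up X f x)
  (Lam fun X => Lam fun f => Lam fun x => Lam fun g => Lam fun y => Lam fun H =>
    Let (As (funext' (Lam fun n => H n)) (f ≐ g)) fun h =>
    Ind h (Lam fun q => Ind q (Lam fun u => u)))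
def upTransfer : Tr := v 43 2

def upTransferC : ACtx := typeFrom catEqC upTransferT :: catEqC
theorem realized_upTransfer (u : ℕ × ℕ) : Realized u upTransferC :=
  (realized_catEq u).cons_of_check (t := upTransferP) (by decide +kernel)

/-- The recursion principle of the integers implies their universal property. -/
def upOfRecT : Tr := Pi UU fun Z => Pi (Z ⇒ Z) fun s => Pi Z fun z => recT Z s z ⇒ up Z s z
def upOfRecP : Tr := Lam fun Z => Lam fun s => Lam fun z => Lam fun R =>
  Lam fun K => Lam fun e => Lam fun h =>
  Let (As (Lam fun x => R K e (Lam fun n => pr (Lam fun y => fst (fst (h n y)))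
      (Lam fun y => snd (fst (h n y)))) x)
    (Pi (K z) fun x => Sig (Pi Z fun n => K n) fun k =>
      Sig (Pi Z fun n => k (s n) ≐ e n (k n)) fun _ => k z ≐ x)) fun Q =>
  pr (Lam fun x => pr (fst (Q x)) (fst (snd (Q x))))
    (Lam fun g => secUniq Z s z R K e h (pr (fst (Q (fst g z))) (fst (snd (Q (fst g z))))) g
      (snd (snd (Q (fst g z)))))
def upOfRec : Tr := v 44 0

def upOfRecC : ACtx := typeFrom upTransferC upOfRecT :: upTransferC
theorem realized_upOfRec (u : ℕ × ℕ) : Realized u upOfRecC :=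
  (realized_upTransfer u).cons_of_check (t := upOfRecP) (by decide +kernel)

/-- Under the evaluation of loops, composition with a loop `l` whose value is `f x` corresponds to
`f`. -/
def evMulT : Tr := Pi UU fun C => Pi C fun c => Pi (C ⇒ U (.i 0)) fun X =>
  Pi (Pi C fun z => X z ⇒ X z) fun f => Pi (X c) fun x => Pi (c ≐ c) fun l =>
  evAt X c x c l ≐ f c x ⇒ Pi C fun z => Pi (c ≐ z) fun q =>
  evAt X c x z (l ⬝ q) ≐ f z (evAt X c x z q)
def evMulP : Tr := Lam fun C => Lam fun c => Lam fun X => Lam fun f => Lam fun x => Lam fun l =>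
  Lam fun h => Lam fun z => Lam fun q => Ind q h
def evMul : Tr := v 45 0

def evMulC : ACtx := typeFrom upOfRecC evMulT :: upOfRecC
theorem realized_evMul (u : ℕ × ℕ) : Realized u evMulC :=
  (realized_upOfRec u).cons_of_check (t := evMulP) (by decide +kernel)

/-! ### The induction principle -/

/-- The family whose sections give the induction principle: an element `y` over `z`, with
compatible paths to it from the transports of `a` along all paths to `z`. -/
def cone (C c l A a p z : Tr) : Tr := Sig (A z) fun y =>
  Sig (Pi (c ≐ z) fun q => Tp (fun z => A z) q a ≐ y) fun k =>
  Pi (c ≐ z) fun q => k (l ⬝ q) ≐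
    J (fun z q => Tp (fun z => A z) (l ⬝ q) a ≐ Tp (fun z => A z) q a) p q ⬝ k q

/-- The families of types in `U j` over `C`. -/
def famT (C : Tr) : Tr := C ⇒ U (.j 0)
/-- The paths from `a` to itself over `l`. -/
def overT (c l A a : Tr) : Tr := Idt (A c) (Tp (fun z => A z) l a) a

/-- The universal property of the loops at `c`, with composition with `l` as the successor. -/
def upLoopT (c l : Tr) : Tr := up (c ≐ c) (LamT (c ≐ c) fun q => l ⬝ q) (idp c)

/-- The type `C` is connected. -/
def connT' (C c : Tr) : Tr := Pi C fun z => Trunc (c ≐ z)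

/-- The universal property of `(X, s, x)` implies that compatible extensions of a map `F : X → Y` to
the cone over `X` form a contractible type. -/
def extContrT : Tr := Pi UU fun X => Pi (X ⇒ X) fun s => Pi X fun x => up X s x ⇒
  Pi UU fun Y => Pi (X ⇒ Y) fun F => Pi (Pi X fun q => F (s q) ≐ F q) fun d =>
  isContr' (Sig Y fun y => Sig (Pi X fun q => F q ≐ y) fun k => Pi X fun q => k (s q) ≐ d q ⬝ k q)
/-- A compatible extension is determined by its value `F x = y` at `x`, and the paths from `F x`
form a contractible type. -/
def extContrP : Tr := Lam fun X => Lam fun s => Lam fun x => Lam fun h =>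
  Lam fun Y => Lam fun F => Lam fun d =>
  let S := fun y => Sig (Pi X fun q => F q ≐ y) fun k => Pi X fun q => k (s q) ≐ d q ⬝ k q
  Let (As (Lam fun y => h (Lam fun q => F q ≐ y) (Lam fun q => Lam fun r => d q ⬝ r)
      (Lam fun q => catEq (d q) y))
    (Pi Y fun y => Sig (F x ≐ y ⇒ S y) fun mk => Pi (S y) fun g => mk (fst g x) ≐ g)) fun M =>
  retract (Sig Y fun y => F x ≐ y) (Sig Y S)
    (Lam fun w => pr (fst w) (fst (M (fst w)) (snd w)))
    (Lam fun u => pr (fst u) (fst (snd u) x))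
    (Lam fun u => Split u fun y g => Ap (fun g => As (pr y g) (Sig Y S)) (snd (M y) g))
    (singContr Y (F x))
def extContr : Tr := v 46 0

def extContrC : ACtx := typeFrom evMulC extContrT :: evMulC
theorem realized_extContr (u : ℕ × ℕ) : Realized u extContrC :=
  (realized_evMul u).cons_of_check (t := extContrP) (by decide +kernel)

/-- The type `cone` over the base point is contractible. -/
def coneBaseT : Tr := Pi UU fun C => Pi C fun c => Pi (c ≐ c) fun l => upLoopT c l ⇒
  Pi (famT C) fun A => Pi (A c) fun a => Pi (overT c l A a) fun p => isContr' (cone C c l A a p c)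
def coneBaseP : Tr := Lam fun C => Lam fun c => Lam fun l => Lam fun h =>
  Lam fun A => Lam fun a => Lam fun p =>
  extContr (c ≐ c) (LamT (c ≐ c) fun q => l ⬝ q) (idp c) h (A c)
    (LamT (c ≐ c) fun q => Tp (fun z => A z) q a)
    (LamT (c ≐ c) fun q => J (fun z q => Tp (fun z => A z) (l ⬝ q) a ≐ Tp (fun z => A z) q a) p q)
def coneBase : Tr := v 47 0

def coneBaseC : ACtx := typeFrom extContrC coneBaseT :: extContrC
theorem realized_coneBase (u : ℕ × ℕ) : Realized u coneBaseC :=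
  (realized_extContr u).cons_of_check (t := coneBaseP) (by decide +kernel)

/-- All types `cone` are contractible, since this holds at the base point of a connected type. -/
def coneContrT : Tr := Pi UU fun C => Pi C fun c => Pi (c ≐ c) fun l => upLoopT c l ⇒ connT' C c ⇒
  Pi (famT C) fun A => Pi (A c) fun a => Pi (overT c l A a) fun p =>
  Pi C fun z => isContr' (cone C c l A a p z)
def coneContrP : Tr := Lam fun C => Lam fun c => Lam fun l => Lam fun h => Lam fun n =>
  Lam fun A => Lam fun a => Lam fun p => Lam fun z =>
  trRec (propContr (cone C c l A a p z))
    (Lam fun q => Tp (fun z => isContr' (cone C c l A a p z)) q (coneBase C c l h A a p)) (n z)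
def coneContr : Tr := v 48 0

def coneContrC : ACtx := typeFrom coneBaseC coneContrT :: coneBaseC
theorem realized_coneContr (u : ℕ × ℕ) : Realized u coneContrC :=
  (realized_coneBase u).cons_of_check (t := coneContrP) (by decide +kernel)

/-- A naturality square of `k : a = b` as a path over the inverse of `k` in the family of paths `t y
= y`. -/
def overEqT : Tr := Pi UU fun X => Pi (X ⇒ X) fun t => Pi X fun a => Pi X fun b =>
  Pi (a ≐ b) fun k => Pi (t b ≐ b) fun d => Pi (t a ≐ a) fun p =>
  p ⬝ k ≐ Ap (fun x => t x) k ⬝ d ⇒ Tp (fun y => t y ≐ y) (Sym k) d ≐ p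
def overEqP : Tr := Lam fun X => Lam fun t => Lam fun a => Lam fun b => Lam fun k => Ind k <|
  Lam fun d => Lam fun p => Lam fun h => Sym (h ⬝ catId d)
def overEq : Tr := v 49 0

def overEqC : ACtx := typeFrom coneContrC overEqT :: coneContrC
theorem realized_overEq (u : ℕ × ℕ) : Realized u overEqC :=
  (realized_coneContr u).cons_of_check (t := overEqP) (by decide +kernel)

/-- The action of the identity function on paths. -/
def apIdT : Tr := Pi UU fun X => Pi X fun x => Pi X fun y => Pi (x ≐ y) fun q =>
  q ≐ Ap (fun y => y) q
def apIdP : Tr := Lam fun X => Lam fun x => Lam fun y => Lam fun q => Ind q rf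
def apId : Tr := v 50 3

def apIdC : ACtx := typeFrom overEqC apIdT :: overEqC
theorem realized_apId (u : ℕ × ℕ) : Realized u apIdC :=
  (realized_overEq u).cons_of_check (t := apIdP) (by decide +kernel)

/-- The dependent action on paths of a function `f`. -/
def apd' (c A f q : Tr) : Tr :=
  J (fun z q => Idt (A z) (Tp (fun z => A z) q (f c)) (f z)) (idp (f c)) q

/-- Paths to the values of `f` from the transports of `a` are determined by the one at the constant
path. -/
def pathsNatT : Tr := Pi UU fun C => Pi C fun c => Pi (famT C) fun A => Pi (A c) fun a =>
  Pi (Pi C fun z => A z) fun f =>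
  Pi (Pi C fun z => Pi (c ≐ z) fun q => Tp (fun z => A z) q a ≐ f z) fun k =>
  Pi C fun z => Pi (c ≐ z) fun q => k z q ≐
    Ap (fun x => Tp (fun z => A z) q x) (As (k c (idp c)) (a ≐ f c)) ⬝ apd' c A f q
def pathsNatP : Tr := Lam fun C => Lam fun c => Lam fun A => Lam fun a => Lam fun f => Lam fun k =>
  Lam fun z => Lam fun q => Ind q (apId (k c (idp c)))
def pathsNat : Tr := v 51 0

def pathsNatC : ACtx := typeFrom apIdC pathsNatT :: apIdC
theorem realized_pathsNat (u : ℕ × ℕ) : Realized u pathsNatC :=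
  (realized_apId u).cons_of_check (t := pathsNatP) (by decide +kernel)

/-- The data that make the function `f` an algebra section. -/
def algSectT (C c l A a p f : Tr) : Tr := Sig (Idt (A c) (f c) a) fun r =>
  let L := LamT (A c) fun y => Idt (A c) (Tp (fun z => A z) l y) y
  Idt (L a) (Tp (fun y => L y) r (apd' c A f l)) p

/-- The induction principle of the circle for `(C, c, l)`. -/
def circleT (C c l : Tr) : Tr := Pi (famT C) fun A => Pi (A c) fun a => Pi (overT c l A a) fun p =>
  Sig (Pi C fun z => A z) fun f => algSectT C c l A a p f

/-- A function with paths to its values from the transports of `a`, such that those at `l` and at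
the constant path correspond under `p`, is an algebra section. -/
def sectOfPathsT : Tr := Pi UU fun C => Pi C fun c => Pi (c ≐ c) fun l => Pi (famT C) fun A =>
  Pi (A c) fun a => Pi (overT c l A a) fun p => Pi (Pi C fun z => A z) fun f =>
  Pi (Pi C fun z => Pi (c ≐ z) fun q => Tp (fun z => A z) q a ≐ f z) fun k =>
  k c l ≐ p ⬝ k c (idp c) ⇒ algSectT C c l A a p f
def sectOfPathsP : Tr := Lam fun C => Lam fun c => Lam fun l => Lam fun A => Lam fun a =>
  Lam fun p => Lam fun f => Lam fun k => Lam fun h =>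
  pr (Sym (As (k c (idp c)) (a ≐ f c)))
    (overEq (A c) (Lam fun y => Tp (fun z => A z) l y) a (f c) (k c (idp c)) (apd' c A f l) p
      (Sym h ⬝ pathsNat C c A a f k c l))
def sectOfPaths : Tr := v 52 0

def sectOfPathsC : ACtx := typeFrom pathsNatC sectOfPathsT :: pathsNatC
theorem realized_sectOfPaths (u : ℕ × ℕ) : Realized u sectOfPathsC :=
  (realized_pathsNat u).cons_of_check (t := sectOfPathsP) (by decide +kernel)

/-- The universal property of the loops at a point of a connected type implies the induction
principle of the circle. -/
def circleIndT : Tr := Pi UU fun C => Pi C fun c => Pi (c ≐ c) fun l => upLoopT c l ⇒ connT' C c ⇒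
  circleT C c l
def circleIndP : Tr := Lam fun C => Lam fun c => Lam fun l => Lam fun h => Lam fun n =>
  Lam fun A => Lam fun a => Lam fun p =>
  Let (As (Lam fun z => fst (coneContr C c l h n A a p z))
    (Pi C fun z => cone C c l A a p z)) fun w =>
  pr (LamT C fun z => fst (w z)) (sectOfPaths C c l A a p (LamT C fun z => fst (w z))
    (Lam fun z => Lam fun q => fst (snd (w z)) q) (snd (snd (w c)) (idp c)))
def circleInd : Tr := v 53 0

def circleIndC : ACtx := typeFrom sectOfPathsC circleIndT :: sectOfPathsC
theorem realized_circleInd (u : ℕ × ℕ) : Realized u circleIndC :=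
  (realized_sectOfPaths u).cons_of_check (t := circleIndP) (by decide +kernel)

/-- Paths in sum types from paths over paths. -/
def sigPathT : Tr := Pi UU fun X => Pi (X ⇒ UU) fun B => Pi X fun x => Pi (B x) fun b =>
  Pi X fun x' => Pi (x ≐ x') fun r => Pi (B x') fun b' => Tp (fun x => B x) r b ≐ b' ⇒
  Idt (Sig X B) (pr x b) (pr x' b')
def sigPathP : Tr := Lam fun X => Lam fun B => Lam fun x => Lam fun b => Lam fun x' => Lam fun r =>
  Ind r <| Lam fun b' => Lam fun s => Ap (fun c => As (pr x c) (Sig X B)) s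
def sigPath : Tr := v 54 0

def sigPathC : ACtx := typeFrom circleIndC sigPathT :: circleIndC
theorem realized_sigPath (u : ℕ × ℕ) : Realized u sigPathC :=
  (realized_circleInd u).cons_of_check (t := sigPathP) (by decide +kernel)

/-- The dependent universal property of the circle for `(C, c, l)`. -/
def univT (C c l : Tr) : Tr := Pi (famT C) fun A =>
  let F := Pi C fun z => A z
  let S := Sig (A c) fun a => overT c l A a
  Sig (S ⇒ F) fun g => Pi S fun y =>
    Idt S ((LamT F fun f => As (pr (f c) (apd' c A f l)) S) (g y)) y

/-- The induction principle of the circle implies its dependent universal property. -/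
def depUnivT : Tr := Pi UU fun C => Pi C fun c => Pi (c ≐ c) fun l => circleT C c l ⇒ univT C c l
def depUnivP : Tr := Lam fun C => Lam fun c => Lam fun l => Lam fun I => Lam fun A =>
  pr (Lam fun y => fst (I A (fst y) (snd y))) <| Lam fun y => Split y fun a p =>
    let w := I A a p
    sigPath (A c) (Lam fun a => overT c l A a) (fst w c) (apd' c A (fst w) l) a (fst (snd w)) p
      (snd (snd w))
def depUniv : Tr := v 55 0

def depUnivC : ACtx := typeFrom sigPathC depUnivT :: sigPathC
theorem realized_depUniv (u : ℕ × ℕ) : Realized u depUnivC :=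
  (realized_sigPath u).cons_of_check (t := depUnivP) (by decide +kernel)

/-! ### From the universal property of the loops to that of the circle -/

/-- The preimage of `s z` under the equivalence `e`. -/
def preim (e s z : Tr) : Tr := fst (fst (e (s z)))

/-- Under the hypothesis that the loops at `c` are identified with `Z` by the equivalence `k`, so
that composition with the preimage `l` of `s z` corresponds to `s` and the constant loop to `z`, and
that `(Z, s, z)` has the recursion principle of the integers, the statement `R C c l`. -/
def loopsThen (R : Tr → Tr → Tr → Tr) : Tr :=
  Pi UU fun C => Pi C fun c => Pi UU fun Z => Pi (Z ⇒ Z) fun s => Pi Z fun z =>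
  Pi (c ≐ c ⇒ Z) fun k => Pi (isEq (c ≐ c) Z k) fun e =>
  (Pi (c ≐ c) fun l => k l ≐ s z ⇒ Pi (c ≐ c) fun q => k (l ⬝ q) ≐ s (k q)) ⇒ k (idp c) ≐ z ⇒
  recT Z s z ⇒ R C c (preim e s z)

/-- The universal property of the integers, transferred to the loops. -/
def upLoopsT : Tr := loopsThen fun _ c l => upLoopT c l
def upLoopsP : Tr := Lam fun C => Lam fun c => Lam fun Z => Lam fun s => Lam fun z => Lam fun k =>
  Lam fun e => Lam fun H => Lam fun h => Lam fun r =>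
  upTransfer k e (LamT (c ≐ c) fun q => preim e s z ⬝ q) (idp c) s z
    (H (preim e s z) (snd (fst (e (s z))))) h (upOfRec Z s z r)
def upLoops : Tr := v 56 0

def upLoopsC : ACtx := typeFrom depUnivC upLoopsT :: depUnivC
theorem realized_upLoops (u : ℕ × ℕ) : Realized u upLoopsC :=
  (realized_depUniv u).cons_of_check (t := upLoopsP) (by decide +kernel)

/-- The induction principle of the circle, from the identification of the loops with the integers.
-/
def loopsIndT : Tr := loopsThen fun C c l => connT' C c ⇒ circleT C c l
def loopsIndP : Tr := Lam fun C => Lam fun c => Lam fun Z => Lam fun s => Lam fun z => Lam fun k =>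
  Lam fun e => Lam fun H => Lam fun h => Lam fun r =>
  circleInd C c (preim e s z) (upLoops C c Z s z k e H h r)
def loopsInd : Tr := v 57 0

def loopsIndC : ACtx := typeFrom upLoopsC loopsIndT :: upLoopsC
theorem realized_loopsInd (u : ℕ × ℕ) : Realized u loopsIndC :=
  (realized_upLoops u).cons_of_check (t := loopsIndP) (by decide +kernel)

/-- The dependent universal property of the circle, from the identification of the loops with the
integers. -/
def loopsUniT : Tr := loopsThen fun C c l => connT' C c ⇒ univT C c l
def loopsUniP : Tr := Lam fun C => Lam fun c => Lam fun Z => Lam fun s => Lam fun z => Lam fun k =>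
  Lam fun e => Lam fun H => Lam fun h => Lam fun r => Lam fun n =>
  depUniv C c (preim e s z) (loopsInd C c Z s z k e H h r n)
def loopsUni : Tr := v 58 0

def loopsUniC : ACtx := typeFrom loopsIndC loopsUniT :: loopsIndC
theorem realized_loopsUni (u : ℕ × ℕ) : Realized u loopsUniC :=
  (realized_loopsInd u).cons_of_check (t := loopsUniP) (by decide +kernel)

/-! ### The loops of the type of torsors -/

/-- The application of `loopsInd` or `loopsUni` to the type of torsors, where `e` is the assumption
that `ev₀` is an equivalence. -/
def applyLoops (t : Tr) : Tr :=
  t tor pt' Zt sZ i0 (LamT lps fun q => ev pt' q) (v 59 0)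
    (Lam fun l => Lam fun h => evMul tor pt' car (Lam fun z => snd (fst z)) i0 l h pt') rf zRec conn

/-- The induction principle of the circle for the type of torsors. -/
def indP : Tr := applyLoops loopsInd
/-- The dependent universal property of the circle for the type of torsors. -/
def uniP : Tr := applyLoops loopsUni

end HoTT

namespace HoTT

open Tr Tm ATm

/-! ### The theorem -/

section

variable {u : ℕ × ℕ} {Γ : ACtx} {A : ATm} {t : Tr} {X Y e : Tm}

theorem Realized.isInhabited (h : Realized u Γ) (hc : check Γ A t = true)
    (hA : A.matchesRaw X = true) (hX : X.relabel (decodeLevel u) = Y) (hY : ∀ σ, Y.sub σ = Y) :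
    IsInhabited Y := by
  obtain ⟨hΓ, σ, hσ⟩ := h
  have h := W.realize hΓ hσ (checkAt_sound hΓ hc).2
  rw [erase_of_matchesRaw u hA, hX, hY] at h
  exact ⟨_, h⟩

/-- A raw type that is inferred in a realized context extended by a raw closed type is inhabited,
after the substitution of any element `e` of the latter. -/
theorem Realized.isInhabited_of_infersRaw (h : Realized u Γ) {Z Z' : Tm}
    (hA : (isType Γ A && A.matchesRaw Z) = true) (hZ : Z.relabel (decodeLevel u) = Z')
    (hZ' : ∀ σ, Z'.sub σ = Z') (he : HasType e Z') (hc : infersRaw (A :: Γ) t X = true)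
    (hX : ∀ σ, (X.relabel (decodeLevel u)).sub (consSub e σ) = Y) : IsInhabited Y := by
  rw [Bool.and_eq_true] at hA
  obtain ⟨hΓ, σ, hσ⟩ := h
  obtain ⟨k, hk⟩ := isType_sound hΓ hA.1
  have hΓ' : CxOK u (A :: Γ) := ⟨hΓ, k, hk⟩
  obtain ⟨a, ha⟩ := infersRaw_sound hΓ' hc
  have hσ' : SubOK (consSub e σ) (eraseCtx u (A :: Γ)) [] :=
    hσ.cons (by rw [erase_of_matchesRaw u hA.2, hZ, hZ']; exact he)
  have h := W.realize hΓ' hσ' ha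
  rw [hX] at h
  exact ⟨_, h⟩

end

theorem isInhabited_evZeroIsEquiv (u : ℕ × ℕ) : IsInhabited (evZeroIsEquiv u.1) :=
  (realized_torContr u).isInhabited (A := typeFrom torContrC evT) (t := evP)
    (X := evZeroIsEquiv 1000) (by decide +kernel) (by decide +kernel)
    (relabel_evZeroIsEquiv _ _) (fun σ => evZeroIsEquiv_sub σ _)

theorem evT_matchesRaw : (isType loopsUniC (typeFrom loopsUniC evT) &&
    (typeFrom loopsUniC evT).matchesRaw (evZeroIsEquiv 1000)) = true := by decide +kernel

theorem isInhabited_circleInduction {u : ℕ × ℕ} {e : Tm} (he : HasType e (evZeroIsEquiv u.1)) :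
    IsInhabited (circleInduction u.2 (TorZ u.1) pt (loop u.1 e)) :=
  (realized_loopsUni u).isInhabited_of_infersRaw (t := indP)
    (X := circleInduction 1001 (TorZ 1000) pt (loop 1000 (.var 0)))
    evT_matchesRaw (relabel_evZeroIsEquiv _ _) (fun σ => evZeroIsEquiv_sub σ _) he
    (by decide +kernel) fun σ => by
      rw [relabel_circleInduction, relabel_TorZ, relabel_loop, circleInduction_sub, TorZ_sub,
        loop_sub]
      rfl

theorem isInhabited_dependentUniversalProperty {u : ℕ × ℕ} {e : Tm}
    (he : HasType e (evZeroIsEquiv u.1)) :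
    IsInhabited (dependentUniversalProperty u.2 (TorZ u.1) pt (loop u.1 e)) :=
  (realized_loopsUni u).isInhabited_of_infersRaw (t := uniP)
    (X := dependentUniversalProperty 1001 (TorZ 1000) pt (loop 1000 (.var 0)))
    evT_matchesRaw (relabel_evZeroIsEquiv _ _) (fun σ => evZeroIsEquiv_sub σ _) he
    (by decide +kernel) fun σ => by
      rw [relabel_dependentUniversalProperty, relabel_TorZ, relabel_loop,
        dependentUniversalProperty_sub, TorZ_sub, loop_sub]
      rfl

end HoTT

theorem mainTheorem1 (i j : ℕ) :
    HoTT.IsInhabited (HoTT.evZeroIsEquiv i) ∧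
    ∀ e : HoTT.Tm, HoTT.HasType e (HoTT.evZeroIsEquiv i) →
      HoTT.IsInhabited (HoTT.circleInduction j (HoTT.TorZ i) HoTT.pt (HoTT.loop i e)) ∧
      HoTT.IsInhabited
        (HoTT.dependentUniversalProperty j (HoTT.TorZ i) HoTT.pt (HoTT.loop i e)) :=
  ⟨HoTT.isInhabited_evZeroIsEquiv (i, j), fun _ he =>
    ⟨HoTT.isInhabited_circleInduction (u := (i, j)) he,
      HoTT.isInhabited_dependentUniversalProperty (u := (i, j)) he⟩⟩
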